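/- **Notation.** Let $\mathbb{C}_+=\{z:\Re z>0\}$ and $w=(w_1+w_2)/2$. For $w_1,w_2\in\mathbb{C}_+$ let $G(z)=G(w_1,w_2;z)$ be the hyperbolic gamma function: for $|\Im z|<\Re w$, $$G(w_1,w_2;z)=\exp\Big(i\int_0^\infty\Big(\frac{\sin(2yz)}{2\sinh(w_1y)\sinh(w_2y)}-\frac{z}{w_1w_2y}\Big)\frac{dy}{y}\Big),$$ continued meromorphically in $z$ to $\mathbb{C}$ by $G(z+iw_1/2)=2\cosh(\pi z/w_2)\,G(z-iw_1/2)$. Write $G(z\pm a)=G(z+a)G(z-a)$. Let $\gamma=(\gamma_0,\gamma_1,\gamma_2,\gamma_3)\in\mathbb{C}^4$, and define $\rho,\sigma,\tau,\upsilon$ by $\gamma_0=-\rho+\sigma$, $\gamma_1=\rho+\sigma$, $\gamma_2=-\tau-\upsilon$, $\gamma_3=\tau-\upsilon$. The dual parameters are $$\hat\gamma_0=\tfrac12(\gamma_0+\gamma_1+\gamma_2+\gamma_3),\quad \hat\gamma_1=\tfrac12(\gamma_0+\gamma_1-\gamma_2-\gamma_3),\quad \hat\gamma_2=\tfrac12(\gamma_0-\gamma_1+\gamma_2-\gamma_3),\quad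 \hat\gamma_3=\tfrac12(\gamma_0-\gamma_1-\gamma_2+\gamma_3);$$ equivalently, $\rho$ and $\upsilon$ are interchanged. For $w_1,w_2>0$ and $x,\lambda\in\mathbb{C}$, put $\zeta=w/2-\max(|\Re\rho|,|\Re\sigma|,|\Re\tau|,|\Re\upsilon|)-|\Im(\lambda/2)|$. If $\zeta>0$ and $|\Im x|<\zeta$, define $$\psi(\gamma;x,\lambda)=\int_{\mathbb{R}}\frac{G(z+x+\lambda/2-iw/2\pm i\tau)\,G(z-\lambda/2-iw/2\pm i\sigma)}{G(z+x-\lambda/2+iw/2\pm i\rho)\,G(z+\lambda/2+iw/2\pm i\upsilon)}\,dz .$$ **Theorem (Duality).** The integral defining $\psi$ converges absolutely, and $\psi$ has a unique continuation to a meromorphic function of $(w_1,w_2,\gamma,x,\lambda)$ on $\mathcal{O}=\mathbb{C}_+^2\times\mathbb{C}^6$. With this continuation, put $$S(\gamma;x,\lambda)=\frac{N(\gamma)\,\psi(\gamma;x,\lambda)}{\sqrt{w_1w_2}\,\Delta(\gamma;x)\,\Delta(\hat\gamma;\lambda)},\quad N(\gamma)=\prod_{j=1}^3G(i\gamma_0+i\gamma_j+iw),\quad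 \Delta(\gamma;x)=\frac{G(x+i\gamma_2)G(x+i\gamma_3)}{G(x-i\gamma_0)G(x-i\gamma_1)},$$ where the square root is the principal branch. Then $S$ is a meromorphic function on $\mathcal{O}$, and $$S(\gamma;x,\lambda)=S(\hat\gamma;\lambda,x)$$ as meromorphic functions on $\mathcal{O}$. -/

import Mathlib

open MeasureTheory Set

open scoped Matrix

noncomputable section

namespace HypGamma

/-! ### Meromorphic functions of several complex variables

A meromorphic function is represented by a total function whose values on a thin set are
irrelevant: locally it is a quotient `g / h` of holomorphic functions, at the points where `h` does
not vanish, and `h` vanishes identically on no non-empty open set. Two such representatives give the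
same meromorphic function when they coincide on a dense open subset. -/

/-- `f` represents a meromorphic function on the open set `O`. -/
def IsMeromorphicOn {E : Type*} [NormedAddCommGroup E] [NormedSpace ℂ E]
    (f : E → ℂ) (O : Set E) : Prop :=
  ∀ p ∈ O, ∃ V : Set E, IsOpen V ∧ p ∈ V ∧ V ⊆ O ∧ ∃ g h : E → ℂ,
    DifferentiableOn ℂ g V ∧ DifferentiableOn ℂ h V ∧
    V ⊆ closure {q | q ∈ V ∧ h q ≠ 0} ∧
    ∀ q ∈ V, h q ≠ 0 → f q = g q / h q

/-- `f₁` and `f₂` represent the same meromorphic function on the open set `O`. -/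
def MeromorphicEqOn {E : Type*} [TopologicalSpace E] (f₁ f₂ : E → ℂ) (O : Set E) : Prop :=
  ∃ W : Set E, IsOpen W ∧ W ⊆ O ∧ O ⊆ closure W ∧ EqOn f₁ f₂ W

/-! ### The hyperbolic gamma function -/

/-- The integral `g(w₁, w₂; z)`, convergent for `|Im z| < Re ((w₁ + w₂) / 2)`. -/
def gInt (w₁ w₂ z : ℂ) : ℂ :=
  ∫ y in Ioi (0 : ℝ),
    (Complex.sin (2 * y * z) / (2 * Complex.sinh (w₁ * y) * Complex.sinh (w₂ * y))
      - z / (w₁ * w₂ * y)) / y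

/-- `exp (i g(w₁, w₂; z))`: the hyperbolic gamma function on the strip
`|Im z| < Re ((w₁ + w₂) / 2)`. -/
def GStrip (w₁ w₂ z : ℂ) : ℂ := Complex.exp (Complex.I * gInt w₁ w₂ z)

/-- The hyperbolic gamma function `G(w₁, w₂; z)` for `w₁, w₂` in the right half plane. On the strip
it is `exp (i g)`; elsewhere it is the continuation given by iterating the difference equation
`G(z + i w₁ / 2) = 2 cosh (π z / w₂) G(z - i w₁ / 2)`, where the number of steps `n` is such that
`|Im (z - i n w₁)| ≤ Re w₁ / 2`, so that `z - i n w₁` is in the strip. (At the poles of `G`, which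
are zeros of the `cosh` factors in the last denominator, the value of this function is `0`.) -/
def G (w₁ w₂ z : ℂ) : ℂ :=
  if |z.im| < ((w₁ + w₂) / 2).re then GStrip w₁ w₂ z
  else
    let n : ℤ := round (z.im / w₁.re)
    if 0 ≤ n then
      (∏ k ∈ Finset.range n.toNat,
        2 * Complex.cosh (Real.pi * (z - Complex.I * w₁ * (k + 1 / 2)) / w₂))
        * GStrip w₁ w₂ (z - Complex.I * n * w₁)
    else
      GStrip w₁ w₂ (z - Complex.I * n * w₁) /
        ∏ k ∈ Finset.range (-n).toNat,
          2 * Complex.cosh (Real.pi * (z + Complex.I * w₁ * (k + 1 / 2)) / w₂)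

/-- `G(z ± a) = G(z + a) G(z - a)`. -/
def Gpm (w₁ w₂ z a : ℂ) : ℂ := G w₁ w₂ (z + a) * G w₁ w₂ (z - a)

/-! ### Parameters

The parameters are `γ = (γ₀, γ₁, γ₂, γ₃)`, related to `(ρ, σ, τ, υ)` by
`γ₀ = -ρ + σ`, `γ₁ = ρ + σ`, `γ₂ = -τ - υ`, `γ₃ = τ - υ`. -/

def rho (γ : Fin 4 → ℂ) : ℂ := (γ 1 - γ 0) / 2
def sigma (γ : Fin 4 → ℂ) : ℂ := (γ 0 + γ 1) / 2
def tau (γ : Fin 4 → ℂ) : ℂ := (γ 3 - γ 2) / 2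
def upsilon (γ : Fin 4 → ℂ) : ℂ := -(γ 2 + γ 3) / 2

/-- The dual parameters. -/
def dual (γ : Fin 4 → ℂ) : Fin 4 → ℂ :=
  (1 / 2 : ℂ) • (!![1, 1, 1, 1; 1, 1, -1, -1; 1, -1, 1, -1; 1, -1, -1, 1] *ᵥ γ)

theorem gamma_eq (γ : Fin 4 → ℂ) :
    γ 0 = -rho γ + sigma γ ∧ γ 1 = rho γ + sigma γ ∧
      γ 2 = -tau γ - upsilon γ ∧ γ 3 = tau γ - upsilon γ := by
  refine ⟨?_, ?_, ?_, ?_⟩ <;> simp only [rho, sigma, tau, upsilon] <;> ring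

/-- Taking dual parameters amounts to interchanging `ρ` and `υ`. -/
theorem dual_interchange (γ : Fin 4 → ℂ) :
    rho (dual γ) = upsilon γ ∧ sigma (dual γ) = sigma γ ∧
      tau (dual γ) = tau γ ∧ upsilon (dual γ) = rho γ := by
  refine ⟨?_, ?_, ?_, ?_⟩ <;>
    simp [rho, sigma, tau, upsilon, dual, dotProduct, Fin.sum_univ_four] <;> ring

/-- The variables `(w₁, w₂, γ, x, λ)`. -/
abbrev Params : Type := ℂ × ℂ × (Fin 4 → ℂ) × ℂ × ℂ

/-- The full parameter domain `ℂ₊² × ℂ⁶`, with `ℂ₊` the open right half plane. -/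
def fullDomain : Set Params := {p | 0 < p.1.re ∧ 0 < p.2.1.re}

/-- `ξ`: the maximum of `|Re ρ|`, `|Re σ|`, `|Re τ|`, `|Re υ|`. -/
def xi (γ : Fin 4 → ℂ) : ℝ :=
  max (max |(rho γ).re| |(sigma γ).re|) (max |(tau γ).re| |(upsilon γ).re|)

/-- `ζ = w / 2 - ξ - |Im (λ / 2)|`, where `w = (w₁ + w₂) / 2`. -/
def zeta (w₁ w₂ : ℝ) (γ : Fin 4 → ℂ) (l : ℂ) : ℝ :=
  (w₁ + w₂) / 2 / 2 - xi γ - |(l / 2).im|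

/-! ### The formal matrix coefficient `ψ` and its renormalization `S` -/

/-- The integrand in the integral representation of `ψ(γ; x, λ)`. -/
def psiIntegrand (w₁ w₂ : ℂ) (γ : Fin 4 → ℂ) (x l z : ℂ) : ℂ :=
  let w := (w₁ + w₂) / 2
  let I := Complex.I
  (Gpm w₁ w₂ (z + x + l / 2 - I * w / 2) (I * tau γ)
      * Gpm w₁ w₂ (z - l / 2 - I * w / 2) (I * sigma γ))
    / (Gpm w₁ w₂ (z + x - l / 2 + I * w / 2) (I * rho γ)
      * Gpm w₁ w₂ (z + l / 2 + I * w / 2) (I * upsilon γ))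

/-- `f` is a meromorphic function on the full domain that is given by the (convergent) integral
`∫_ℝ psiIntegrand dz` for `w₁, w₂ > 0`, `ζ > 0` and `|Im x| < ζ`. -/
def IsPsi (f : Params → ℂ) : Prop :=
  IsMeromorphicOn f fullDomain ∧
  ∀ (w₁ w₂ : ℝ) (γ : Fin 4 → ℂ) (x l : ℂ), 0 < w₁ → 0 < w₂ →
    0 < zeta w₁ w₂ γ l → |x.im| < zeta w₁ w₂ γ l →
    Integrable (fun z : ℝ => psiIntegrand w₁ w₂ γ x l z) ∧
    f (w₁, w₂, γ, x, l) = ∫ z : ℝ, psiIntegrand w₁ w₂ γ x l z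

/-- The formal matrix coefficient `ψ`, as a meromorphic function on the full domain. -/
def psi : Params → ℂ := Classical.epsilon IsPsi

/-- `N(γ) = ∏_{j = 1}^{3} G(i γ₀ + i γⱼ + i w)`. -/
def N (w₁ w₂ : ℂ) (γ : Fin 4 → ℂ) : ℂ :=
  ∏ j : Fin 3,
    G w₁ w₂ (Complex.I * γ 0 + Complex.I * γ j.succ + Complex.I * ((w₁ + w₂) / 2))

/-- `Δ(γ; x)`. -/
def Delta (w₁ w₂ : ℂ) (γ : Fin 4 → ℂ) (x : ℂ) : ℂ :=
  (G w₁ w₂ (x + Complex.I * γ 2) * G w₁ w₂ (x + Complex.I * γ 3))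
    / (G w₁ w₂ (x - Complex.I * γ 0) * G w₁ w₂ (x - Complex.I * γ 1))

/-- `S(γ; x, λ) = N(γ) ψ(γ; x, λ) / (√(w₁ w₂) Δ(γ; x) Δ(γ̂; λ))`, with the principal branch of the
square root. -/
def S (p : Params) : ℂ :=
  match p with
  | (w₁, w₂, γ, x, l) =>
    N w₁ w₂ γ * psi (w₁, w₂, γ, x, l)
      / ((w₁ * w₂) ^ (1 / 2 : ℂ) * Delta w₁ w₂ γ x * Delta w₁ w₂ (dual γ) l)

end HypGamma

end

noncomputable section

namespace HypGamma

open Filter Topology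

/-! ### The identity theorem on convex sets, and uniqueness from real points. -/

section Identity

variable {E : Type*} [NormedAddCommGroup E] [NormedSpace ℂ E]

/-! The duality itself is a symmetry of the integrand. Dualizing interchanges `ρ` and `υ`, so
passing from `(γ, x, λ)` to `(γ̂, λ, x)` permutes the factors of the integrand up to the translation
of `z` by `(λ - x) / 2` (`psiIntegrand_dual`). For real `x` and `λ` this is a translation of the
line of integration, so `ψ(γ; x, λ) = ψ(γ̂; λ, x)` at the real parameters near a base point. A
meromorphic function on a convex domain is determined by its values at such points
(`meromorphicEqOn_of_eq_on_real`), so the equality holds everywhere. The sums `γ₀ + γⱼ` in `N` are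
self-dual, dualizing is an involution, and the two factors `Δ` trade places, so `S` inherits the
symmetry.

The substance is the meromorphic continuation of `ψ` in all variables, periods included. The
integrand is a product of eight shifted functions `G`, with poles `a j - i (k w₁ + l w₂)` and `b j +
i (k w₁ + l w₂)`, where the sum of all `b j - a j` is `2 i (w₁ + w₂)`. The integral makes sense
while the `a j` lie below and the `b j` above the real line. Let `P` be the product of the linear
factors that vanish at finitely many lower poles, and `Q` the same for upper poles. With the factor
`P` the contour can be lowered beneath every `b j`, where the integral is holomorphic in the
parameters; with the factor `Q` it can be raised instead. The product `D` of all sums of a factor of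
`P` and a factor of `Q` with opposite signs of `z` is free of `z` and has the form `α P + β Q`
(`exists_prod_add_eq`). Hence `D ψ` is holomorphic (`IsBoundedFamily.exists_continuation`), and the
local quotients glue (`exists_isPsi`).

This needs three facts on `G`, jointly in `(w₁, w₂, z)`: holomorphy above the poles, the difference
equation with `G(-z) = 1 / G(z)`, and uniform asymptotics on horizontal strips. All three rest on
`gInt_eq`: subtracting explicit kernels with the same singularity at `y = 0` splits the defining
integral into elementary `tanh` terms and a bounded remainder. In the integrand of `ψ` the Gaussian
asymptotics then cancel to exponential decay (`prod_gaussExp`). -/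

/-- A holomorphic function that vanishes at the real points of a complex line near a point of a
convex open set vanishes on the part of the line in this set. -/
theorem eq_zero_on_line {U : Set E} (hU : IsOpen U) (hc : Convex ℝ U) {k : E → ℂ}
    (hk : DifferentiableOn ℂ k U) {p v : E} (hp : p ∈ U)
    (h : ∀ᶠ t : ℝ in 𝓝 0, k (p + (t : ℂ) • v) = 0) (t : ℂ) (ht : p + t • v ∈ U) :
    k (p + t • v) = 0 := by
  set D : Set ℂ := (fun t : ℂ => p + t • v) ⁻¹' U with hD
  have hDo : IsOpen D := hU.preimage (by fun_prop)
  have hDc : Convex ℝ D := by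
    intro a ha b hb r s hr hs hrs
    have := hc ha hb hr hs hrs
    rw [hD, mem_preimage]
    convert this using 1
    have h1 : (r : ℂ) + s = 1 := by exact_mod_cast hrs
    have h2 : ∀ (c : ℝ) (x : E), c • x = (c : ℂ) • x := fun c x => rfl
    rw [h2, h2, smul_add, smul_add, smul_smul, smul_smul, add_add_add_comm, ← add_smul, h1,
      one_smul, ← add_smul]
    rfl
  have hd : DifferentiableOn ℂ (fun t : ℂ => k (p + t • v)) D :=
    hk.comp (by fun_prop) (fun x hx => hx)
  have h0 : (0 : ℂ) ∈ D := by simpa [hD] using hp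
  have hz := (hd.analyticOnNhd hDo).eqOn_zero_of_preconnected_of_frequently_eq_zero
    hDc.isPreconnected h0 ?_
  · exact hz ht
  · have h1 : ∃ᶠ t : ℝ in 𝓝[≠] (0 : ℝ), k (p + (t : ℂ) • v) = 0 :=
      (h.filter_mono nhdsWithin_le_nhds).frequently
    have h2 : Tendsto (fun t : ℝ => (t : ℂ)) (𝓝[≠] (0 : ℝ)) (𝓝[≠] (0 : ℂ)) := by
      refine tendsto_nhdsWithin_of_tendsto_nhds_of_eventually_within _ ?_ ?_
      · have : Tendsto (fun t : ℝ => (t : ℂ)) (𝓝 0) (𝓝 ((0 : ℝ) : ℂ)) :=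
          Complex.continuous_ofReal.tendsto 0
        rw [Complex.ofReal_zero] at this
        exact this.mono_left nhdsWithin_le_nhds
      · filter_upwards [self_mem_nhdsWithin] with t ht
        simpa using ht
    exact h2.frequently h1

/-- Any two points of `U` lie on a complex line, whose trace in `U` is convex, so the identity
theorem in one variable suffices. -/
theorem eq_zero_of_eventually_eq_zero {U : Set E} (hU : IsOpen U) (hc : Convex ℝ U) {k : E → ℂ}
    (hk : DifferentiableOn ℂ k U) {p : E} (hp : p ∈ U) (h : ∀ᶠ q in 𝓝 p, k q = 0) :
    ∀ q ∈ U, k q = 0 := by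
  intro q hq
  have := eq_zero_on_line hU hc hk (v := q - p) hp ?_ 1 (by simpa using hq)
  · simpa using this
  · have : Tendsto (fun t : ℝ => p + (t : ℂ) • (q - p)) (𝓝 0) (𝓝 p) := by
      have : Continuous (fun t : ℝ => p + (t : ℂ) • (q - p)) := by fun_prop
      simpa using this.tendsto 0
    exact this.eventually h

/-- A holomorphic function on a convex open set that does not vanish identically vanishes on no
non-empty open subset. -/
theorem subset_closure_ne_zero {U : Set E} (hU : IsOpen U) (hc : Convex ℝ U) {k : E → ℂ}
    (hk : DifferentiableOn ℂ k U) {p : E} (hp : p ∈ U) (h : k p ≠ 0) :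
    U ⊆ closure {q | q ∈ U ∧ k q ≠ 0} := by
  intro q hq
  by_contra hcl
  refine h (eq_zero_of_eventually_eq_zero hU hc hk hq ?_ p hp)
  have h1 : (closure {q | q ∈ U ∧ k q ≠ 0})ᶜ ∈ 𝓝 q := isClosed_closure.isOpen_compl.mem_nhds hcl
  filter_upwards [h1, hU.mem_nhds hq] with r hr hrU
  by_contra h0
  exact hr (subset_closure ⟨hrU, h0⟩)

variable [StarAddMonoid E] [StarModule ℂ E] [NormedStarGroup E]

/-- A holomorphic function that vanishes at the self-adjoint points near a self-adjoint point of a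
convex open set vanishes on this set. -/
theorem eq_zero_of_eq_zero_on_real {U : Set E} (hU : IsOpen U) (hc : Convex ℝ U) {k : E → ℂ}
    (hk : DifferentiableOn ℂ k U) {p : E} (hp : p ∈ U) (hps : star p = p)
    (h : ∀ᶠ q in 𝓝 p, star q = q → k q = 0) :
    ∀ q ∈ U, k q = 0 := by
  refine eq_zero_of_eventually_eq_zero hU hc hk hp ?_
  obtain ⟨r, hr, hball⟩ := Metric.mem_nhds_iff.1 (inter_mem h (hU.mem_nhds hp))
  have hr3 : 0 < r / 3 := by positivity
  filter_upwards [Metric.ball_mem_nhds p hr3] with q hq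
  -- Real and imaginary parts: `q = p + u + i v` with `u`, `v` self-adjoint. On the complex line
  -- through `p + u` in the direction `v` the real points are self-adjoint, and `q` is the point
  -- with parameter `i`. The radius `r / 3` keeps both the real segment and `q` in the ball of
  -- radius `r`.
  set u : E := (1 / 2 : ℂ) • ((q - p) + star (q - p)) with hu
  set v : E := (-Complex.I / 2) • ((q - p) - star (q - p)) with hv
  have hus : star u = u := by
    rw [hu, star_smul, star_add, star_star, add_comm]; simp
  have hvs : star v = v := by
    rw [hv, star_smul, star_sub, star_star, ← neg_sub (q - p), smul_neg, ← neg_smul]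
    congr 1
    simp [neg_div]
  have hn : ‖q - p‖ < r / 3 := by simpa [dist_eq_norm] using hq
  have hun : ‖u‖ < r / 3 := by
    refine lt_of_le_of_lt ?_ hn
    rw [hu, norm_smul]
    have := norm_add_le (q - p) (star (q - p))
    rw [norm_star] at this
    rw [show ‖(1 / 2 : ℂ)‖ = 1 / 2 by norm_num]
    linarith
  have hvn : ‖v‖ < r / 3 := by
    refine lt_of_le_of_lt ?_ hn
    rw [hv, norm_smul]
    have := norm_sub_le (q - p) (star (q - p))
    rw [norm_star] at this
    rw [show ‖(-Complex.I / 2 : ℂ)‖ = 1 / 2 by simp]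
    linarith
  have hq' : q = (p + u) + Complex.I • v := by
    rw [hu, hv, smul_smul]
    have : Complex.I * (-Complex.I / 2) = 1 / 2 := by
      rw [mul_div_assoc', mul_neg, Complex.I_mul_I]; norm_num
    rw [this, add_assoc, ← smul_add]
    have h2 : (q - p + star (q - p) + (q - p - star (q - p))) = (2 : ℂ) • (q - p) := by
      rw [two_smul]; abel
    rw [h2, smul_smul]; norm_num
  have hmem : ∀ x : E, ‖x - p‖ < r → x ∈ Metric.ball p r := fun x hx => by
    simpa [dist_eq_norm] using hx
  rw [hq']
  refine eq_zero_on_line (U := Metric.ball p r) Metric.isOpen_ball (convex_ball p r)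
    (hk.mono fun x hx => (hball hx).2) (hmem _ ?_) ?_ _ (hmem _ ?_)
  · rw [add_sub_cancel_left]; linarith
  · filter_upwards [Metric.ball_mem_nhds (0 : ℝ) one_pos] with t ht
    refine (hball (hmem _ ?_)).1 ?_
    · rw [add_assoc, add_sub_cancel_left]
      refine lt_of_le_of_lt (norm_add_le _ _) ?_
      rw [norm_smul (t : ℂ)]
      have : ‖(t : ℂ)‖ < 1 := by simpa using ht
      nlinarith [norm_nonneg v, norm_nonneg (t : ℂ)]
    · rw [star_add, star_add, hps, hus, star_smul, hvs]
      simp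
  · rw [add_assoc, add_sub_cancel_left]
    refine lt_of_le_of_lt (norm_add_le _ _) ?_
    rw [norm_smul Complex.I, Complex.norm_I]
    linarith

end Identity

/-! ### Calculus of meromorphic functions and their uniqueness. -/

section Meromorphic

theorem subset_closure_inter_of_isOpen {X : Type*} [TopologicalSpace X] {V V' S : Set X}
    (hV' : IsOpen V') (hVV : V' ⊆ V) (h : V ⊆ closure {q | q ∈ V ∧ q ∈ S}) :
    V' ⊆ closure {q | q ∈ V' ∧ q ∈ S} := by
  intro q hq
  rw [mem_closure_iff]
  intro o ho hqo
  obtain ⟨x, hx, hx'⟩ := mem_closure_iff.1 (h (hVV hq)) (o ∩ V') (ho.inter hV') ⟨hqo, hq⟩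
  exact ⟨x, hx.1, hx.2, hx'.2⟩

/-- Two dense sets meet densely once one of them is open; this is what allows denominators to be
multiplied. -/
theorem subset_closure_and_of_isOpen {X : Type*} [TopologicalSpace X] {V S T : Set X}
    (hS : IsOpen {q | q ∈ V ∧ q ∈ S})
    (h : V ⊆ closure {q | q ∈ V ∧ q ∈ S}) (h' : V ⊆ closure {q | q ∈ V ∧ q ∈ T}) :
    V ⊆ closure {q | q ∈ V ∧ q ∈ S ∧ q ∈ T} := by
  intro q hq
  rw [mem_closure_iff]
  intro o ho hqo
  obtain ⟨x, hx, hx'⟩ := mem_closure_iff.1 (h hq) o ho hqo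
  obtain ⟨y, hy, hy'⟩ := mem_closure_iff.1 (h' hx'.1) (o ∩ {q | q ∈ V ∧ q ∈ S})
    (ho.inter hS) ⟨hx, hx'⟩
  exact ⟨y, hy.1, hy'.1, hy.2.2, hy'.2⟩

variable {E : Type*} [NormedAddCommGroup E] [NormedSpace ℂ E]

theorem isOpen_ne_zero {V : Set E} (hV : IsOpen V) {h : E → ℂ} (hh : DifferentiableOn ℂ h V) :
    IsOpen {q | q ∈ V ∧ h q ≠ 0} :=
  hh.continuousOn.isOpen_inter_preimage hV isOpen_ne

theorem subset_closure_mul_ne_zero {V : Set E} (hV : IsOpen V) {h k : E → ℂ}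
    (hh : DifferentiableOn ℂ h V)
    (h1 : V ⊆ closure {q | q ∈ V ∧ h q ≠ 0}) (h2 : V ⊆ closure {q | q ∈ V ∧ k q ≠ 0}) :
    V ⊆ closure {q | q ∈ V ∧ h q * k q ≠ 0} := by
  have := subset_closure_and_of_isOpen (S := {q | h q ≠ 0}) (T := {q | k q ≠ 0})
    (isOpen_ne_zero hV hh) h1 h2
  simpa only [mem_ofPred_eq, mul_ne_zero_iff] using this

/-- `f` represents a meromorphic function on `O` that vanishes identically on no non-empty open
subset. -/
def IsMeromorphicUnitOn (f : E → ℂ) (O : Set E) : Prop :=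
  ∀ p ∈ O, ∃ V : Set E, IsOpen V ∧ p ∈ V ∧ V ⊆ O ∧ ∃ g h : E → ℂ,
    DifferentiableOn ℂ g V ∧ DifferentiableOn ℂ h V ∧
    V ⊆ closure {q | q ∈ V ∧ g q ≠ 0} ∧ V ⊆ closure {q | q ∈ V ∧ h q ≠ 0} ∧
    ∀ q ∈ V, h q ≠ 0 → f q = g q / h q

theorem IsMeromorphicUnitOn.isMeromorphicOn {f : E → ℂ} {O : Set E}
    (hf : IsMeromorphicUnitOn f O) : IsMeromorphicOn f O := by
  intro p hp
  obtain ⟨V, h1, h2, h3, g, h, h4, h5, -, h6, h7⟩ := hf p hp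
  exact ⟨V, h1, h2, h3, g, h, h4, h5, h6, h7⟩

theorem IsMeromorphicUnitOn.of_differentiableOn {f : E → ℂ} {O : Set E} (hO : IsOpen O)
    (hf : DifferentiableOn ℂ f O) (h0 : ∀ p ∈ O, f p ≠ 0) : IsMeromorphicUnitOn f O := by
  intro p hp
  refine ⟨O, hO, hp, subset_rfl, f, fun _ => 1, hf, by fun_prop, ?_, ?_, by simp⟩
  · exact fun q hq => subset_closure ⟨hq, h0 q hq⟩
  · exact fun q hq => subset_closure ⟨hq, one_ne_zero⟩

theorem IsMeromorphicOn.mul {f₁ f₂ : E → ℂ} {O : Set E} (hf₁ : IsMeromorphicOn f₁ O)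
    (hf₂ : IsMeromorphicOn f₂ O) : IsMeromorphicOn (fun p => f₁ p * f₂ p) O := by
  intro p hp
  obtain ⟨V, hV, hpV, hVO, g, h, hg, hh, hd, he⟩ := hf₁ p hp
  obtain ⟨V', hV', hpV', hVO', g', h', hg', hh', hd', he'⟩ := hf₂ p hp
  have hVV := hV.inter hV'
  refine ⟨V ∩ V', hVV, ⟨hpV, hpV'⟩, fun q hq => hVO hq.1, fun q => g q * g' q,
    fun q => h q * h' q, (hg.mono inter_subset_left).mul (hg'.mono inter_subset_right),
    (hh.mono inter_subset_left).mul (hh'.mono inter_subset_right), ?_, ?_⟩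
  · exact subset_closure_mul_ne_zero hVV (hh.mono inter_subset_left)
      (subset_closure_inter_of_isOpen hVV inter_subset_left hd)
      (subset_closure_inter_of_isOpen hVV inter_subset_right hd')
  · intro q hq hne
    rw [mul_ne_zero_iff] at hne
    simp only [he q hq.1 hne.1, he' q hq.2 hne.2]
    exact div_mul_div_comm _ _ _ _

theorem IsMeromorphicUnitOn.mul {f₁ f₂ : E → ℂ} {O : Set E} (hf₁ : IsMeromorphicUnitOn f₁ O)
    (hf₂ : IsMeromorphicUnitOn f₂ O) : IsMeromorphicUnitOn (fun p => f₁ p * f₂ p) O := by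
  intro p hp
  obtain ⟨V, hV, hpV, hVO, g, h, hg, hh, hn, hd, he⟩ := hf₁ p hp
  obtain ⟨V', hV', hpV', hVO', g', h', hg', hh', hn', hd', he'⟩ := hf₂ p hp
  have hVV := hV.inter hV'
  refine ⟨V ∩ V', hVV, ⟨hpV, hpV'⟩, fun q hq => hVO hq.1, fun q => g q * g' q,
    fun q => h q * h' q, (hg.mono inter_subset_left).mul (hg'.mono inter_subset_right),
    (hh.mono inter_subset_left).mul (hh'.mono inter_subset_right), ?_, ?_, ?_⟩
  · exact subset_closure_mul_ne_zero hVV (hg.mono inter_subset_left)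
      (subset_closure_inter_of_isOpen hVV inter_subset_left hn)
      (subset_closure_inter_of_isOpen hVV inter_subset_right hn')
  · exact subset_closure_mul_ne_zero hVV (hh.mono inter_subset_left)
      (subset_closure_inter_of_isOpen hVV inter_subset_left hd)
      (subset_closure_inter_of_isOpen hVV inter_subset_right hd')
  · intro q hq hne
    rw [mul_ne_zero_iff] at hne
    simp only [he q hq.1 hne.1, he' q hq.2 hne.2]
    exact div_mul_div_comm _ _ _ _

theorem IsMeromorphicUnitOn.inv {f : E → ℂ} {O : Set E} (hf : IsMeromorphicUnitOn f O) :
    IsMeromorphicUnitOn (fun p => (f p)⁻¹) O := by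
  intro p hp
  obtain ⟨V, hV, hpV, hVO, g, h, hg, hh, hn, hd, he⟩ := hf p hp
  -- The superfluous factor `h` excludes the zeros of `h`, where nothing is known about the value of
  -- `f`.
  refine ⟨V, hV, hpV, hVO, fun q => h q * h q, fun q => h q * g q, hh.mul hh, hh.mul hg,
    subset_closure_mul_ne_zero hV hh hd hd, subset_closure_mul_ne_zero hV hh hd hn, ?_⟩
  intro q hq hne
  rw [mul_ne_zero_iff] at hne
  simp only [he q hq hne.1, inv_div, mul_div_mul_left _ _ hne.1]

theorem IsMeromorphicUnitOn.div {f₁ f₂ : E → ℂ} {O : Set E} (hf₁ : IsMeromorphicUnitOn f₁ O)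
    (hf₂ : IsMeromorphicUnitOn f₂ O) : IsMeromorphicUnitOn (fun p => f₁ p / f₂ p) O := by
  simpa only [div_eq_mul_inv] using hf₁.mul hf₂.inv

variable {F : Type*} [NormedAddCommGroup F] [NormedSpace ℂ F]

/-- Openness of `T` is what carries the density of the sets where `g` and `h` do not vanish back
along `T`. -/
theorem IsMeromorphicUnitOn.comp {f : F → ℂ} {O : Set F} {O' : Set E}
    (hf : IsMeromorphicUnitOn f O) {T : E → F} (hT : Differentiable ℂ T) (hTo : IsOpenMap T)
    (hO : T ⁻¹' O = O') : IsMeromorphicUnitOn (fun p => f (T p)) O' := by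
  subst hO
  intro p hp
  obtain ⟨V, hV, hpV, hVO, g, h, hg, hh, hn, hd, he⟩ := hf (T p) hp
  refine ⟨T ⁻¹' V, hV.preimage hT.continuous, hpV, preimage_mono hVO, fun q => g (T q),
    fun q => h (T q), hg.comp hT.differentiableOn (fun q hq => hq),
    hh.comp hT.differentiableOn (fun q hq => hq), ?_, ?_, fun q hq => he (T q) hq⟩
  · exact (preimage_mono hn).trans hTo.preimage_closure_subset_closure_preimage
  · exact (preimage_mono hd).trans hTo.preimage_closure_subset_closure_preimage

theorem IsMeromorphicOn.comp {f : F → ℂ} {O : Set F} {O' : Set E}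
    (hf : IsMeromorphicOn f O) {T : E → F} (hT : Differentiable ℂ T) (hTo : IsOpenMap T)
    (hO : T ⁻¹' O = O') : IsMeromorphicOn (fun p => f (T p)) O' := by
  subst hO
  intro p hp
  obtain ⟨V, hV, hpV, hVO, g, h, hg, hh, hd, he⟩ := hf (T p) hp
  exact ⟨T ⁻¹' V, hV.preimage hT.continuous, hpV, preimage_mono hVO, fun q => g (T q),
    fun q => h (T q), hg.comp hT.differentiableOn (fun q hq => hq),
    hh.comp hT.differentiableOn (fun q hq => hq),
    (preimage_mono hd).trans hTo.preimage_closure_subset_closure_preimage,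
    fun q hq => he (T q) hq⟩

/-- Two meromorphic functions have, near each point, a common form `g₁ / h`, `g₂ / h` on a ball. -/
theorem exists_ball_common_denominator {f₁ f₂ : E → ℂ} {O : Set E} (hf₁ : IsMeromorphicOn f₁ O)
    (hf₂ : IsMeromorphicOn f₂ O) {p : E} (hp : p ∈ O) :
    ∃ r > 0, Metric.ball p r ⊆ O ∧ ∃ g₁ g₂ h : E → ℂ,
      DifferentiableOn ℂ g₁ (Metric.ball p r) ∧ DifferentiableOn ℂ g₂ (Metric.ball p r) ∧
      DifferentiableOn ℂ h (Metric.ball p r) ∧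
      Metric.ball p r ⊆ closure {q | q ∈ Metric.ball p r ∧ h q ≠ 0} ∧
      ∀ q ∈ Metric.ball p r, h q ≠ 0 → f₁ q = g₁ q / h q ∧ f₂ q = g₂ q / h q := by
  obtain ⟨V, hV, hpV, hVO, g, h, hg, hh, hd, he⟩ := hf₁ p hp
  obtain ⟨V', hV', hpV', hVO', g', h', hg', hh', hd', he'⟩ := hf₂ p hp
  obtain ⟨r, hr, hb⟩ := Metric.mem_nhds_iff.1 ((hV.inter hV').mem_nhds ⟨hpV, hpV'⟩)
  have hb1 : Metric.ball p r ⊆ V := hb.trans inter_subset_left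
  have hb2 : Metric.ball p r ⊆ V' := hb.trans inter_subset_right
  refine ⟨r, hr, hb1.trans hVO, fun q => g q * h' q, fun q => g' q * h q, fun q => h q * h' q,
    (hg.mono hb1).mul (hh'.mono hb2), (hg'.mono hb2).mul (hh.mono hb1),
    (hh.mono hb1).mul (hh'.mono hb2), ?_, ?_⟩
  · exact subset_closure_mul_ne_zero Metric.isOpen_ball (hh.mono hb1)
      (subset_closure_inter_of_isOpen Metric.isOpen_ball hb1 hd)
      (subset_closure_inter_of_isOpen Metric.isOpen_ball hb2 hd')
  · intro q hq hne
    rw [mul_ne_zero_iff] at hne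
    rw [he q (hb1 hq) hne.1, he' q (hb2 hq) hne.2]
    refine ⟨?_, ?_⟩
    · exact (mul_div_mul_right _ _ hne.2).symm
    · simp only [mul_comm (h q), mul_div_mul_right _ _ hne.1]

variable [StarAddMonoid E] [StarModule ℂ E] [NormedStarGroup E]

/-- Meromorphic functions on a convex open set that agree at the self-adjoint points near one
self-adjoint point are the same. -/
theorem meromorphicEqOn_of_eq_on_real {f₁ f₂ : E → ℂ} {O : Set E}
    (hc : Convex ℝ O) (hf₁ : IsMeromorphicOn f₁ O) (hf₂ : IsMeromorphicOn f₂ O) {p : E}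
    (hp : p ∈ O) (hps : star p = p) (h : ∀ᶠ q in 𝓝 p, star q = q → f₁ q = f₂ q) :
    MeromorphicEqOn f₁ f₂ O := by
  set W : Set E := interior {q | q ∈ O ∧ f₁ q = f₂ q} with hW
  -- Agreement on a ball is expressed by `h * (g₁ - g₂) = 0`; with the factor `h` the equation can
  -- be checked also at zeros of `h`, where the values of the representatives are arbitrary.
  have key : ∀ q ∈ O, ∀ r > 0, ∀ g₁ g₂ h : E → ℂ,
      DifferentiableOn ℂ h (Metric.ball q r) → Metric.ball q r ⊆ O →
      Metric.ball q r ⊆ closure {s | s ∈ Metric.ball q r ∧ h s ≠ 0} →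
      (∀ s ∈ Metric.ball q r, h s ≠ 0 → f₁ s = g₁ s / h s ∧ f₂ s = g₂ s / h s) →
      (∀ s ∈ Metric.ball q r, h s * (g₁ s - g₂ s) = 0) → Metric.ball q r ⊆ closure W := by
    intro q hq r hr g₁ g₂ h hh hbO hd he hz
    refine hd.trans (closure_mono ?_)
    refine interior_maximal ?_ (isOpen_ne_zero Metric.isOpen_ball hh)
    intro s hs
    refine ⟨hbO hs.1, ?_⟩
    rw [(he s hs.1 hs.2).1, (he s hs.1 hs.2).2]
    have := (mul_eq_zero.1 (hz s hs.1)).resolve_left hs.2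
    rw [sub_eq_zero.1 this]
  -- Connectedness: the points near which agreement is dense form an open set that contains `p` and
  -- is closed in `O`.
  have hsub : O ⊆ interior (closure W) := by
    refine hc.isPreconnected.subset_of_closure_inter_subset isOpen_interior ?_ ?_
    · obtain ⟨r, hr, hbO, g₁, g₂, k, hg₁, hg₂, hk, hd, he⟩ :=
        exists_ball_common_denominator hf₁ hf₂ hp
      refine ⟨p, hp, ?_⟩
      refine interior_maximal (key p hp r hr g₁ g₂ k hk hbO hd he ?_) Metric.isOpen_ball
        (Metric.mem_ball_self hr)
      refine eq_zero_of_eq_zero_on_real Metric.isOpen_ball (convex_ball p r)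
        (hk.mul (hg₁.sub hg₂)) (Metric.mem_ball_self hr) hps ?_
      filter_upwards [h, Metric.ball_mem_nhds p hr] with q hq hqb hqs
      by_cases h0 : k q = 0
      · simp [h0]
      · have h1 := hq hqs
        rw [(he q hqb h0).1, (he q hqb h0).2, div_left_inj' h0] at h1
        simp [h1]
    · rintro q ⟨hq, hqO⟩
      obtain ⟨r, hr, hbO, g₁, g₂, k, hg₁, hg₂, hk, hd, he⟩ :=
        exists_ball_common_denominator hf₁ hf₂ hqO
      refine interior_maximal (key q hqO r hr g₁ g₂ k hk hbO hd he ?_) Metric.isOpen_ball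
        (Metric.mem_ball_self hr)
      obtain ⟨s, hsb, hs⟩ := mem_closure_iff.1 hq _ Metric.isOpen_ball (Metric.mem_ball_self hr)
      obtain ⟨t, htb, ht⟩ := mem_closure_iff.1 (interior_subset hs) _ Metric.isOpen_ball hsb
      refine eq_zero_of_eventually_eq_zero Metric.isOpen_ball (convex_ball q r)
        (hk.mul (hg₁.sub hg₂)) htb ?_
      filter_upwards [isOpen_interior.mem_nhds ht, Metric.isOpen_ball.mem_nhds htb] with u hu hub
      by_cases h0 : k u = 0
      · simp [h0]
      · have h1 := (interior_subset hu).2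
        rw [(he u hub h0).1, (he u hub h0).2, div_left_inj' h0] at h1
        simp [h1]
  exact ⟨W, isOpen_interior, fun q hq => (interior_subset hq).1, hsub.trans interior_subset,
    fun q hq => (interior_subset hq).2⟩

end Meromorphic

/-! ### Holomorphic dependence of integrals on several parameters. -/

section ParametricIntegral

variable {E : Type*} [NormedAddCommGroup E] [NormedSpace ℂ E] [FiniteDimensional ℂ E]
  {α : Type*} [MeasurableSpace α] {μ : Measure α}

/-- Each directional derivative is a limit of a sequence of difference quotients, and finitely many
of them determine the derivative. -/
theorem aestronglyMeasurable_fderiv {F : E → α → ℂ} {U : Set E} (hU : IsOpen U)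
    (hd : ∀ᵐ a ∂μ, DifferentiableOn ℂ (F · a) U) (hm : ∀ p ∈ U, AEStronglyMeasurable (F p) μ)
    {p : E} (hp : p ∈ U) : AEStronglyMeasurable (fun a => fderiv ℂ (F · a) p) μ := by
  have key : ∀ v : E, AEStronglyMeasurable (fun a => fderiv ℂ (F · a) p v) μ := by
    intro v
    have hcont : Tendsto (fun t : ℝ => p + (t : ℂ) • v) (𝓝 0) (𝓝 p) := by
      have : Continuous (fun t : ℝ => p + (t : ℂ) • v) := by fun_prop
      simpa using this.tendsto 0
    obtain ⟨δ, hδ, hδU⟩ := Metric.eventually_nhds_iff.1 (hcont.eventually (hU.mem_nhds hp))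
    set t : ℕ → ℝ := fun n => (δ / 2) / (n + 1) with ht
    have htpos : ∀ n, 0 < t n := fun n => by positivity
    have htlt : ∀ n, t n < δ := fun n => by
      have : t n ≤ δ / 2 := div_le_self (by positivity) (by
        have : (0 : ℝ) ≤ n := Nat.cast_nonneg n
        linarith)
      linarith
    have htU : ∀ n, p + (t n : ℂ) • v ∈ U := fun n => hδU (by
      simpa [abs_of_pos (htpos n)] using htlt n)
    have ht0 : Tendsto t atTop (𝓝 0) := by
      have := (tendsto_one_div_add_atTop_nhds_zero_nat (𝕜 := ℝ)).const_mul (δ / 2)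
      simpa [ht, div_eq_mul_inv] using this
    refine aestronglyMeasurable_of_tendsto_ae atTop
      (f := fun n a => ((t n : ℂ))⁻¹ * (F (p + (t n : ℂ) • v) a - F p a)) ?_ ?_
    · intro n
      exact ((hm _ (htU n)).sub (hm p hp)).const_mul _
    · filter_upwards [hd] with a ha
      have h1 : HasFDerivAt (F · a) (fderiv ℂ (F · a) p) p :=
        (ha.differentiableAt (hU.mem_nhds hp)).hasFDerivAt
      have h2 := h1.hasLineDerivAt v
      have h3 := h2.tendsto_slope_zero
      have h4 : Tendsto (fun n => (t n : ℂ)) atTop (𝓝[≠] 0) := by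
        refine tendsto_nhdsWithin_of_tendsto_nhds_of_eventually_within _ ?_ ?_
        · have := (Complex.continuous_ofReal.tendsto 0).comp ht0
          simpa [Function.comp_def] using this
        · exact Eventually.of_forall fun n => by simpa using (htpos n).ne'
      simpa only [Function.comp_def, smul_eq_mul] using h3.comp h4
  set b := Module.finBasis ℂ E
  have hsum : (fun a => fderiv ℂ (F · a) p) = fun a => ∑ i,
      (fderiv ℂ (F · a) p (b i)) • (LinearMap.toContinuousLinearMap (b.coord i)) := by
    funext a
    ext x
    conv_lhs => rw [← b.sum_repr x, map_sum]
    simp only [map_smul, smul_eq_mul, mul_comm, sum_apply,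
      smul_apply, LinearMap.coe_toContinuousLinearMap', Module.Basis.coord_apply]
  rw [hsum]
  refine Finset.aestronglyMeasurable_fun_sum _ fun i _ => ?_
  exact (key (b i)).smul_const _

/-- A locally uniform integrable bound for `F` alone is enough, because Cauchy's estimate on balls
of radius `r / 2` turns it into one for the derivative. -/
theorem differentiableOn_integral {F : E → α → ℂ} {U : Set E} (hU : IsOpen U)
    (hd : ∀ᵐ a ∂μ, DifferentiableOn ℂ (F · a) U) (hm : ∀ p ∈ U, AEStronglyMeasurable (F p) μ)
    (hb : ∀ p ∈ U, ∃ s ∈ 𝓝 p, ∃ bound : α → ℝ, Integrable bound μ ∧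
      ∀ᵐ a ∂μ, ∀ q ∈ s, ‖F q a‖ ≤ bound a) :
    DifferentiableOn ℂ (fun p => ∫ a, F p a ∂μ) U := by
  intro p hp
  obtain ⟨s, hs, bound, hbi, hbound⟩ := hb p hp
  obtain ⟨r, hr, hball⟩ := Metric.mem_nhds_iff.1 (inter_mem hs (hU.mem_nhds hp))
  have hr2 : 0 < r / 2 := by positivity
  have hsub : ∀ q ∈ Metric.ball p (r / 2), Metric.ball q (r / 2) ⊆ Metric.ball p r :=
    fun q hq => Metric.ball_subset_ball' (by
      have : dist q p < r / 2 := hq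
      linarith)
  refine (hasFDerivAt_integral_of_dominated_of_fderiv_le (s := Metric.ball p (r / 2))
    (F' := fun q a => fderiv ℂ (F · a) q) (bound := fun a => 2 * bound a / (r / 2))
    (Metric.ball_mem_nhds p hr2) ?_ ?_ ?_ ?_ ?_ ?_).differentiableAt.differentiableWithinAt
  · filter_upwards [hU.mem_nhds hp] with q hq using hm q hq
  · refine hbi.mono' (hm p hp) ?_
    filter_upwards [hbound] with a ha using ha p (hball (Metric.mem_ball_self hr)).1
  · exact aestronglyMeasurable_fderiv hU hd hm hp
  · filter_upwards [hbound, hd] with a ha hda q hq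
    refine Complex.norm_fderiv_le_div_of_mapsTo_ball
      (hda.mono fun x hx => (hball (hsub q hq hx)).2) ?_ hr2
    intro x hx
    rw [Metric.mem_closedBall, dist_eq_norm]
    refine (norm_sub_le _ _).trans ?_
    have h1 := ha x (hball (hsub q hq hx)).1
    have h2 := ha q (hball (hsub q hq (Metric.mem_ball_self hr2))).1
    linarith
  · exact (hbi.const_mul 2).div_const _
  · filter_upwards [hd] with a ha q hq
    exact (ha.differentiableAt (hU.mem_nhds
      (hball (hsub q hq (Metric.mem_ball_self hr2))).2)).hasFDerivAt

end ParametricIntegral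

/-! ### Integrals of decaying functions over horizontal lines. -/

section Contour

theorem integrable_exp_neg_abs {c : ℝ} (hc : 0 < c) :
    Integrable (fun t : ℝ => Real.exp (-(c * |t|))) := by
  rw [← integrableOn_univ, ← Iic_union_Ioi (a := (0 : ℝ)), integrableOn_union]
  constructor
  · refine (integrableOn_exp_mul_Iic hc 0).congr_fun (fun t ht => ?_) measurableSet_Iic
    simp [abs_of_nonpos (show t ≤ 0 from ht)]
  · refine (exp_neg_integrableOn_Ioi 0 hc).congr_fun (fun t ht => ?_) measurableSet_Ioi
    simp [abs_of_pos (show 0 < t from ht)]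

theorem integrable_of_continuous_of_decay {φ : ℝ → ℂ} (hφ : Continuous φ) {C c X : ℝ} (hc : 0 < c)
    (h : ∀ t : ℝ, X ≤ |t| → ‖φ t‖ ≤ C * Real.exp (-(c * |t|))) : Integrable φ := by
  obtain ⟨B, hB⟩ := (isCompact_Icc (a := -X) (b := X)).exists_bound_of_continuousOn hφ.continuousOn
  refine ((integrable_exp_neg_abs hc).const_mul (max C (B * Real.exp (c * X)))).mono'
    hφ.aestronglyMeasurable (Eventually.of_forall fun t => ?_)
  rcases le_or_gt X |t| with ht | ht
  · exact (h t ht).trans (mul_le_mul_of_nonneg_right (le_max_left _ _) (Real.exp_nonneg _))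
  · have h1 := hB t (abs_le.1 ht.le)
    have hB0 : 0 ≤ B := (norm_nonneg _).trans h1
    refine h1.trans ((?_ : B ≤ B * Real.exp (c * X) * Real.exp (-(c * |t|))).trans
      (mul_le_mul_of_nonneg_right (le_max_right _ _) (Real.exp_nonneg _)))
    rw [mul_assoc, ← Real.exp_add]
    refine le_mul_of_one_le_right hB0 (Real.one_le_exp ?_)
    nlinarith

/-- The integral of a decaying holomorphic function over a horizontal line does not depend on the
line. -/
theorem integral_horizontal_eq {Φ : ℂ → ℂ} {a b C c X : ℝ} (hab : a ≤ b) (hc : 0 < c)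
    (hd : ∀ z : ℂ, a ≤ z.im → z.im ≤ b → DifferentiableAt ℂ Φ z)
    (hdec : ∀ z : ℂ, a ≤ z.im → z.im ≤ b → X ≤ |z.re| → ‖Φ z‖ ≤ C * Real.exp (-(c * |z.re|))) :
    ∫ t : ℝ, Φ (t + a * Complex.I) = ∫ t : ℝ, Φ (t + b * Complex.I) := by
  have hline : ∀ y : ℝ, a ≤ y → y ≤ b → Integrable (fun t : ℝ => Φ (t + y * Complex.I)) := by
    intro y hay hyb
    refine integrable_of_continuous_of_decay (C := C) (X := X) ?_ hc ?_
    · refine continuous_iff_continuousAt.2 fun t => ?_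
      have h1 : ContinuousAt Φ (t + y * Complex.I) :=
        (hd _ (by simpa using hay) (by simpa using hyb)).continuousAt
      exact ContinuousAt.comp (f := fun t : ℝ => (t : ℂ) + y * Complex.I) h1 (by fun_prop)
    · intro t ht
      simpa using hdec (t + y * Complex.I) (by simpa using hay) (by simpa using hyb)
        (by simpa using ht)
  have hrect : ∀ T : ℝ, (∫ x : ℝ in -T..T, Φ (x + a * Complex.I)) -
      (∫ x : ℝ in -T..T, Φ (x + b * Complex.I)) =
      Complex.I • (∫ y : ℝ in a..b, Φ ((-T : ℝ) + y * Complex.I)) -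
      Complex.I • (∫ y : ℝ in a..b, Φ (T + y * Complex.I)) := by
    intro T
    have := Complex.integral_boundary_rect_eq_zero_of_differentiableOn Φ ⟨-T, a⟩ ⟨T, b⟩ ?_
    · simp only at this
      linear_combination this
    · intro z hz
      have := hz.2
      simp only [mem_preimage, uIcc_of_le hab] at this
      exact (hd z this.1 this.2).differentiableWithinAt
  have hside : ∀ s : ℝ → ℝ, (∀ T, |s T| = |T|) →
      Tendsto (fun T : ℝ => Complex.I • ∫ y : ℝ in a..b, Φ ((s T : ℝ) + y * Complex.I)) atTop
        (𝓝 0) := by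
    intro s hs
    have hlim : Tendsto (fun T : ℝ => C * Real.exp (-(c * T)) * |b - a|) atTop (𝓝 0) := by
      have h1 : Tendsto (fun T : ℝ => Real.exp (-(c * T))) atTop (𝓝 0) :=
        Real.tendsto_exp_neg_atTop_nhds_zero.comp (tendsto_id.const_mul_atTop hc)
      simpa using (h1.const_mul C).mul_const |b - a|
    refine squeeze_zero_norm' ?_ hlim
    filter_upwards [eventually_ge_atTop (max X 0)] with T hT
    have hT0 : 0 ≤ T := (le_max_right _ _).trans hT
    rw [norm_smul, Complex.norm_I, one_mul]
    refine intervalIntegral.norm_integral_le_of_norm_le_const fun y hy => ?_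
    rw [uIoc_of_le hab] at hy
    have h1 := hdec ((s T : ℝ) + y * Complex.I) (by simpa using hy.1.le) (by simpa using hy.2)
      (by simpa [hs T, abs_of_nonneg hT0] using (le_max_left _ _).trans hT)
    simpa [hs T, abs_of_nonneg hT0] using h1
  have hA := intervalIntegral_tendsto_integral (hline a le_rfl hab) tendsto_neg_atTop_atBot
    tendsto_id
  have hB := intervalIntegral_tendsto_integral (hline b hab le_rfl) tendsto_neg_atTop_atBot
    tendsto_id
  have h0 := (hside (fun T => -T) fun T => abs_neg T).sub (hside (fun T => T) fun T => rfl)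
  have h1 := hA.sub hB
  simp only [id] at h1
  rw [funext hrect] at h1
  rw [sub_zero] at h0
  exact sub_eq_zero.1 (tendsto_nhds_unique h1 h0)

end Contour

/-! ### Elementary bounds for trigonometric and hyperbolic functions. -/

section Bounds

theorem norm_cos_le (z : ℂ) : ‖Complex.cos z‖ ≤ Real.exp |z.im| := by
  rw [Complex.cos, norm_div]
  have h := norm_add_le (Complex.exp (z * Complex.I)) (Complex.exp (-z * Complex.I))
  rw [Complex.norm_exp, Complex.norm_exp] at h
  have h1 : Real.exp (z * Complex.I).re ≤ Real.exp |z.im| :=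
    Real.exp_le_exp.2 (by simpa using neg_le_abs z.im)
  have h2 : Real.exp (-z * Complex.I).re ≤ Real.exp |z.im| :=
    Real.exp_le_exp.2 (by simpa using le_abs_self z.im)
  rw [Complex.norm_two, div_le_iff₀ two_pos]
  linarith

theorem norm_sin_le (z : ℂ) : ‖Complex.sin z‖ ≤ Real.exp |z.im| := by
  rw [Complex.sin, norm_div, norm_mul, Complex.norm_I, mul_one]
  have h := norm_sub_le (Complex.exp (-z * Complex.I)) (Complex.exp (z * Complex.I))
  rw [Complex.norm_exp, Complex.norm_exp] at h
  have h1 : Real.exp (z * Complex.I).re ≤ Real.exp |z.im| :=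
    Real.exp_le_exp.2 (by simpa using neg_le_abs z.im)
  have h2 : Real.exp (-z * Complex.I).re ≤ Real.exp |z.im| :=
    Real.exp_le_exp.2 (by simpa using le_abs_self z.im)
  rw [Complex.norm_two, div_le_iff₀ two_pos]
  linarith

theorem norm_sin_le_mul (z : ℂ) : ‖Complex.sin z‖ ≤ ‖z‖ * Real.exp |z.im| := by
  have hconv : Convex ℝ {x : ℂ | |x.im| ≤ |z.im|} := by
    have : {x : ℂ | |x.im| ≤ |z.im|} = Complex.imLm ⁻¹' (Icc (-|z.im|) |z.im|) := by
      ext x; simp [abs_le]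
    rw [this]
    exact (convex_Icc _ _).linear_preimage _
  have := hconv.norm_image_sub_le_of_norm_deriv_le (𝕜 := ℂ) (f := Complex.sin) (x := 0) (y := z)
    (C := Real.exp |z.im|) (fun x _ => Complex.differentiable_sin x) ?_ (by simp) (by simp)
  · simpa [mul_comm] using this
  · intro x hx
    rw [Complex.deriv_sin]
    exact (norm_cos_le x).trans (Real.exp_le_exp.2 hx)

theorem sinh_re_le_norm_sinh (z : ℂ) : Real.sinh z.re ≤ ‖Complex.sinh z‖ := by
  rw [Real.sinh_eq, Complex.sinh, norm_div, Complex.norm_two]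
  have h := norm_sub_norm_le (Complex.exp z) (Complex.exp (-z))
  rw [Complex.norm_exp, Complex.norm_exp, Complex.neg_re] at h
  gcongr

/-- A single bound for `x / sinh x` that serves both near `0` and at infinity; it amounts to `1 + 2
x ≤ exp (2 x)`. -/
theorem le_sinh_mul {x : ℝ} (hx : 0 ≤ x) :
    x ≤ Real.sinh x * ((1 + 2 * x) * Real.exp (-x)) := by
  have h1 : 1 + 2 * x ≤ Real.exp x * Real.exp x := by
    rw [← Real.exp_add, ← two_mul]
    linarith [Real.add_one_le_exp (2 * x)]
  have h2 : Real.exp x * Real.exp (-x) = 1 := by rw [← Real.exp_add]; simp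
  have h3 : Real.sinh x * ((1 + 2 * x) * Real.exp (-x)) =
      (1 + 2 * x) * (1 - Real.exp (-x) * Real.exp (-x)) / 2 := by
    rw [Real.sinh_eq]
    linear_combination (1 + 2 * x) / 2 * h2
  have h4 : Real.exp (-x) * Real.exp (-x) * (1 + 2 * x) ≤ 1 := by
    calc Real.exp (-x) * Real.exp (-x) * (1 + 2 * x)
        ≤ Real.exp (-x) * Real.exp (-x) * (Real.exp x * Real.exp x) := by gcongr
      _ = 1 := by linear_combination (Real.exp x * Real.exp (-x) + 1) * h2
  rw [h3]
  linarith

theorem sinh_ne_zero_of_re_pos {z : ℂ} (hz : 0 < z.re) : Complex.sinh z ≠ 0 := by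
  intro h
  have := sinh_re_le_norm_sinh z
  rw [h, norm_zero] at this
  exact absurd (Real.sinh_pos_iff.2 hz) (not_lt.2 this)

theorem inv_norm_sinh_le {w : ℂ} (hw : 0 < w.re) {y : ℝ} (hy : 0 < y) :
    y * ‖Complex.sinh (w * y)‖⁻¹ ≤
      (1 / w.re) * ((1 + 2 * (w.re * y)) * Real.exp (-(w.re * y))) := by
  have hre : (w * y).re = w.re * y := by simp
  have hpos : 0 < w.re * y := mul_pos hw hy
  have h1 := sinh_re_le_norm_sinh (w * y)
  rw [hre] at h1
  have h2 := le_sinh_mul hpos.le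
  have h3 : 0 < Real.sinh (w.re * y) := Real.sinh_pos_iff.2 hpos
  have h4 : 0 ≤ (1 + 2 * (w.re * y)) * Real.exp (-(w.re * y)) := by positivity
  rw [← div_eq_mul_inv, div_le_iff₀ (h3.trans_le h1)]
  calc y = (1 / w.re) * (w.re * y) := by field_simp
    _ ≤ (1 / w.re) * (Real.sinh (w.re * y) *
        ((1 + 2 * (w.re * y)) * Real.exp (-(w.re * y)))) := by gcongr
    _ ≤ (1 / w.re) * (‖Complex.sinh (w * y)‖ *
        ((1 + 2 * (w.re * y)) * Real.exp (-(w.re * y)))) := by gcongr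
    _ = _ := by ring

theorem integrableOn_one_add_mul_exp {a b : ℝ} (ha : 0 < a) :
    IntegrableOn (fun y : ℝ => (1 + b * y) * Real.exp (-(a * y))) (Ioi 0) := by
  have h1 : IntegrableOn (fun y : ℝ => Real.exp (-(a * y))) (Ioi 0) := by
    simpa using exp_neg_integrableOn_Ioi 0 ha
  have h2 : IntegrableOn (fun y : ℝ => Real.exp (-(a / 2 * y))) (Ioi 0) := by
    simpa using exp_neg_integrableOn_Ioi 0 (half_pos ha)
  have h3 : IntegrableOn (fun y : ℝ => y * Real.exp (-(a * y))) (Ioi 0) := by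
    refine (h2.const_mul (2 / a)).mono' ?_ ?_
    · exact (by fun_prop : Continuous fun y : ℝ => y * Real.exp (-(a * y))).aestronglyMeasurable
    · filter_upwards [ae_restrict_mem measurableSet_Ioi] with y hy
      have hy0 : 0 < y := hy
      rw [Real.norm_of_nonneg (by positivity)]
      have h4 : a / 2 * y ≤ Real.exp (a / 2 * y) := by
        linarith [Real.add_one_le_exp (a / 2 * y)]
      calc y * Real.exp (-(a * y)) = 2 / a * (a / 2 * y) * Real.exp (-(a * y)) := by field_simp
        _ ≤ 2 / a * Real.exp (a / 2 * y) * Real.exp (-(a * y)) := by gcongr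
        _ = 2 / a * Real.exp (-(a / 2 * y)) := by rw [mul_assoc, ← Real.exp_add]; congr 2; ring
  refine (h1.add (h3.const_mul b)).congr_fun (fun y _ => ?_) measurableSet_Ioi
  simp only [Pi.add_apply]; ring

end Bounds

/-! ### The sine transform of `1 / sinh`. -/

section SineTransform

theorem norm_sin_div_sinh_le (z : ℂ) {y : ℝ} (hy : 0 < y) :
    ‖Complex.sin (2 * y * z) / Complex.sinh y‖ ≤
      2 * ‖z‖ * ((1 + 2 * y) * Real.exp (-((1 - 2 * |z.im|) * y))) := by
  have h1 := norm_sin_le_mul (2 * y * z)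
  have h2 := inv_norm_sinh_le (w := 1) (by simp) hy
  have him : |(2 * (y : ℂ) * z).im| = 2 * |z.im| * y := by
    have : (2 * (y : ℂ) * z).im = 2 * y * z.im := by
      rw [show (2 * (y : ℂ) * z) = ((2 * y : ℝ) : ℂ) * z by push_cast; ring, Complex.im_ofReal_mul]
    rw [this, abs_mul, abs_of_pos (by positivity : 0 < 2 * y)]; ring
  have hn : ‖2 * (y : ℂ) * z‖ = 2 * y * ‖z‖ := by
    simp [abs_of_pos hy]
  rw [him, hn] at h1
  simp only [one_mul, Complex.one_re, div_one] at h2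
  rw [norm_div, div_eq_mul_inv]
  calc ‖Complex.sin (2 * y * z)‖ * ‖Complex.sinh y‖⁻¹
      ≤ 2 * y * ‖z‖ * Real.exp (2 * |z.im| * y) * ‖Complex.sinh y‖⁻¹ := by gcongr
    _ = 2 * ‖z‖ * Real.exp (2 * |z.im| * y) * (y * ‖Complex.sinh y‖⁻¹) := by ring
    _ ≤ 2 * ‖z‖ * Real.exp (2 * |z.im| * y) * ((1 + 2 * y) * Real.exp (-y)) := by gcongr
    _ = 2 * ‖z‖ * ((1 + 2 * y) * (Real.exp (2 * |z.im| * y) * Real.exp (-y))) := by ring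
    _ = _ := by rw [← Real.exp_add]; congr 3; ring_nf

theorem continuousOn_sin_div_sinh (z : ℂ) :
    ContinuousOn (fun y : ℝ => Complex.sin (2 * y * z) / Complex.sinh y) (Ioi 0) := by
  refine ContinuousOn.div (by fun_prop) (by fun_prop) fun y hy => ?_
  exact sinh_ne_zero_of_re_pos (by simpa using hy)

theorem integrableOn_sin_div_sinh {z : ℂ} (hz : |z.im| < 1 / 2) :
    IntegrableOn (fun y : ℝ => Complex.sin (2 * y * z) / Complex.sinh y) (Ioi 0) := by
  refine ((integrableOn_one_add_mul_exp (a := 1 - 2 * |z.im|) (b := 2) (by linarith)).const_mul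
    (2 * ‖z‖)).mono' ((continuousOn_sin_div_sinh z).aestronglyMeasurable measurableSet_Ioi) ?_
  filter_upwards [ae_restrict_mem measurableSet_Ioi] with y hy
  exact norm_sin_div_sinh_le z hy

theorem integral_exp_mul_sin {z : ℂ} (hz : |z.im| < 1 / 2) (k : ℕ) :
    IntegrableOn (fun y : ℝ => 2 * Complex.exp (-((2 * k + 1) * y)) * Complex.sin (2 * y * z))
      (Ioi 0) ∧
    ∫ y in Ioi (0 : ℝ), 2 * Complex.exp (-((2 * k + 1) * y)) * Complex.sin (2 * y * z) =
      -Complex.I * (1 / ((2 * k + 1) - 2 * Complex.I * z) -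
        1 / ((2 * k + 1) + 2 * Complex.I * z)) := by
  have hk : (0 : ℝ) ≤ k := Nat.cast_nonneg k
  have h := abs_lt.1 hz
  have e1 : (-(2 * k + 1) + 2 * Complex.I * z).re < 0 := by simp; linarith
  have e2 : (-(2 * k + 1) - 2 * Complex.I * z).re < 0 := by simp; linarith
  have hf : ∀ y : ℝ, 2 * Complex.exp (-((2 * k + 1) * y)) * Complex.sin (2 * y * z) =
      -Complex.I * (Complex.exp ((-(2 * k + 1) + 2 * Complex.I * z) * y) -
        Complex.exp ((-(2 * k + 1) - 2 * Complex.I * z) * y)) := by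
    intro y
    have a1 : (-(2 * (k : ℂ) + 1) + 2 * Complex.I * z) * y =
      -((2 * k + 1) * y) + (2 * y * z) * Complex.I := by ring
    have a2 : (-(2 * (k : ℂ) + 1) - 2 * Complex.I * z) * y =
      -((2 * k + 1) * y) + (-(2 * y * z)) * Complex.I := by ring
    rw [a1, a2, Complex.exp_add, Complex.exp_add, Complex.sin]
    ring
  have i1 := integrableOn_exp_mul_complex_Ioi e1 0
  have i2 := integrableOn_exp_mul_complex_Ioi e2 0
  simp only [hf]
  refine ⟨(i1.sub i2).const_mul _, ?_⟩
  rw [integral_const_mul, integral_sub i1 i2, integral_exp_mul_complex_Ioi e1,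
    integral_exp_mul_complex_Ioi e2]
  simp only [Complex.ofReal_zero, mul_zero, Complex.exp_zero]
  congr 1
  rw [← neg_div_neg_eq (-1 : ℂ), ← neg_div_neg_eq (-1 : ℂ)]
  congr 2 <;> ring

/-- Partial sums of the geometric expansion of `1 / sinh y`. The closed form shows that they are
dominated by `2 / sinh y`, which justifies integrating term by term. -/
theorem hasSum_geometric_sinh {y : ℝ} (hy : 0 < y) (n : ℕ) :
    ∑ k ∈ Finset.range n, 2 * Complex.exp (-((2 * k + 1) * y)) =
      (1 - Complex.exp (-(2 * n * y))) / Complex.sinh y := by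
  have hs : Complex.sinh (y : ℂ) ≠ 0 := sinh_ne_zero_of_re_pos (by simpa using hy)
  rw [eq_div_iff hs]
  induction n with
  | zero => simp
  | succ n ih =>
    rw [Finset.sum_range_succ, add_mul, ih, Complex.sinh]
    have h1 : Complex.exp (-((2 * n + 1) * y)) * Complex.exp y = Complex.exp (-(2 * n * y)) := by
      rw [← Complex.exp_add]; congr 1; ring
    have h2 : Complex.exp (-((2 * n + 1) * y)) * Complex.exp (-y) =
        Complex.exp (-(2 * (n + 1 : ℕ) * y)) := by
      rw [← Complex.exp_add]; congr 1; push_cast; ring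
    linear_combination h1 - h2

/-- The poles at odd integers are all poles without the even ones, and the even terms at `u` are
half the terms at `u / 2`. This is the partial fraction form of `tan θ = cot θ - 2 cot (2 θ)`. -/
theorem sum_cotTerm_odd (u : ℂ) (n : ℕ) :
    ∑ k ∈ Finset.range n, (1 / ((2 * (k : ℂ) + 1) - u) - 1 / ((2 * k + 1) + u)) =
      (1 / 2) * ∑ j ∈ Finset.range n, cotTerm (u / 2) j -
        ∑ j ∈ Finset.range (2 * n), cotTerm u j := by
  induction n with
  | zero => simp
  | succ n ih =>
    rw [Finset.sum_range_succ, ih, Finset.sum_range_succ, mul_add 2 n 1, mul_one,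
      Finset.sum_range_succ, Finset.sum_range_succ]
    have h1 : (1 / 2 : ℂ) * cotTerm (u / 2) n = cotTerm u (2 * n + 1) := by
      simp only [cotTerm]
      rw [mul_add, one_div_mul_one_div, one_div_mul_one_div]
      congr 2 <;> push_cast <;> ring
    have h2 : cotTerm u (2 * n) = - (1 / ((2 * (n : ℂ) + 1) - u) - 1 / ((2 * n + 1) + u)) := by
      simp only [cotTerm]
      rw [← neg_sub u, one_div_neg_eq_neg_one_div]
      push_cast
      rw [add_comm (2 * (n : ℂ) + 1) u]
      ring
    rw [mul_add, h1, h2]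
    ring

/-- Integrating the geometric series term by term gives partial fractions in `u = 2 i z` with poles
at the odd integers, which sum to cotangents by the Mittag-Leffler expansion. The case `z = 0` is
apart because that expansion excludes integers. -/
theorem integral_sin_div_sinh {z : ℂ} (hz : |z.im| < 1 / 2) :
    ∫ y in Ioi (0 : ℝ), Complex.sin (2 * y * z) / Complex.sinh y =
      Real.pi / 2 * Complex.tanh (Real.pi * z) := by
  by_cases hz0 : z = 0
  · simp [hz0]
  set u : ℂ := 2 * Complex.I * z with hu
  have hu0 : u ≠ 0 := by simp [hu, hz0]
  have hure : |u.re| < 1 := by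
    have : u.re = -(2 * z.im) := by simp [hu]
    rw [this, abs_neg, abs_mul, abs_two]; linarith
  have hint : ∀ v : ℂ, v ≠ 0 → |v.re| < 1 → v ∈ Complex.integerComplement := by
    rintro v hv hv1 ⟨n, rfl⟩
    rw [Complex.intCast_re] at hv1
    have : |n| < 1 := by exact_mod_cast hv1
    rw [Int.abs_lt_one_iff] at this
    simp [this] at hv
  have hu1 := hint u hu0 hure
  have hu2 : u / 2 ∈ Complex.integerComplement := hint _ (by simpa using hu0) (by
    have : (u / 2).re = u.re / 2 := by simp
    rw [this, abs_div, abs_two]; linarith [abs_nonneg u.re])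
  have hA : Tendsto (fun n : ℕ => ∫ y in Ioi (0 : ℝ),
      (∑ k ∈ Finset.range n, 2 * Complex.exp (-((2 * k + 1) * y))) * Complex.sin (2 * y * z)) atTop
      (𝓝 (∫ y in Ioi (0 : ℝ), Complex.sin (2 * y * z) / Complex.sinh y)) := by
    refine tendsto_integral_of_dominated_convergence
      (fun y => 2 * ‖Complex.sin (2 * y * z) / Complex.sinh y‖) (fun n => ?_)
      ((integrableOn_sin_div_sinh hz).norm.const_mul 2) (fun n => ?_) ?_
    · exact (by fun_prop : Continuous fun y : ℝ => (∑ k ∈ Finset.range n,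
        2 * Complex.exp (-((2 * k + 1) * y))) * Complex.sin (2 * y * z)).aestronglyMeasurable
    · filter_upwards [ae_restrict_mem measurableSet_Ioi] with y hy
      have hy0 : (0 : ℝ) < y := hy
      rw [hasSum_geometric_sinh hy, div_mul_eq_mul_div, mul_div_assoc, norm_mul]
      gcongr
      refine (norm_sub_le _ _).trans ?_
      rw [Complex.norm_exp]
      have : Real.exp (-(2 * (n : ℂ) * y)).re ≤ 1 := Real.exp_le_one_iff.2 (by
        simp; positivity)
      rw [norm_one]; linarith
    · filter_upwards [ae_restrict_mem measurableSet_Ioi] with y hy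
      have hy0 : (0 : ℝ) < y := hy
      have h1 : Tendsto (fun n : ℕ => Complex.exp (-(2 * n * y))) atTop (𝓝 0) := by
        rw [tendsto_zero_iff_norm_tendsto_zero]
        have h2 : ∀ n : ℕ, ‖Complex.exp (-(2 * n * y))‖ = Real.exp (-((2 * y) * n)) := fun n => by
          rw [Complex.norm_exp]; congr 1; simp; ring
        simp only [h2]
        exact Real.tendsto_exp_neg_atTop_nhds_zero.comp
          (tendsto_natCast_atTop_atTop.const_mul_atTop (by positivity))
      have h3 := ((h1.const_sub 1).div_const (Complex.sinh y)).mul_const (Complex.sin (2 * y * z))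
      refine (h3.congr fun n => ?_).trans (by rw [sub_zero, one_div, mul_comm, div_eq_mul_inv])
      rw [hasSum_geometric_sinh hy]
  have hB : ∀ n : ℕ, ∫ y in Ioi (0 : ℝ),
      (∑ k ∈ Finset.range n, 2 * Complex.exp (-((2 * k + 1) * y))) * Complex.sin (2 * y * z) =
      -Complex.I * ((1 / 2) * ∑ j ∈ Finset.range n, cotTerm (u / 2) j -
        ∑ j ∈ Finset.range (2 * n), cotTerm u j) := by
    intro n
    simp only [Finset.sum_mul]
    rw [integral_finsetSum _ fun k _ => (integral_exp_mul_sin hz k).1, ← sum_cotTerm_odd,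
      Finset.mul_sum]
    exact Finset.sum_congr rfl fun k _ => (integral_exp_mul_sin hz k).2
  have hC := ((((tendsto_logDeriv_euler_cot_sub hu2).const_mul (1 / 2)).sub
    ((tendsto_logDeriv_euler_cot_sub hu1).comp
      (tendsto_id.const_mul_atTop' (by norm_num : 0 < 2)))).const_mul (-Complex.I))
  rw [funext hB] at hA
  rw [tendsto_nhds_unique hA hC]
  set θ : ℂ := Real.pi * z * Complex.I with hθ
  have e1 : (Real.pi : ℂ) * (u / 2) = θ := by rw [hu, hθ]; ring
  have e2 : (Real.pi : ℂ) * u = 2 * θ := by rw [hu, hθ]; ring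
  have hs1 : Complex.sin θ ≠ 0 := by rw [← e1]; exact sin_pi_mul_ne_zero hu2
  have hs2 : Complex.sin (2 * θ) ≠ 0 := by rw [← e2]; exact sin_pi_mul_ne_zero hu1
  have hc : Complex.cos θ ≠ 0 := by
    intro h; apply hs2; rw [Complex.sin_two_mul, h]; ring
  have ht : Complex.tanh (Real.pi * z) = -Complex.I * (Complex.sin θ / Complex.cos θ) := by
    rw [Complex.tanh_eq_sinh_div_cosh, ← Complex.cos_mul_I, hθ, Complex.sin_mul_I]
    linear_combination (Complex.sinh (Real.pi * z) / Complex.cos (Real.pi * z * Complex.I)) *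
      Complex.I_mul_I
  have hcot : Complex.cos θ / Complex.sin θ - Complex.cos (2 * θ) / (Complex.sin θ * Complex.cos θ) =
      Complex.sin θ / Complex.cos θ := by
    rw [Complex.cos_two_mul]
    field_simp
    linear_combination -Complex.sin_sq_add_cos_sq θ
  have hu2 : 1 / (u / 2) = 2 * (1 / u) := by field_simp
  rw [e1, e2, ht, Complex.cot_eq_cos_div_sin, Complex.cot_eq_cos_div_sin, Complex.sin_two_mul,
    ← hcot, hu2, mul_assoc 2, mul_comm (2 : ℂ), ← div_div]
  ring

theorem abs_div_im_lt {z : ℂ} {c : ℝ} (hc : 0 < c) (hz : |z.im| < c / 2) :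
    |(z / c).im| < 1 / 2 := by
  rw [Complex.div_ofReal_im, abs_div, abs_of_pos hc, div_lt_iff₀ hc]
  linarith

theorem sin_div_sinh_scale {z : ℂ} {c : ℝ} (hc : 0 < c) (y : ℝ) :
    Complex.sin (2 * y * z) / Complex.sinh (c * y) =
      Complex.sin (2 * (c * y : ℝ) * (z / c)) / Complex.sinh (c * y : ℝ) := by
  have hc0 : (c : ℂ) ≠ 0 := by exact_mod_cast hc.ne'
  push_cast
  congr 2
  field_simp

theorem integrableOn_sin_div_sinh_mul {z : ℂ} {c : ℝ} (hc : 0 < c) (hz : |z.im| < c / 2) :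
    IntegrableOn (fun y : ℝ => Complex.sin (2 * y * z) / Complex.sinh (c * y)) (Ioi 0) := by
  simp only [sin_div_sinh_scale hc]
  have := (integrableOn_Ioi_comp_mul_left_iff
    (fun y : ℝ => Complex.sin (2 * y * (z / c)) / Complex.sinh y) 0 hc).2
  refine this ?_
  rw [mul_zero]
  exact integrableOn_sin_div_sinh (abs_div_im_lt hc hz)

theorem integral_sin_div_sinh_mul {z : ℂ} {c : ℝ} (hc : 0 < c) (hz : |z.im| < c / 2) :
    ∫ y in Ioi (0 : ℝ), Complex.sin (2 * y * z) / Complex.sinh (c * y) =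
      Real.pi / (2 * c) * Complex.tanh (Real.pi * z / c) := by
  have hc0 : (c : ℂ) ≠ 0 := by exact_mod_cast hc.ne'
  simp only [sin_div_sinh_scale hc]
  rw [integral_comp_mul_left_Ioi
    (fun y : ℝ => Complex.sin (2 * y * (z / c)) / Complex.sinh y) 0 hc, mul_zero,
    integral_sin_div_sinh (abs_div_im_lt hc hz), Complex.real_smul, Complex.ofReal_inv,
    mul_div_assoc]
  field_simp

end SineTransform

/-! ### Taylor expansions to third order at the origin. -/

section Taylor

/-- `f` and `g` agree to third order at the origin, with an error bounded on the unit disc. -/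
def AgreeToThirdOrder (f g : ℂ → ℂ) : Prop :=
  ∃ C : ℝ, ∀ u : ℂ, u ≠ 0 → ‖u‖ ≤ 1 → ‖f u - g u‖ ≤ C * ‖u‖ ^ 4

theorem AgreeToThirdOrder.mul {f g p q : ℂ → ℂ} (hf : AgreeToThirdOrder f p)
    (hg : AgreeToThirdOrder g q) (hp : Continuous p) (hq : Continuous q) :
    AgreeToThirdOrder (fun u => f u * g u) (fun u => p u * q u) := by
  obtain ⟨C, hC⟩ := hf
  obtain ⟨D, hD⟩ := hg
  obtain ⟨P, hP⟩ := (isCompact_closedBall (0 : ℂ) 1).exists_bound_of_continuousOn hp.continuousOn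
  obtain ⟨Q, hQ⟩ := (isCompact_closedBall (0 : ℂ) 1).exists_bound_of_continuousOn hq.continuousOn
  have hC0 : 0 ≤ C := by simpa using (norm_nonneg _).trans (hC 1 one_ne_zero (by simp))
  have hD0 : 0 ≤ D := by simpa using (norm_nonneg _).trans (hD 1 one_ne_zero (by simp))
  refine ⟨C * (Q + D) + P * D, fun u hu hu1 => ?_⟩
  have hm : u ∈ Metric.closedBall (0 : ℂ) 1 := by simpa using hu1
  have h1 := hC u hu hu1
  have h2 := hD u hu hu1
  have h3 : ‖g u‖ ≤ Q + D := by
    calc ‖g u‖ = ‖q u + (g u - q u)‖ := by congr 1; ring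
      _ ≤ ‖q u‖ + ‖g u - q u‖ := norm_add_le _ _
      _ ≤ Q + D * ‖u‖ ^ 4 := add_le_add (hQ u hm) h2
      _ ≤ Q + D * 1 := by gcongr; exact pow_le_one₀ (norm_nonneg _) hu1
      _ = Q + D := by ring
  calc ‖f u * g u - p u * q u‖ = ‖(f u - p u) * g u + p u * (g u - q u)‖ := by congr 1; ring
    _ ≤ ‖f u - p u‖ * ‖g u‖ + ‖p u‖ * ‖g u - q u‖ := by
      refine (norm_add_le _ _).trans ?_
      rw [norm_mul, norm_mul]
    _ ≤ (C * ‖u‖ ^ 4) * (Q + D) + P * (D * ‖u‖ ^ 4) := by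
      have := hP u hm
      gcongr
      exact (norm_nonneg _).trans this
    _ = _ := by ring

theorem AgreeToThirdOrder.trans {f g p : ℂ → ℂ} (hf : AgreeToThirdOrder f g)
    (hg : AgreeToThirdOrder g p) : AgreeToThirdOrder f p := by
  obtain ⟨C, hC⟩ := hf
  obtain ⟨D, hD⟩ := hg
  refine ⟨C + D, fun u hu hu1 => ?_⟩
  calc ‖f u - p u‖ = ‖(f u - g u) + (g u - p u)‖ := by congr 1; ring
    _ ≤ ‖f u - g u‖ + ‖g u - p u‖ := norm_add_le _ _
    _ ≤ C * ‖u‖ ^ 4 + D * ‖u‖ ^ 4 := add_le_add (hC u hu hu1) (hD u hu hu1)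
    _ = _ := by ring

theorem AgreeToThirdOrder.add_const {f g : ℂ → ℂ} (hf : AgreeToThirdOrder f g) (c : ℂ) :
    AgreeToThirdOrder (fun u => c + f u) (fun u => c + g u) := by
  obtain ⟨C, hC⟩ := hf
  exact ⟨C, fun u hu hu1 => by simpa using hC u hu hu1⟩

theorem AgreeToThirdOrder.of_factor {f g q : ℂ → ℂ} (hq : Continuous q)
    (h : ∀ u, f u - g u = u ^ 4 * q u) : AgreeToThirdOrder f g := by
  obtain ⟨Q, hQ⟩ := (isCompact_closedBall (0 : ℂ) 1).exists_bound_of_continuousOn hq.continuousOn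
  refine ⟨Q, fun u _ hu1 => ?_⟩
  rw [h, norm_mul, norm_pow, mul_comm]
  gcongr
  exact hQ u (by simpa using hu1)

theorem norm_sinh_sub_le {u : ℂ} (hu : ‖u‖ ≤ 1) :
    ‖Complex.sinh u - (u + u ^ 3 / 6)‖ ≤ ‖u‖ ^ 5 / 100 := by
  have h := Complex.sin_bound (x := u * Complex.I) (by simpa using hu)
  have h1 : Complex.sin (u * Complex.I) - (u * Complex.I - (u * Complex.I) ^ 3 / 6) =
      (Complex.sinh u - (u + u ^ 3 / 6)) * Complex.I := by
    rw [Complex.sin_mul_I, mul_pow, Complex.I_pow_three]; ring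
  rw [h1] at h
  simpa using h

theorem agreeToThirdOrder_cosh :
    AgreeToThirdOrder Complex.cosh (fun u => 1 + u ^ 2 / 2) := by
  refine ⟨5 / 96, fun u _ hu1 => ?_⟩
  have h := Complex.cos_bound (x := u * Complex.I) (by simpa using hu1)
  rw [Complex.cos_mul_I, mul_pow, Complex.I_sq] at h
  have e : (1 : ℂ) - u ^ 2 * -1 / 2 = 1 + u ^ 2 / 2 := by ring
  rw [e] at h
  simpa [mul_comm] using h

theorem half_norm_le_norm_sinh {u : ℂ} (hu : ‖u‖ ≤ 1) : ‖u‖ / 2 ≤ ‖Complex.sinh u‖ := by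
  have h := norm_sinh_sub_le hu
  have h1 : ‖u‖ ≤ ‖Complex.sinh u‖ + ‖Complex.sinh u - (u + u ^ 3 / 6)‖ + ‖u ^ 3 / 6‖ := by
    calc ‖u‖ = ‖Complex.sinh u - (Complex.sinh u - (u + u ^ 3 / 6)) - u ^ 3 / 6‖ := by
          congr 1; ring
      _ ≤ _ := (norm_sub_le _ _).trans (add_le_add (norm_sub_le _ _) le_rfl)
  have h2 : ‖u ^ 3 / 6‖ = ‖u‖ ^ 3 / 6 := by simp
  have h3 : ‖u‖ ^ 3 ≤ ‖u‖ := by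
    simpa using pow_le_pow_of_le_one (norm_nonneg u) hu (show 1 ≤ 3 by norm_num)
  have h4 : ‖u‖ ^ 5 ≤ ‖u‖ := by
    simpa using pow_le_pow_of_le_one (norm_nonneg u) hu (show 1 ≤ 5 by norm_num)
  linarith [norm_nonneg u]

theorem agreeToThirdOrder_div_sinh :
    AgreeToThirdOrder (fun u => u / Complex.sinh u) (fun u => 1 - u ^ 2 / 6) := by
  refine ⟨1, fun u hu hu1 => ?_⟩
  have hun : 0 < ‖u‖ := norm_pos_iff.2 hu
  have h := norm_sinh_sub_le hu1
  have hs := half_norm_le_norm_sinh hu1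
  have hs0 : Complex.sinh u ≠ 0 := norm_pos_iff.1 (by linarith)
  set e := Complex.sinh u - (u + u ^ 3 / 6) with he
  have h1 : u / Complex.sinh u - (1 - u ^ 2 / 6) =
      (u ^ 5 / 36 - e * (1 - u ^ 2 / 6)) / Complex.sinh u := by
    rw [eq_div_iff hs0, sub_mul, div_mul_cancel₀ _ hs0, he]; ring
  rw [h1, norm_div, div_le_iff₀ (by linarith)]
  have h2 : ‖1 - u ^ 2 / 6‖ ≤ 2 := by
    refine (norm_sub_le _ _).trans ?_
    have : ‖u‖ ^ 2 ≤ 1 := pow_le_one₀ hun.le hu1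
    simp; linarith
  have h3 : ‖u ^ 5 / 36 - e * (1 - u ^ 2 / 6)‖ ≤ ‖u‖ ^ 5 / 36 + ‖u‖ ^ 5 / 100 * 2 := by
    refine (norm_sub_le _ _).trans (add_le_add (by simp) ?_)
    rw [norm_mul]
    gcongr
  have h4 : ‖u‖ ^ 4 * (‖u‖ / 2) ≤ ‖u‖ ^ 4 * ‖Complex.sinh u‖ := by gcongr
  have h5 : 0 < ‖u‖ ^ 5 := by positivity
  nlinarith

/-- The quadratic terms cancel: to this order the product is `(1 - u² / 2) (2 + u²)`. Therefore
`cubicKernel` is `1 / (2 y³)` up to `O(y)`, with no term in `1 / y`. -/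
theorem agreeToThirdOrder_kernel :
    AgreeToThirdOrder (fun u => (u / Complex.sinh u) * ((u / Complex.sinh u) *
      (u / Complex.sinh u)) * (1 + Complex.cosh u * Complex.cosh u)) (fun _ => 2) := by
  have hs := agreeToThirdOrder_div_sinh
  have hc := agreeToThirdOrder_cosh
  have h1 := (hs.mul (hs.mul hs (by fun_prop) (by fun_prop)) (by fun_prop) (by fun_prop)).mul
    ((hc.mul hc (by fun_prop) (by fun_prop)).add_const 1) (by fun_prop) (by fun_prop)
  refine h1.trans (AgreeToThirdOrder.of_factor (q := fun u =>
    -1 / 12 - 11 / 216 * u ^ 2 + 7 / 432 * u ^ 4 - u ^ 6 / 864) (by fun_prop) fun u => ?_)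
  ring

end Taylor

/-! ### Splitting the kernel of the hyperbolic gamma function. -/

section Kernel

/-- The kernel of the hyperbolic gamma function. -/
def gammaKernel (w₁ w₂ : ℂ) (y : ℝ) : ℂ :=
  1 / (2 * y * Complex.sinh (w₁ * y) * Complex.sinh (w₂ * y))

/-- One quarter of the second derivative of `c / sinh (c y)`. -/
def cubicKernel (c y : ℝ) : ℂ :=
  c ^ 3 / 4 * (1 + Complex.cosh (c * y) ^ 2) / Complex.sinh (c * y) ^ 3

def cschKernel (c y : ℝ) : ℂ := c / Complex.sinh (c * y)

/-- What remains of the kernel of the hyperbolic gamma function after subtraction of explicit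
kernels with the same singularity at `0`. -/
def remKernel (c : ℝ) (w₁ w₂ : ℂ) (y : ℝ) : ℂ :=
  gammaKernel w₁ w₂ y - cubicKernel c y / (w₁ * w₂) +
    (w₁ ^ 2 + w₂ ^ 2) / (12 * w₁ * w₂) * cschKernel c y

theorem exists_norm_cubicKernel_sub_le {c : ℝ} (hc : 0 < c) :
    ∃ C, ∀ y : ℝ, 0 < y → c * y ≤ 1 → ‖cubicKernel c y - 1 / (2 * y ^ 3)‖ ≤ C * y := by
  obtain ⟨C, hC⟩ := agreeToThirdOrder_kernel
  refine ⟨C * c ^ 4 / 4, fun y hy hcy => ?_⟩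
  have hcy0 : 0 < c * y := mul_pos hc hy
  have hn : ‖(c : ℂ) * y‖ = c * y := by simp [abs_of_pos hc, abs_of_pos hy]
  have h := hC (c * y) (by exact_mod_cast hcy0.ne') (by rwa [hn])
  have hs : Complex.sinh (c * y) ≠ 0 := sinh_ne_zero_of_re_pos (by simpa using hcy0)
  have hy0 : (y : ℂ) ≠ 0 := by exact_mod_cast hy.ne'
  have e : cubicKernel c y - 1 / (2 * y ^ 3) = (1 / (4 * y ^ 3)) *
      ((c * y / Complex.sinh (c * y)) * ((c * y / Complex.sinh (c * y)) *
      (c * y / Complex.sinh (c * y))) * (1 + Complex.cosh (c * y) * Complex.cosh (c * y)) - 2) := by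
    rw [cubicKernel]
    field_simp
    ring
  rw [e, norm_mul]
  rw [hn] at h
  have h2 : ‖(1 / (4 * y ^ 3) : ℂ)‖ = 1 / (4 * y ^ 3) := by simp [abs_of_pos hy]
  rw [h2]
  calc 1 / (4 * y ^ 3) * _ ≤ 1 / (4 * y ^ 3) * (C * (c * y) ^ 4) := by gcongr
    _ = C * c ^ 4 / 4 * y := by field_simp

/-- With `u = w₁ y`, `v = w₂ y` and the factor `1 / (2 w₁ w₂ y³)` removed, the kernel becomes to
third order `(1 - u² / 6) (1 - v² / 6) - 1 + (u² + v²) / 6`, which is of fourth order. All errors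
are measured by `t = 2 R y`, which bounds `‖u‖` and `‖v‖`. -/
theorem exists_norm_remKernel_le_near {ε R : ℝ} (hε : 0 < ε) (hR : 0 < R) :
    ∃ C, 0 ≤ C ∧ ∀ w₁ w₂ : ℂ, ε ≤ w₁.re → ε ≤ w₂.re → ‖w₁‖ ≤ R → ‖w₂‖ ≤ R →
      ∀ y : ℝ, 0 < y → 2 * R * y ≤ 1 → ‖remKernel (2 * R) w₁ w₂ y‖ ≤ C := by
  obtain ⟨C, hC⟩ := agreeToThirdOrder_kernel
  obtain ⟨D, hD⟩ := agreeToThirdOrder_div_sinh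
  have hC0 : 0 ≤ C := by simpa using (norm_nonneg _).trans (hC 1 one_ne_zero (by simp))
  have hD0 : 0 ≤ D := by simpa using (norm_nonneg _).trans (hD 1 one_ne_zero (by simp))
  set B : ℝ := (2 + D) * D + 2 * D + 1 + C / 2 + 1 + D with hB
  refine ⟨1 / (2 * ε ^ 2) * (B * (2 * R) ^ 3), by positivity, fun w₁ w₂ h₁ h₂ hw₁ hw₂ y hy hcy => ?_⟩
  set t : ℝ := 2 * R * y with ht
  have ht0 : 0 < t := by positivity
  have hn : ∀ w : ℂ, ‖w‖ ≤ R → ‖w * y‖ ≤ t := fun w hw => by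
    rw [norm_mul, Complex.norm_real, Real.norm_of_nonneg hy.le, ht]
    nlinarith [norm_nonneg w]
  have hne : ∀ w : ℂ, ε ≤ w.re → w ≠ 0 := fun w hw h => by
    rw [h, Complex.zero_re] at hw; linarith
  have hw₁0 := hne w₁ h₁
  have hw₂0 := hne w₂ h₂
  have hy0 : (y : ℂ) ≠ 0 := by exact_mod_cast hy.ne'
  have hR0 : (R : ℂ) ≠ 0 := by exact_mod_cast hR.ne'
  have hs : ∀ w : ℂ, ε ≤ w.re → Complex.sinh (w * y) ≠ 0 := fun w hw =>
    sinh_ne_zero_of_re_pos (by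
      rw [Complex.re_mul_ofReal]; exact mul_pos (hε.trans_le hw) hy)
  have hs₁ := hs w₁ h₁
  have hs₂ := hs w₂ h₂
  have hsc : Complex.sinh (2 * R * y) ≠ 0 := sinh_ne_zero_of_re_pos (by
    have : ((2 * R * y : ℂ)).re = t := by
      rw [ht, ← Complex.ofReal_re (2 * R * y)]; push_cast; rfl
    rw [this]; exact ht0)
  set u : ℂ := w₁ * y with hu
  set v : ℂ := w₂ * y with hv
  have hut := hn w₁ hw₁
  have hvt := hn w₂ hw₂
  have hcn : ‖(2 * R * y : ℂ)‖ = t := by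
    simp [abs_of_pos hR, abs_of_pos hy, ht]
  set s₁ : ℂ := u / Complex.sinh u with hs1
  set s₂ : ℂ := v / Complex.sinh v with hs2
  set s : ℂ := 2 * R * y / Complex.sinh (2 * R * y) with hs3
  set k : ℂ := s * (s * s) * (1 + Complex.cosh (2 * R * y) * Complex.cosh (2 * R * y)) with hk
  have e : remKernel (2 * R) w₁ w₂ y = (1 / (2 * (w₁ * w₂) * y ^ 3)) *
      (s₁ * s₂ - k / 2 + (u ^ 2 + v ^ 2) / 6 * s) := by
    rw [remKernel, gammaKernel, cubicKernel, cschKernel, hk, hs1, hs2, hs3]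
    push_cast
    rw [hu, hv]
    field_simp
    ring
  have b1 : ‖s₁ - (1 - u ^ 2 / 6)‖ ≤ D * t ^ 4 :=
    (hD u (mul_ne_zero hw₁0 hy0) (hut.trans hcy)).trans (by gcongr)
  have b2 : ‖s₂ - (1 - v ^ 2 / 6)‖ ≤ D * t ^ 4 :=
    (hD v (mul_ne_zero hw₂0 hy0) (hvt.trans hcy)).trans (by gcongr)
  have hc0 : (2 * R * y : ℂ) ≠ 0 := mul_ne_zero (mul_ne_zero two_ne_zero hR0) hy0
  have b3 : ‖s - (1 - (2 * R * y) ^ 2 / 6)‖ ≤ D * t ^ 4 := by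
    have := hD (2 * R * y) hc0 (by rw [hcn]; exact hcy)
    rwa [hcn] at this
  have b4 : ‖k - 2‖ ≤ C * t ^ 4 := by
    have := hC (2 * R * y) hc0 (by rw [hcn]; exact hcy)
    rwa [hcn] at this
  have ht4 : t ^ 4 ≤ 1 := pow_le_one₀ ht0.le hcy
  have hsq : ∀ x : ℂ, ‖x‖ ≤ t → ‖x ^ 2 / 6‖ ≤ t ^ 2 / 6 := fun x hx => by
    rw [norm_div, norm_pow]
    simp only [RCLike.norm_ofNat]
    gcongr
  have ht2 : t ^ 2 ≤ 1 := pow_le_one₀ ht0.le hcy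
  have p1 : ‖1 - u ^ 2 / 6‖ ≤ 2 := (norm_sub_le _ _).trans (by
    rw [norm_one]; linarith [hsq u hut])
  have p2 : ‖1 - v ^ 2 / 6‖ ≤ 2 := (norm_sub_le _ _).trans (by
    rw [norm_one]; linarith [hsq v hvt])
  have q1 : ‖s₁‖ ≤ 2 + D := by
    calc ‖s₁‖ = ‖(s₁ - (1 - u ^ 2 / 6)) + (1 - u ^ 2 / 6)‖ := by congr 1; ring
      _ ≤ D * t ^ 4 + 2 := (norm_add_le _ _).trans (add_le_add b1 p1)
      _ ≤ 2 + D := by nlinarith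
  have main : ‖s₁ * s₂ - k / 2 + (u ^ 2 + v ^ 2) / 6 * s‖ ≤ B * t ^ 4 := by
    have e2 : s₁ * s₂ - k / 2 + (u ^ 2 + v ^ 2) / 6 * s =
        s₁ * (s₂ - (1 - v ^ 2 / 6)) + (s₁ - (1 - u ^ 2 / 6)) * (1 - v ^ 2 / 6)
        + (u ^ 2 / 6) * (v ^ 2 / 6) - (k - 2) / 2
        + (u ^ 2 / 6 + v ^ 2 / 6) * (s - (1 - (2 * R * y) ^ 2 / 6))
        - (u ^ 2 / 6 + v ^ 2 / 6) * ((2 * R * y) ^ 2 / 6) := by ring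
    have n1 : ‖s₁ * (s₂ - (1 - v ^ 2 / 6))‖ ≤ (2 + D) * (D * t ^ 4) := by
      rw [norm_mul]; gcongr
    have n2 : ‖(s₁ - (1 - u ^ 2 / 6)) * (1 - v ^ 2 / 6)‖ ≤ (D * t ^ 4) * 2 := by
      rw [norm_mul]; gcongr
    have n3 : ‖(u ^ 2 / 6) * (v ^ 2 / 6)‖ ≤ (t ^ 2 / 6) * (t ^ 2 / 6) := by
      rw [norm_mul]; exact mul_le_mul (hsq u hut) (hsq v hvt) (norm_nonneg _) (by positivity)
    have n4 : ‖(k - 2) / 2‖ ≤ C * t ^ 4 / 2 := by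
      rw [norm_div, Complex.norm_two]; gcongr
    have n5 : ‖u ^ 2 / 6 + v ^ 2 / 6‖ ≤ t ^ 2 / 6 + t ^ 2 / 6 :=
      (norm_add_le _ _).trans (add_le_add (hsq u hut) (hsq v hvt))
    have n6 : ‖(u ^ 2 / 6 + v ^ 2 / 6) * (s - (1 - (2 * R * y) ^ 2 / 6))‖ ≤ 1 * (D * t ^ 4) := by
      rw [norm_mul]; exact mul_le_mul (n5.trans (by linarith)) b3 (norm_nonneg _) zero_le_one
    have n7 : ‖(u ^ 2 / 6 + v ^ 2 / 6) * ((2 * R * y) ^ 2 / 6)‖ ≤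
        (t ^ 2 / 6 + t ^ 2 / 6) * (t ^ 2 / 6) := by
      rw [norm_mul]; exact mul_le_mul n5 (hsq _ hcn.le) (norm_nonneg _) (by positivity)
    rw [e2]
    refine (norm_sub_le _ _).trans ((add_le_add ((norm_add_le _ _).trans (add_le_add
      ((norm_sub_le _ _).trans (add_le_add ((norm_add_le _ _).trans (add_le_add
      ((norm_add_le _ _).trans (add_le_add n1 n2)) n3)) n4)) n6)) n7).trans ?_)
    have : 0 ≤ t ^ 4 := by positivity
    rw [hB]
    nlinarith
  have hwε : ∀ w : ℂ, ε ≤ w.re → ε ≤ ‖w‖ := fun w hw => hw.trans (Complex.re_le_norm w)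
  have hpre : ‖(1 / (2 * (w₁ * w₂) * y ^ 3) : ℂ)‖ ≤ 1 / (2 * ε ^ 2) * (1 / y ^ 3) := by
    rw [norm_div, norm_mul, norm_mul, norm_mul, norm_pow, Complex.norm_real,
      Real.norm_of_nonneg hy.le, norm_one, Complex.norm_two, one_div_mul_one_div]
    have := mul_le_mul (hwε w₁ h₁) (hwε w₂ h₂) hε.le (norm_nonneg _)
    rw [pow_two]
    gcongr
  rw [e, norm_mul]
  calc _ ≤ 1 / (2 * ε ^ 2) * (1 / y ^ 3) * (B * t ^ 4) := by gcongr
    _ = 1 / (2 * ε ^ 2) * (B * (2 * R) ^ 3) * t := by rw [ht]; field_simp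
    _ ≤ 1 / (2 * ε ^ 2) * (B * (2 * R) ^ 3) := mul_le_of_le_one_right (by positivity) hcy

theorem exp_mul_le_sinh {x₀ x : ℝ} (h : x₀ ≤ x) :
    (1 - Real.exp (-(2 * x₀))) / 2 * Real.exp x ≤ Real.sinh x := by
  rw [Real.sinh_eq]
  have h1 : Real.exp (-x) ≤ Real.exp (-(2 * x₀)) * Real.exp x := by
    rw [← Real.exp_add]; exact Real.exp_le_exp.2 (by linarith)
  linarith

/-- A lower bound for `sinh (w y)` away from `y = 0`. -/
theorem exists_inv_norm_sinh_le {ε y₀ : ℝ} (hε : 0 < ε) (hy₀ : 0 < y₀) :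
    ∃ C, 0 < C ∧ ∀ w : ℂ, ε ≤ w.re → ∀ y : ℝ, y₀ ≤ y →
      ‖Complex.sinh (w * y)‖⁻¹ ≤ C * Real.exp (-(w.re * y)) := by
  have hκ : 0 < (1 - Real.exp (-(2 * (ε * y₀)))) / 2 := by
    have : Real.exp (-(2 * (ε * y₀))) < 1 := by
      rw [← Real.exp_zero]
      exact Real.exp_lt_exp.2 (by have := mul_pos hε hy₀; linarith)
    linarith
  refine ⟨((1 - Real.exp (-(2 * (ε * y₀)))) / 2)⁻¹, inv_pos.2 hκ, fun w hw y hy => ?_⟩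
  have h1 := sinh_re_le_norm_sinh (w * y)
  rw [Complex.re_mul_ofReal] at h1
  have h2 := exp_mul_le_sinh (x₀ := ε * y₀) (x := w.re * y)
    (mul_le_mul hw hy hy₀.le (hε.le.trans hw))
  rw [Real.exp_neg (w.re * y), ← mul_inv]
  exact inv_anti₀ (mul_pos hκ (Real.exp_pos _)) (h2.trans h1)

theorem norm_cosh_le (z : ℂ) : ‖Complex.cosh z‖ ≤ Real.exp |z.re| := by
  have := norm_cos_le (z * Complex.I)
  rw [Complex.cos_mul_I] at this
  simpa using this

theorem exists_norm_cubicKernel_le {c y₀ : ℝ} (hc : 0 < c) (hy₀ : 0 < y₀) :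
    ∃ C, 0 ≤ C ∧ ∀ y : ℝ, y₀ ≤ y → ‖cubicKernel c y‖ ≤ C * Real.exp (-(c * y)) := by
  obtain ⟨C, hC0, hC⟩ := exists_inv_norm_sinh_le hc hy₀
  refine ⟨c ^ 3 / 4 * 2 * C ^ 3, by positivity, fun y hy => ?_⟩
  have hy0 : 0 < y := hy₀.trans_le hy
  have h := hC c (by simp) y hy
  rw [Complex.ofReal_re] at h
  have h1 : ‖1 + Complex.cosh (c * y) ^ 2‖ ≤ 2 * Real.exp (c * y) ^ 2 := by
    have h2 := norm_cosh_le (c * y)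
    have h3 : |((c : ℂ) * y).re| = c * y := by
      rw [← Complex.ofReal_mul, Complex.ofReal_re, abs_of_pos (mul_pos hc hy0)]
    rw [h3] at h2
    have h4 : 1 ≤ Real.exp (c * y) := Real.one_le_exp (by positivity)
    calc ‖1 + Complex.cosh (c * y) ^ 2‖ ≤ 1 + ‖Complex.cosh (c * y)‖ ^ 2 := by
          refine (norm_add_le _ _).trans ?_
          rw [norm_one, norm_pow]
      _ ≤ 1 + Real.exp (c * y) ^ 2 := by gcongr
      _ ≤ _ := by nlinarith
  rw [cubicKernel, norm_div, norm_mul, norm_div, norm_pow, norm_pow, Complex.norm_real,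
    Real.norm_of_nonneg hc.le, div_eq_mul_inv _ (_ ^ 3), ← inv_pow]
  have h4 : ‖(4 : ℂ)‖ = 4 := by simp
  rw [h4]
  calc _ ≤ c ^ 3 / 4 * (2 * Real.exp (c * y) ^ 2) * (C * Real.exp (-(c * y))) ^ 3 := by gcongr
    _ = c ^ 3 / 4 * 2 * C ^ 3 * Real.exp (-(c * y)) * (Real.exp (c * y) * Real.exp (-(c * y))) ^ 2 := by
        ring
    _ = _ := by rw [← Real.exp_add]; simp

/-- The rate is that of `gammaKernel`; the scale `2 * R` of the subtracted kernels is at least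
`w₁.re + w₂.re`, so they decay no slower. For `2 R y ≤ 1` the exponential is at least `exp (-1)`,
whence the factor `exp 1`. -/
theorem exists_norm_remKernel_le {ε R : ℝ} (hε : 0 < ε) (hR : 0 < R) :
    ∃ C, 0 ≤ C ∧ ∀ w₁ w₂ : ℂ, ε ≤ w₁.re → ε ≤ w₂.re → ‖w₁‖ ≤ R → ‖w₂‖ ≤ R →
      ∀ y : ℝ, 0 < y → ‖remKernel (2 * R) w₁ w₂ y‖ ≤ C * Real.exp (-((w₁.re + w₂.re) * y)) := by
  have hc : 0 < 2 * R := by positivity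
  set y₀ : ℝ := 1 / (2 * R) with hy₀d
  have hy₀ : 0 < y₀ := by positivity
  obtain ⟨C₁, hC₁0, hC₁⟩ := exists_norm_remKernel_le_near hε hR
  obtain ⟨C₂, hC₂0, hC₂⟩ := exists_inv_norm_sinh_le hε hy₀
  obtain ⟨C₃, hC₃0, hC₃⟩ := exists_norm_cubicKernel_le hc hy₀
  obtain ⟨C₄, hC₄0, hC₄⟩ := exists_inv_norm_sinh_le hc hy₀
  set D : ℝ := 1 / (2 * y₀) * C₂ * C₂ + C₃ * (1 / ε ^ 2) + (2 * R ^ 2) / (12 * ε ^ 2) * (2 * R * C₄)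
    with hD
  have hD0 : 0 ≤ D := by positivity
  refine ⟨C₁ * Real.exp 1 + D, by positivity, fun w₁ w₂ h₁ h₂ hw₁ hw₂ y hy => ?_⟩
  have hre₁ := (Complex.re_le_norm w₁).trans hw₁
  have hre₂ := (Complex.re_le_norm w₂).trans hw₂
  rw [add_mul]
  rcases le_total (2 * R * y) 1 with h | h
  · have h3 := hC₁ w₁ w₂ h₁ h₂ hw₁ hw₂ y hy h
    have h4 : 1 ≤ Real.exp 1 * Real.exp (-((w₁.re + w₂.re) * y)) := by
      rw [← Real.exp_add]
      exact Real.one_le_exp (by nlinarith)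
    have h5 : 0 ≤ D * Real.exp (-((w₁.re + w₂.re) * y)) := by positivity
    nlinarith
  · have hy1 : y₀ ≤ y := by rw [hy₀d, div_le_iff₀ hc]; linarith
    have hexp : Real.exp (-(2 * R * y)) ≤ Real.exp (-((w₁.re + w₂.re) * y)) :=
      Real.exp_le_exp.2 (by nlinarith)
    have hwε : ∀ w : ℂ, ε ≤ w.re → ε ≤ ‖w‖ := fun w hw => hw.trans (Complex.re_le_norm w)
    have hww : ε ^ 2 ≤ ‖w₁ * w₂‖ := by
      rw [norm_mul, pow_two]
      exact mul_le_mul (hwε w₁ h₁) (hwε w₂ h₂) hε.le (norm_nonneg _)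
    have n1 : ‖gammaKernel w₁ w₂ y‖ ≤
        1 / (2 * y₀) * C₂ * C₂ * Real.exp (-((w₁.re + w₂.re) * y)) := by
      have a1 := hC₂ w₁ h₁ y hy1
      have a2 := hC₂ w₂ h₂ y hy1
      have : ‖gammaKernel w₁ w₂ y‖ = 1 / (2 * y) * ‖Complex.sinh (w₁ * y)‖⁻¹ *
          ‖Complex.sinh (w₂ * y)‖⁻¹ := by
        rw [gammaKernel, norm_div, norm_mul, norm_mul, norm_mul, Complex.norm_real,
          Real.norm_of_nonneg hy.le, norm_one, Complex.norm_two]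
        simp only [one_div, mul_inv]
      rw [this]
      calc _ ≤ 1 / (2 * y₀) * (C₂ * Real.exp (-(w₁.re * y))) * (C₂ * Real.exp (-(w₂.re * y))) := by
            gcongr
        _ = 1 / (2 * y₀) * C₂ * C₂ * (Real.exp (-(w₁.re * y)) * Real.exp (-(w₂.re * y))) := by ring
        _ = _ := by rw [← Real.exp_add]; congr 2; ring
    have n2 : ‖cubicKernel (2 * R) y / (w₁ * w₂)‖ ≤
        C₃ * (1 / ε ^ 2) * Real.exp (-((w₁.re + w₂.re) * y)) := by
      rw [norm_div, div_eq_mul_one_div]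
      calc _ ≤ C₃ * Real.exp (-((w₁.re + w₂.re) * y)) * (1 / ε ^ 2) := by
            gcongr
            exact (hC₃ y hy1).trans (by gcongr)
        _ = _ := by ring
    have n3 : ‖(w₁ ^ 2 + w₂ ^ 2) / (12 * w₁ * w₂) * cschKernel (2 * R) y‖ ≤
        (2 * R ^ 2) / (12 * ε ^ 2) * (2 * R * C₄) * Real.exp (-((w₁.re + w₂.re) * y)) := by
      have a1 := hC₄ (2 * R : ℝ) (by simp) y hy1
      rw [Complex.ofReal_re] at a1
      rw [norm_mul, cschKernel, norm_div, norm_div, mul_assoc 12, norm_mul 12,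
        Complex.norm_real, Real.norm_of_nonneg hc.le, div_eq_mul_inv (2 * R)]
      have h12 : ‖(12 : ℂ)‖ = 12 := by simp
      rw [h12]
      calc _ ≤ (2 * R ^ 2) / (12 * ε ^ 2) *
            (2 * R * (C₄ * Real.exp (-((w₁.re + w₂.re) * y)))) := by
            gcongr
            · refine (norm_add_le _ _).trans ?_
              rw [norm_pow, norm_pow, two_mul]
              gcongr
            · exact a1.trans (by gcongr)
        _ = _ := by ring
    rw [remKernel]
    refine (norm_add_le _ _).trans ((add_le_add ((norm_sub_le _ _).trans (add_le_add n1 n2))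
      n3).trans ?_)
    have h6 : 0 ≤ C₁ * Real.exp 1 * Real.exp (-((w₁.re + w₂.re) * y)) := by positivity
    rw [hD]
    linarith

end Kernel

/-! ### The sine transform of the cubic kernel. -/

section CubicIntegral

theorem integrableOn_Ioi_of_bounds {f : ℝ → ℂ} (hf : ContinuousOn f (Ioi 0)) {y₀ C : ℝ}
    (hy₀ : 0 < y₀) {g : ℝ → ℝ} (h₁ : ∀ y, 0 < y → y ≤ y₀ → ‖f y‖ ≤ C)
    (hg : IntegrableOn g (Ioi y₀)) (h₂ : ∀ y, y₀ < y → ‖f y‖ ≤ g y) : IntegrableOn f (Ioi 0) := by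
  have hm := hf.aestronglyMeasurable (μ := volume) measurableSet_Ioi
  rw [← Ioc_union_Ioi_eq_Ioi hy₀.le, integrableOn_union]
  constructor
  · refine Integrable.mono' (g := fun _ => C) (integrableOn_const (by simp))
      (hm.mono_set Ioc_subset_Ioi_self) ?_
    filter_upwards [ae_restrict_mem measurableSet_Ioc] with y hy using h₁ y hy.1 hy.2
  · refine hg.mono' (hm.mono_set (Ioi_subset_Ioi hy₀.le)) ?_
    filter_upwards [ae_restrict_mem measurableSet_Ioi] with y hy using h₂ y hy

theorem norm_sin_two_mul_le (z : ℂ) {y : ℝ} (hy : 0 ≤ y) :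
    ‖Complex.sin (2 * y * z)‖ ≤ Real.exp (2 * |z.im| * y) := by
  have him : |(2 * (y : ℂ) * z).im| = 2 * |z.im| * y := by
    have : (2 * (y : ℂ) * z).im = 2 * y * z.im := by
      rw [show (2 * (y : ℂ) * z) = ((2 * y : ℝ) : ℂ) * z by push_cast; ring, Complex.im_ofReal_mul]
    rw [this, abs_mul, abs_of_nonneg (by positivity : 0 ≤ 2 * y)]; ring
  have := norm_sin_le (2 * y * z)
  rwa [him] at this

theorem norm_cos_two_mul_le (z : ℂ) {y : ℝ} (hy : 0 ≤ y) :
    ‖Complex.cos (2 * y * z)‖ ≤ Real.exp (2 * |z.im| * y) := by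
  have him : |(2 * (y : ℂ) * z).im| = 2 * |z.im| * y := by
    have : (2 * (y : ℂ) * z).im = 2 * y * z.im := by
      rw [show (2 * (y : ℂ) * z) = ((2 * y : ℝ) : ℂ) * z by push_cast; ring, Complex.im_ofReal_mul]
    rw [this, abs_mul, abs_of_nonneg (by positivity : 0 ≤ 2 * y)]; ring
  have := norm_cos_le (2 * y * z)
  rwa [him] at this

theorem norm_sin_sub_self_le {u : ℂ} (hu : ‖u‖ ≤ 1) : ‖Complex.sin u - u‖ ≤ ‖u‖ ^ 3 := by
  have h := Complex.sin_bound hu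
  have h1 : ‖Complex.sin u - u‖ ≤ ‖Complex.sin u - (u - u ^ 3 / 6)‖ + ‖u ^ 3 / 6‖ := by
    calc ‖Complex.sin u - u‖ = ‖(Complex.sin u - (u - u ^ 3 / 6)) - u ^ 3 / 6‖ := by
          congr 1; ring
      _ ≤ _ := norm_sub_le _ _
  have h2 : ‖u ^ 3 / 6‖ = ‖u‖ ^ 3 / 6 := by simp
  have h3 : ‖u‖ ^ 5 ≤ ‖u‖ ^ 3 := pow_le_pow_of_le_one (norm_nonneg u) hu (by norm_num)
  have h4 : 0 ≤ ‖u‖ ^ 3 := by positivity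
  linarith

theorem norm_cos_sub_one_le {u : ℂ} (hu : ‖u‖ ≤ 1) : ‖Complex.cos u - 1‖ ≤ ‖u‖ ^ 2 := by
  have h := Complex.cos_bound hu
  have h1 : ‖Complex.cos u - 1‖ ≤ ‖Complex.cos u - (1 - u ^ 2 / 2)‖ + ‖u ^ 2 / 2‖ := by
    calc ‖Complex.cos u - 1‖ = ‖(Complex.cos u - (1 - u ^ 2 / 2)) - u ^ 2 / 2‖ := by
          congr 1; ring
      _ ≤ _ := norm_sub_le _ _
  have h2 : ‖u ^ 2 / 2‖ = ‖u‖ ^ 2 / 2 := by simp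
  have h3 : ‖u‖ ^ 4 ≤ ‖u‖ ^ 2 := pow_le_pow_of_le_one (norm_nonneg u) hu (by norm_num)
  have h4 : 0 ≤ ‖u‖ ^ 2 := by positivity
  linarith

theorem continuousOn_cubicKernel {c : ℝ} (hc : 0 < c) : ContinuousOn (cubicKernel c) (Ioi 0) := by
  unfold cubicKernel
  refine ContinuousOn.div (by fun_prop) (by fun_prop) fun y hy => pow_ne_zero _ ?_
  exact sinh_ne_zero_of_re_pos (by
    rw [← Complex.ofReal_mul, Complex.ofReal_re]; exact mul_pos hc hy)

theorem integrableOn_inv_sq {y₀ : ℝ} (hy₀ : 0 < y₀) :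
    IntegrableOn (fun y : ℝ => 1 / y ^ 2) (Ioi y₀) := by
  refine (integrableOn_Ioi_rpow_of_lt (a := -2) (by norm_num) hy₀).congr_fun
    (fun y hy => ?_) measurableSet_Ioi
  have hy0 : 0 < y := hy₀.trans hy
  simp only [Real.rpow_neg hy0.le, one_div]
  norm_cast

theorem integrableOn_exp_neg {a y₀ : ℝ} (ha : 0 < a) :
    IntegrableOn (fun y : ℝ => Real.exp (-(a * y))) (Ioi y₀) := by
  simpa using exp_neg_integrableOn_Ioi y₀ ha

theorem integrableOn_cubic {c : ℝ} (hc : 0 < c) {z : ℂ} (hz : |z.im| < c / 2) :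
    IntegrableOn (fun y : ℝ => Complex.sin (2 * y * z) * cubicKernel c y - z / y ^ 2) (Ioi 0) := by
  obtain ⟨C, hC⟩ := exists_norm_cubicKernel_sub_le hc
  set y₀ : ℝ := min (1 / c) (1 / (2 * ‖z‖ + 1)) with hy₀d
  have hy₀ : 0 < y₀ := by positivity
  obtain ⟨D, hD0, hD⟩ := exists_norm_cubicKernel_le hc hy₀
  have ha : 0 < c - 2 * |z.im| := by linarith
  refine integrableOn_Ioi_of_bounds (y₀ := y₀)
    (C := Real.exp (2 * |z.im| * y₀) * (|C| * y₀) + 4 * ‖z‖ ^ 3)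
    (g := fun y => D * Real.exp (-((c - 2 * |z.im|) * y)) + ‖z‖ * (1 / y ^ 2)) ?_ hy₀ ?_ ?_ ?_
  · refine ContinuousOn.sub (ContinuousOn.mul (by fun_prop) (continuousOn_cubicKernel hc)) ?_
    exact ContinuousOn.div (by fun_prop) (by fun_prop) fun y hy =>
      pow_ne_zero _ (by exact_mod_cast (show (0 : ℝ) < y from hy).ne')
  · intro y hy hyy
    have hy0 : (y : ℂ) ≠ 0 := by exact_mod_cast hy.ne'
    have h1 : c * y ≤ 1 := by
      have := hyy.trans (min_le_left _ _)
      rwa [le_div_iff₀ hc, mul_comm] at this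
    have hzpos : 0 < 2 * ‖z‖ + 1 := by positivity
    have h2 : ‖2 * (y : ℂ) * z‖ ≤ 1 := by
      have := hyy.trans (min_le_right _ _)
      rw [le_div_iff₀ hzpos] at this
      rw [norm_mul, norm_mul, Complex.norm_real, Complex.norm_two, Real.norm_of_nonneg hy.le]
      nlinarith
    have e : Complex.sin (2 * y * z) * cubicKernel c y - z / y ^ 2 =
        Complex.sin (2 * y * z) * (cubicKernel c y - 1 / (2 * y ^ 3)) +
          (Complex.sin (2 * y * z) - 2 * y * z) * (1 / (2 * y ^ 3)) := by
      field_simp; ring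
    rw [e]
    refine (norm_add_le _ _).trans (add_le_add ?_ ?_)
    · rw [norm_mul]
      refine mul_le_mul ((norm_sin_two_mul_le z hy.le).trans ?_) ((hC y hy h1).trans ?_)
        (norm_nonneg _) (Real.exp_nonneg _)
      · gcongr
      · calc C * y ≤ |C| * y := by gcongr; exact le_abs_self C
          _ ≤ |C| * y₀ := by gcongr
    · rw [norm_mul]
      have h3 := norm_sin_sub_self_le h2
      have h4 : ‖(1 / (2 * y ^ 3) : ℂ)‖ = 1 / (2 * y ^ 3) := by simp [abs_of_pos hy]
      have h5 : ‖2 * (y : ℂ) * z‖ = 2 * y * ‖z‖ := by simp [abs_of_pos hy]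
      rw [h4]
      rw [h5] at h3
      calc _ ≤ (2 * y * ‖z‖) ^ 3 * (1 / (2 * y ^ 3)) := by gcongr
        _ = 4 * ‖z‖ ^ 3 := by field_simp; ring
  · exact ((integrableOn_exp_neg ha).const_mul D).add ((integrableOn_inv_sq hy₀).const_mul ‖z‖)
  · intro y hy
    have hy0 : 0 < y := hy₀.trans hy
    refine (norm_sub_le _ _).trans (add_le_add ?_ ?_)
    · rw [norm_mul]
      calc _ ≤ Real.exp (2 * |z.im| * y) * (D * Real.exp (-(c * y))) := by
            gcongr
            · exact norm_sin_two_mul_le z hy0.le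
            · exact hD y hy.le
        _ = D * (Real.exp (2 * |z.im| * y) * Real.exp (-(c * y))) := by ring
        _ = _ := by rw [← Real.exp_add]; congr 2; ring
    · simp [div_eq_mul_inv]

theorem tendsto_agree_sub_one_div {f q : ℂ → ℂ} (hq : Continuous q)
    (hf : AgreeToThirdOrder f (fun u => 1 + u ^ 2 * q u)) {c : ℝ} (hc : 0 < c) :
    Tendsto (fun y : ℝ => (f (c * y) - 1) / y) (𝓝[>] 0) (𝓝 0) := by
  obtain ⟨C, hC⟩ := hf
  obtain ⟨Q, hQ⟩ := (isCompact_closedBall (0 : ℂ) 1).exists_bound_of_continuousOn hq.continuousOn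
  have hC0 : 0 ≤ C := by simpa using (norm_nonneg _).trans (hC 1 one_ne_zero (by simp))
  refine squeeze_zero_norm' (a := fun y : ℝ => (C + Q) * c ^ 2 * y) ?_ ?_
  · have h1 : ∀ᶠ y : ℝ in 𝓝[>] 0, y < 1 / c :=
      (gt_mem_nhds (by positivity)).filter_mono nhdsWithin_le_nhds
    filter_upwards [self_mem_nhdsWithin, h1] with y hy hy1
    have hy0 : (0 : ℝ) < y := hy
    have hcy : c * y ≤ 1 := by rw [lt_div_iff₀ hc] at hy1; linarith
    have hcy0 : 0 < c * y := mul_pos hc hy0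
    have hn : ‖(c : ℂ) * y‖ = c * y := by simp [abs_of_pos hc, abs_of_pos hy0]
    have h2 := hC (c * y) (by exact_mod_cast hcy0.ne') (by rw [hn]; exact hcy)
    have h3 := hQ (c * y) (by simpa [abs_of_pos hc, abs_of_pos hy0] using hcy)
    have h4 : ‖f (c * y) - 1‖ ≤ C * (c * y) ^ 4 + (c * y) ^ 2 * Q := by
      calc ‖f (c * y) - 1‖ = ‖(f (c * y) - (1 + ((c : ℂ) * y) ^ 2 * q (c * y))) +
            ((c : ℂ) * y) ^ 2 * q (c * y)‖ := by congr 1; ring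
        _ ≤ C * ‖(c : ℂ) * y‖ ^ 4 + ‖(c : ℂ) * y‖ ^ 2 * Q := by
          refine (norm_add_le _ _).trans (add_le_add h2 ?_)
          rw [norm_mul, norm_pow]
          gcongr
        _ = _ := by rw [hn]
    have h5 : (c * y) ^ 4 ≤ (c * y) ^ 2 :=
      pow_le_pow_of_le_one hcy0.le hcy (by norm_num)
    rw [norm_div, Complex.norm_real, Real.norm_of_nonneg hy0.le, div_le_iff₀ hy0]
    calc _ ≤ C * (c * y) ^ 2 + (c * y) ^ 2 * Q := h4.trans (by gcongr)
      _ = _ := by ring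
  · have : Tendsto (fun y : ℝ => (C + Q) * c ^ 2 * y) (𝓝 0) (𝓝 ((C + Q) * c ^ 2 * 0)) :=
      tendsto_id.const_mul _
    rw [mul_zero] at this
    exact this.mono_left nhdsWithin_le_nhds

/-- An antiderivative arising from two integrations by parts. -/
def cubicPrimitive (c : ℝ) (z : ℂ) (y : ℝ) : ℂ :=
  -(1 / 4) * Complex.sin (2 * y * z) * (c ^ 2 * Complex.cosh (c * y) / Complex.sinh (c * y) ^ 2) -
    1 / 2 * z * Complex.cos (2 * y * z) * (c / Complex.sinh (c * y)) + z / y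

/-- Integrating by parts twice moves the second derivative from `c / sinh (c y)` to the sine; what
is left is the known transform of `1 / sinh`. The term `z / y` accounts for the subtracted double
pole. -/
theorem hasDerivAt_cubicPrimitive {c : ℝ} (hc : 0 < c) (z : ℂ) {y : ℝ} (hy : 0 < y) :
    HasDerivAt (cubicPrimitive c z) (Complex.sin (2 * y * z) * cubicKernel c y - z / y ^ 2 +
      z ^ 2 * c * (Complex.sin (2 * y * z) / Complex.sinh (c * y))) y := by
  have hs : Complex.sinh (c * y) ≠ 0 := sinh_ne_zero_of_re_pos (by
    rw [← Complex.ofReal_mul, Complex.ofReal_re]; exact mul_pos hc hy)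
  have hy0 : (y : ℂ) ≠ 0 := by exact_mod_cast hy.ne'
  have hid : HasDerivAt (fun x : ℂ => x) 1 (y : ℂ) := hasDerivAt_id _
  have h1 : HasDerivAt (fun x : ℂ => 2 * x * z) (2 * z) (y : ℂ) := by
    simpa using (hid.const_mul 2).mul_const z
  have h2 : HasDerivAt (fun x : ℂ => (c : ℂ) * x) c (y : ℂ) := by
    simpa using hid.const_mul (c : ℂ)
  have h3 := (((h1.csin.const_mul (-(1 / 4))).mul (((h2.ccosh.const_mul ((c : ℂ) ^ 2))).div
    (h2.csinh.pow 2) (pow_ne_zero 2 hs))).sub ((h1.ccos.const_mul (1 / 2 * z)).mul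
    ((hasDerivAt_const (y : ℂ) (c : ℂ)).div h2.csinh hs))).add
    ((hasDerivAt_const (y : ℂ) z).div hid hy0)
  refine (h3.comp_ofReal).congr_deriv ?_
  rw [cubicKernel]
  simp only [Pi.pow_apply, Pi.div_apply]
  have hT := Complex.cosh_sq (c * y)
  generalize Complex.sinh (c * y) = S at *
  generalize Complex.cosh (c * y) = T at *
  generalize Complex.sin (2 * y * z) = U
  generalize Complex.cos (2 * y * z) = V
  field_simp
  linear_combination 2 * c ^ 3 * U * y ^ 2 * S * hT

theorem tendsto_cubicPrimitive_zero {c : ℝ} (hc : 0 < c) (z : ℂ) :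
    Tendsto (cubicPrimitive c z) (𝓝[>] 0) (𝓝 0) := by
  have hs := agreeToThirdOrder_div_sinh
  have l1 := tendsto_agree_sub_one_div (q := fun u => -(1 / 6)) (by fun_prop)
    (show AgreeToThirdOrder _ _ by convert hs using 2; ring) hc
  have l2 := tendsto_agree_sub_one_div
    (f := fun u => (u / Complex.sinh u) * (u / Complex.sinh u) * Complex.cosh u)
    (q := fun u => 1 / 6 - 5 / 36 * u ^ 2 + u ^ 4 / 72) (by fun_prop) (by
      convert (hs.mul hs (by fun_prop) (by fun_prop)).mul agreeToThirdOrder_cosh (by fun_prop)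
        (by fun_prop) using 2
      ring) hc
  have hid : Tendsto (fun y : ℝ => (y : ℂ)) (𝓝[>] 0) (𝓝 0) := by
    have : Tendsto (fun y : ℝ => (y : ℂ)) (𝓝 0) (𝓝 ((0 : ℝ) : ℂ)) :=
      Complex.continuous_ofReal.tendsto 0
    rw [Complex.ofReal_zero] at this
    exact this.mono_left nhdsWithin_le_nhds
  have hidR : Tendsto (fun y : ℝ => y) (𝓝[>] 0) (𝓝 0) :=
    tendsto_id.mono_left nhdsWithin_le_nhds
  have hsmall : ∀ᶠ y : ℝ in 𝓝[>] 0, ‖2 * (y : ℂ) * z‖ ≤ 1 := by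
    have : Tendsto (fun y : ℝ => ‖2 * (y : ℂ) * z‖) (𝓝[>] 0) (𝓝 0) := by
      simpa using ((hid.const_mul 2).mul_const z).norm
    exact this.eventually_le_const one_pos
  have l3 : Tendsto (fun y : ℝ => (Complex.sin (2 * y * z) - 2 * y * z) / y ^ 2) (𝓝[>] 0)
      (𝓝 0) := by
    refine squeeze_zero_norm' (a := fun y : ℝ => 8 * ‖z‖ ^ 3 * y) ?_ (by
      simpa using hidR.const_mul (8 * ‖z‖ ^ 3))
    filter_upwards [self_mem_nhdsWithin, hsmall] with y hy hy1
    have hy0 : (0 : ℝ) < y := hy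
    have := norm_sin_sub_self_le hy1
    rw [norm_div, norm_pow, Complex.norm_real, Real.norm_of_nonneg hy0.le,
      div_le_iff₀ (by positivity)]
    refine this.trans (le_of_eq ?_)
    rw [norm_mul, norm_mul, Complex.norm_two, Complex.norm_real, Real.norm_of_nonneg hy0.le]
    ring
  have l4 : Tendsto (fun y : ℝ => (Complex.cos (2 * y * z) - 1) / y) (𝓝[>] 0) (𝓝 0) := by
    refine squeeze_zero_norm' (a := fun y : ℝ => 4 * ‖z‖ ^ 2 * y) ?_ (by
      simpa using hidR.const_mul (4 * ‖z‖ ^ 2))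
    filter_upwards [self_mem_nhdsWithin, hsmall] with y hy hy1
    have hy0 : (0 : ℝ) < y := hy
    have := norm_cos_sub_one_le hy1
    rw [norm_div, Complex.norm_real, Real.norm_of_nonneg hy0.le, div_le_iff₀ hy0]
    refine this.trans (le_of_eq ?_)
    rw [norm_mul, norm_mul, Complex.norm_two, Complex.norm_real, Real.norm_of_nonneg hy0.le]
    ring
  -- Each regular factor is written as `1` plus `y` times a null function. The remaining multiples
  -- of `z / y` have coefficients `-1/2`, `-1/2` and `1` and cancel.
  have l := (((l3.const_mul (-(1 / 4))).mul ((l2.mul hid).add_const 1)).sub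
    (l2.const_mul (1 / 2 * z))).sub (((l4.mul ((l1.mul hid).add_const 1)).add l1).const_mul
      (1 / 2 * z))
  simp only [mul_zero, zero_mul, add_zero, sub_zero] at l
  refine l.congr' ?_
  filter_upwards [self_mem_nhdsWithin] with y hy
  have hy0 : (0 : ℝ) < y := hy
  have hs : Complex.sinh (c * y) ≠ 0 := sinh_ne_zero_of_re_pos (by
    rw [← Complex.ofReal_mul, Complex.ofReal_re]; exact mul_pos hc hy0)
  have hy1 : (y : ℂ) ≠ 0 := by exact_mod_cast hy0.ne'
  rw [cubicPrimitive]
  generalize Complex.sinh (c * y) = S at *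
  generalize Complex.cosh (c * y) = T
  generalize Complex.sin (2 * y * z) = U
  generalize Complex.cos (2 * y * z) = V
  field_simp
  ring

theorem tendsto_cubicPrimitive_atTop {c : ℝ} (hc : 0 < c) {z : ℂ} (hz : |z.im| < c / 2) :
    Tendsto (cubicPrimitive c z) atTop (𝓝 0) := by
  obtain ⟨C, hC0, hC⟩ := exists_inv_norm_sinh_le hc one_pos
  have ha : 0 < c - 2 * |z.im| := by linarith
  refine squeeze_zero_norm' (a := fun y : ℝ => (1 / 4 * c ^ 2 * C ^ 2 + 1 / 2 * ‖z‖ * c * C) *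
    Real.exp (-((c - 2 * |z.im|) * y)) + ‖z‖ * y⁻¹) ?_ ?_
  · filter_upwards [eventually_ge_atTop 1] with y hy
    have hy0 : 0 < y := one_pos.trans_le hy
    have h1 := hC c (by simp) y hy
    rw [Complex.ofReal_re] at h1
    have h2 := norm_sin_two_mul_le z hy0.le
    have h3 := norm_cos_two_mul_le z hy0.le
    have h4 := norm_cosh_le (c * y)
    have h5 : |((c : ℂ) * y).re| = c * y := by
      rw [← Complex.ofReal_mul, Complex.ofReal_re, abs_of_pos (mul_pos hc hy0)]
    rw [h5] at h4
    have hcn : ‖(c : ℂ)‖ = c := by simp [abs_of_pos hc]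
    have e1 : Real.exp (c * y) * Real.exp (-(c * y)) = 1 := by rw [← Real.exp_add]; simp
    have e2 : Real.exp (-((c - 2 * |z.im|) * y)) =
        Real.exp (2 * |z.im| * y) * Real.exp (-(c * y)) := by
      rw [← Real.exp_add]; congr 1; ring
    have n1 : ‖-(1 / 4) * Complex.sin (2 * y * z) *
        (c ^ 2 * Complex.cosh (c * y) / Complex.sinh (c * y) ^ 2)‖ ≤
        1 / 4 * c ^ 2 * C ^ 2 * Real.exp (-((c - 2 * |z.im|) * y)) := by
      rw [norm_mul, norm_mul, norm_div, norm_mul, norm_pow, norm_pow, hcn, norm_neg,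
        div_eq_mul_inv _ (_ ^ 2), ← inv_pow]
      have : ‖(1 / 4 : ℂ)‖ = 1 / 4 := by simp
      rw [this]
      calc _ ≤ 1 / 4 * Real.exp (2 * |z.im| * y) * (c ^ 2 * Real.exp (c * y) *
            (C * Real.exp (-(c * y))) ^ 2) := by gcongr
        _ = 1 / 4 * c ^ 2 * C ^ 2 * (Real.exp (2 * |z.im| * y) * Real.exp (-(c * y))) *
            (Real.exp (c * y) * Real.exp (-(c * y))) := by ring
        _ = _ := by rw [e1, e2, mul_one]
    have n2 : ‖1 / 2 * z * Complex.cos (2 * y * z) * (c / Complex.sinh (c * y))‖ ≤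
        1 / 2 * ‖z‖ * c * C * Real.exp (-((c - 2 * |z.im|) * y)) := by
      rw [norm_mul, norm_mul, norm_mul, norm_div (c : ℂ), hcn, div_eq_mul_inv c]
      have : ‖(1 / 2 : ℂ)‖ = 1 / 2 := by simp
      rw [this]
      calc _ ≤ 1 / 2 * ‖z‖ * Real.exp (2 * |z.im| * y) * (c * (C * Real.exp (-(c * y)))) := by
            gcongr
        _ = 1 / 2 * ‖z‖ * c * C * (Real.exp (2 * |z.im| * y) * Real.exp (-(c * y))) := by ring
        _ = _ := by rw [e2]
    have n3 : ‖z / y‖ = ‖z‖ * y⁻¹ := by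
      rw [norm_div, Complex.norm_real, Real.norm_of_nonneg hy0.le, div_eq_mul_inv]
    rw [cubicPrimitive]
    refine (norm_add_le _ _).trans ((add_le_add ((norm_sub_le _ _).trans (add_le_add n1 n2))
      n3.le).trans (le_of_eq (by ring)))
  · have h1 : Tendsto (fun y : ℝ => Real.exp (-((c - 2 * |z.im|) * y))) atTop (𝓝 0) :=
      Real.tendsto_exp_neg_atTop_nhds_zero.comp (tendsto_id.const_mul_atTop ha)
    simpa using (h1.const_mul _).add (tendsto_inv_atTop_zero.const_mul ‖z‖)

theorem integral_cubic {c : ℝ} (hc : 0 < c) {z : ℂ} (hz : |z.im| < c / 2) :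
    ∫ y in Ioi (0 : ℝ), (Complex.sin (2 * y * z) * cubicKernel c y - z / y ^ 2) =
      -(Real.pi / 2) * z ^ 2 * Complex.tanh (Real.pi * z / c) := by
  have hi1 := integrableOn_cubic hc hz
  have hi2 := (integrableOn_sin_div_sinh_mul hc hz).const_mul (z ^ 2 * c)
  have hc0 : (c : ℂ) ≠ 0 := by exact_mod_cast hc.ne'
  -- The default values of the divisions at `y = 0` give `0`, which happens to be the right-hand
  -- limit, so the primitive is continuous from the right there.
  have h0 : cubicPrimitive c z 0 = 0 := by simp [cubicPrimitive]
  have h := integral_Ioi_of_hasDerivAt_of_tendsto (f := cubicPrimitive c z) (a := 0) (m := 0)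
    (by
      rw [← continuousWithinAt_Ioi_iff_Ici, ContinuousWithinAt, h0]
      exact tendsto_cubicPrimitive_zero hc z)
    (fun y hy => hasDerivAt_cubicPrimitive hc z hy) (hi1.add hi2)
    (tendsto_cubicPrimitive_atTop hc hz)
  rw [h0, sub_zero, integral_add hi1 hi2, integral_const_mul,
    integral_sin_div_sinh_mul hc hz] at h
  rw [eq_neg_of_add_eq_zero_left h]
  field_simp

end CubicIntegral

/-! ### Holomorphy and asymptotics of the defining integral of `G`. -/

section Decomposition

theorem differentiableAt_fun_div {E : Type*} [NormedAddCommGroup E] [NormedSpace ℂ E]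
    {f g : E → ℂ} {x : E} (hf : DifferentiableAt ℂ f x) (hg : DifferentiableAt ℂ g x)
    (h0 : g x ≠ 0) : DifferentiableAt ℂ (fun y => f y / g y) x := by
  simp only [div_eq_mul_inv]
  exact hf.fun_mul (hg.fun_inv h0)

/-- The contribution to `gInt` of the kernel `remKernel`. -/
def remInt (c : ℝ) (w₁ w₂ z : ℂ) : ℂ :=
  ∫ y in Ioi (0 : ℝ), Complex.sin (2 * y * z) * remKernel c w₁ w₂ y

theorem sinh_mul_ofReal_ne_zero {w : ℂ} (hw : 0 < w.re) {y : ℝ} (hy : 0 < y) :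
    Complex.sinh (w * y) ≠ 0 :=
  sinh_ne_zero_of_re_pos (by rw [Complex.re_mul_ofReal]; exact mul_pos hw hy)

theorem ne_zero_of_re_pos {w : ℂ} (hw : 0 < w.re) : w ≠ 0 := by
  rintro rfl; simp at hw

theorem continuousOn_remKernel {c : ℝ} (hc : 0 < c) {w₁ w₂ : ℂ} (h₁ : 0 < w₁.re)
    (h₂ : 0 < w₂.re) : ContinuousOn (remKernel c w₁ w₂) (Ioi 0) := by
  unfold remKernel gammaKernel cschKernel
  refine ((ContinuousOn.div (by fun_prop) (by fun_prop) fun y hy => ?_).sub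
    ((continuousOn_cubicKernel hc).div_const _)).add (ContinuousOn.mul (by fun_prop)
      (ContinuousOn.div (by fun_prop) (by fun_prop) fun y hy => ?_))
  · exact mul_ne_zero (mul_ne_zero (mul_ne_zero two_ne_zero (by
      exact_mod_cast (show (0 : ℝ) < y from hy).ne')) (sinh_mul_ofReal_ne_zero h₁ hy))
      (sinh_mul_ofReal_ne_zero h₂ hy)
  · exact sinh_mul_ofReal_ne_zero (by simpa using hc) hy

theorem norm_sin_mul_remKernel_le {ε R C : ℝ}
    (hC0 : 0 ≤ C) (hC : ∀ w₁ w₂ : ℂ, ε ≤ w₁.re → ε ≤ w₂.re → ‖w₁‖ ≤ R → ‖w₂‖ ≤ R →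
      ∀ y : ℝ, 0 < y → ‖remKernel (2 * R) w₁ w₂ y‖ ≤ C * Real.exp (-((w₁.re + w₂.re) * y)))
    {w₁ w₂ z : ℂ} (h₁ : ε ≤ w₁.re) (h₂ : ε ≤ w₂.re) (hw₁ : ‖w₁‖ ≤ R) (hw₂ : ‖w₂‖ ≤ R)
    {δ : ℝ} (hδ : δ ≤ w₁.re + w₂.re - 2 * |z.im|) {y : ℝ} (hy : 0 < y) :
    ‖Complex.sin (2 * y * z) * remKernel (2 * R) w₁ w₂ y‖ ≤ C * Real.exp (-(δ * y)) := by
  rw [norm_mul]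
  calc _ ≤ Real.exp (2 * |z.im| * y) * (C * Real.exp (-((w₁.re + w₂.re) * y))) := by
        gcongr
        · exact norm_sin_two_mul_le z hy.le
        · exact hC w₁ w₂ h₁ h₂ hw₁ hw₂ y hy
    _ = C * (Real.exp (2 * |z.im| * y) * Real.exp (-((w₁.re + w₂.re) * y))) := by ring
    _ ≤ _ := by
      rw [← Real.exp_add]
      gcongr
      nlinarith

theorem half_re (w₁ w₂ : ℂ) : ((w₁ + w₂) / 2).re = (w₁.re + w₂.re) / 2 := by simp

theorem integrableOn_remKernel {ε R : ℝ} (hε : 0 < ε) (hR : 0 < R) {w₁ w₂ z : ℂ}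
    (h₁ : ε ≤ w₁.re) (h₂ : ε ≤ w₂.re) (hw₁ : ‖w₁‖ ≤ R) (hw₂ : ‖w₂‖ ≤ R)
    (hz : |z.im| < (w₁.re + w₂.re) / 2) :
    IntegrableOn (fun y : ℝ => Complex.sin (2 * y * z) * remKernel (2 * R) w₁ w₂ y) (Ioi 0) := by
  obtain ⟨C, hC0, hC⟩ := exists_norm_remKernel_le hε hR
  have hδ : 0 < w₁.re + w₂.re - 2 * |z.im| := by linarith
  refine ((integrableOn_exp_neg hδ).const_mul C).mono' ?_ ?_
  · exact (ContinuousOn.mul (by fun_prop) (continuousOn_remKernel (by positivity)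
      (hε.trans_le h₁) (hε.trans_le h₂))).aestronglyMeasurable measurableSet_Ioi
  · filter_upwards [ae_restrict_mem measurableSet_Ioi] with y hy
    exact norm_sin_mul_remKernel_le hC0 hC h₁ h₂ hw₁ hw₂ le_rfl hy

/-- The kernel is restored from its three parts; the regularizing term `z / (w₁ w₂ y²)` goes with
the cubic one. All growth in `z` now sits in explicit `tanh` terms. As `R` stays fixed while the
periods vary in a box, each part can be studied separately as a function of `(w₁, w₂, z)`. -/
theorem gInt_eq {ε R : ℝ} (hε : 0 < ε) (hR : 0 < R) {w₁ w₂ z : ℂ}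
    (h₁ : ε ≤ w₁.re) (h₂ : ε ≤ w₂.re) (hw₁ : ‖w₁‖ ≤ R) (hw₂ : ‖w₂‖ ≤ R)
    (hz : |z.im| < (w₁.re + w₂.re) / 2) :
    IntegrableOn (fun y : ℝ => (Complex.sin (2 * y * z) / (2 * Complex.sinh (w₁ * y) *
      Complex.sinh (w₂ * y)) - z / (w₁ * w₂ * y)) / y) (Ioi 0) ∧
    gInt w₁ w₂ z = 1 / (w₁ * w₂) * (-(Real.pi / 2) * z ^ 2 *
        Complex.tanh (Real.pi * z / (2 * R : ℝ))) -
      (w₁ ^ 2 + w₂ ^ 2) / (12 * w₁ * w₂) * (Real.pi / 2 * Complex.tanh (Real.pi * z / (2 * R : ℝ))) +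
      remInt (2 * R) w₁ w₂ z := by
  have hc : 0 < 2 * R := by positivity
  have hz' : |z.im| < 2 * R / 2 := by
    have := (Complex.re_le_norm w₁).trans hw₁
    have := (Complex.re_le_norm w₂).trans hw₂
    linarith
  have i1 := (integrableOn_cubic hc hz').const_mul (1 / (w₁ * w₂))
  have i2 := (integrableOn_sin_div_sinh_mul hc hz').const_mul
    ((w₁ ^ 2 + w₂ ^ 2) / (12 * w₁ * w₂) * (2 * R : ℝ))
  have i3 := integrableOn_remKernel hε hR h₁ h₂ hw₁ hw₂ hz
  have hc0 : ((2 * R : ℝ) : ℂ) ≠ 0 := by exact_mod_cast hc.ne'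
  have e : ∀ y ∈ Ioi (0 : ℝ), 1 / (w₁ * w₂) * (Complex.sin (2 * y * z) * cubicKernel (2 * R) y -
      z / y ^ 2) - (w₁ ^ 2 + w₂ ^ 2) / (12 * w₁ * w₂) * (2 * R : ℝ) * (Complex.sin (2 * y * z) /
      Complex.sinh ((2 * R : ℝ) * y)) + Complex.sin (2 * y * z) * remKernel (2 * R) w₁ w₂ y =
      (Complex.sin (2 * y * z) / (2 * Complex.sinh (w₁ * y) *
      Complex.sinh (w₂ * y)) - z / (w₁ * w₂ * y)) / y := by
    intro y hy
    have hy0 : (y : ℂ) ≠ 0 := by exact_mod_cast (show (0 : ℝ) < y from hy).ne'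
    have a1 := sinh_mul_ofReal_ne_zero (hε.trans_le h₁) hy
    have a2 := sinh_mul_ofReal_ne_zero (hε.trans_le h₂) hy
    have a3 := ne_zero_of_re_pos (hε.trans_le h₁)
    have a4 := ne_zero_of_re_pos (hε.trans_le h₂)
    rw [remKernel, gammaKernel, cschKernel]
    generalize Complex.sinh (w₁ * y) = S₁ at *
    generalize Complex.sinh (w₂ * y) = S₂ at *
    generalize Complex.sin (2 * y * z) = U
    generalize cubicKernel (2 * R) y = K
    field_simp
    ring
  have i12 : IntegrableOn (fun y : ℝ => 1 / (w₁ * w₂) * (Complex.sin (2 * y * z) *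
      cubicKernel (2 * R) y - z / y ^ 2) - (w₁ ^ 2 + w₂ ^ 2) / (12 * w₁ * w₂) * (2 * R : ℝ) *
      (Complex.sin (2 * y * z) / Complex.sinh ((2 * R : ℝ) * y))) (Ioi 0) := i1.sub i2
  refine ⟨IntegrableOn.congr_fun (Integrable.add i12 i3 : IntegrableOn _ _ _) e
    measurableSet_Ioi, ?_⟩
  rw [gInt, ← setIntegral_congr_fun measurableSet_Ioi e, integral_add i12 i3,
    integral_sub i1 i2, integral_const_mul, integral_const_mul, integral_cubic hc hz',
    integral_sin_div_sinh_mul hc hz', remInt]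
  congr 2
  field_simp

theorem exists_norm_remInt_le {ε R η : ℝ} (hε : 0 < ε) (hR : 0 < R) (hη : 0 < η) :
    ∃ C, ∀ w₁ w₂ z : ℂ, ε ≤ w₁.re → ε ≤ w₂.re → ‖w₁‖ ≤ R → ‖w₂‖ ≤ R →
      |z.im| ≤ (w₁.re + w₂.re) / 2 - η → ‖remInt (2 * R) w₁ w₂ z‖ ≤ C := by
  obtain ⟨C, hC0, hC⟩ := exists_norm_remKernel_le hε hR
  have h2η : 0 < 2 * η := by positivity
  refine ⟨∫ y in Ioi (0 : ℝ), C * Real.exp (-(2 * η * y)), fun w₁ w₂ z h₁ h₂ hw₁ hw₂ hz => ?_⟩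
  refine norm_integral_le_of_norm_le ((integrableOn_exp_neg h2η).const_mul C) ?_
  filter_upwards [ae_restrict_mem measurableSet_Ioi] with y hy
  exact norm_sin_mul_remKernel_le hC0 hC h₁ h₂ hw₁ hw₂ (by linarith) hy

/-- The domain of the integral representation of the hyperbolic gamma function. -/
def stripDomain : Set (ℂ × ℂ × ℂ) :=
  {q | 0 < q.1.re ∧ 0 < q.2.1.re ∧ |q.2.2.im| < ((q.1 + q.2.1) / 2).re}

theorem isOpen_stripDomain : IsOpen stripDomain := by
  have h1 : IsOpen {q : ℂ × ℂ × ℂ | 0 < q.1.re} := isOpen_lt (by fun_prop) (by fun_prop)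
  have h2 : IsOpen {q : ℂ × ℂ × ℂ | 0 < q.2.1.re} := isOpen_lt (by fun_prop) (by fun_prop)
  have h3 : IsOpen {q : ℂ × ℂ × ℂ | |q.2.2.im| < ((q.1 + q.2.1) / 2).re} :=
    isOpen_lt (by fun_prop) (by fun_prop)
  exact h1.inter (h2.inter h3)

/-- The points of `stripDomain` with bounded periods that are bounded away from the imaginary
axis. -/
def stripBox (ε R : ℝ) : Set (ℂ × ℂ × ℂ) :=
  {q | (ε < q.1.re ∧ ε < q.2.1.re) ∧ (‖q.1‖ < R ∧ ‖q.2.1‖ < R) ∧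
    |q.2.2.im| < (q.1.re + q.2.1.re) / 2}

theorem isOpen_stripBox (ε R : ℝ) : IsOpen (stripBox ε R) := by
  have h1 : IsOpen {q : ℂ × ℂ × ℂ | ε < q.1.re} := isOpen_lt (by fun_prop) (by fun_prop)
  have h2 : IsOpen {q : ℂ × ℂ × ℂ | ε < q.2.1.re} := isOpen_lt (by fun_prop) (by fun_prop)
  have h3 : IsOpen {q : ℂ × ℂ × ℂ | ‖q.1‖ < R} := isOpen_lt (by fun_prop) (by fun_prop)
  have h4 : IsOpen {q : ℂ × ℂ × ℂ | ‖q.2.1‖ < R} := isOpen_lt (by fun_prop) (by fun_prop)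
  have h5 : IsOpen {q : ℂ × ℂ × ℂ | |q.2.2.im| < (q.1.re + q.2.1.re) / 2} :=
    isOpen_lt (by fun_prop) (by fun_prop)
  exact (h1.inter h2).inter ((h3.inter h4).inter h5)

theorem exists_mem_stripBox {q : ℂ × ℂ × ℂ} (hq : q ∈ stripDomain) :
    ∃ ε R : ℝ, 0 < ε ∧ 0 < R ∧ q ∈ stripBox ε R := by
  obtain ⟨h1, h2, h3⟩ := hq
  rw [half_re] at h3
  refine ⟨min q.1.re q.2.1.re / 2, ‖q.1‖ + ‖q.2.1‖ + 1, half_pos (lt_min h1 h2), by positivity,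
    ⟨?_, ?_⟩, ⟨?_, ?_⟩, h3⟩
  · linarith [min_le_left q.1.re q.2.1.re]
  · linarith [min_le_right q.1.re q.2.1.re]
  · linarith [norm_nonneg q.2.1]
  · linarith [norm_nonneg q.1]

theorem differentiableOn_remInt {ε R : ℝ} (hε : 0 < ε) (hR : 0 < R) :
    DifferentiableOn ℂ (fun q : ℂ × ℂ × ℂ => remInt (2 * R) q.1 q.2.1 q.2.2) (stripBox ε R) := by
  obtain ⟨C, hC0, hC⟩ := exists_norm_remKernel_le hε hR
  unfold remInt
  refine differentiableOn_integral (isOpen_stripBox ε R) ?_ ?_ ?_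
  · filter_upwards [ae_restrict_mem measurableSet_Ioi] with y hy
    intro q hq
    have a1 := sinh_mul_ofReal_ne_zero (hε.trans hq.1.1) hy
    have a2 := sinh_mul_ofReal_ne_zero (hε.trans hq.1.2) hy
    have a3 := ne_zero_of_re_pos (hε.trans hq.1.1)
    have a4 := ne_zero_of_re_pos (hε.trans hq.1.2)
    have hy0 : (y : ℂ) ≠ 0 := by exact_mod_cast (show (0 : ℝ) < y from hy).ne'
    have d1 : DifferentiableAt ℂ (fun q : ℂ × ℂ × ℂ => Complex.sin (2 * y * q.2.2)) q := by fun_prop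
    have d2 : DifferentiableAt ℂ (fun q : ℂ × ℂ × ℂ => gammaKernel q.1 q.2.1 y) q := by
      unfold gammaKernel
      refine differentiableAt_fun_div ?_ ?_ ?_
      · fun_prop
      · fun_prop
      · exact mul_ne_zero (mul_ne_zero (mul_ne_zero two_ne_zero hy0) a1) a2
    have d3 : DifferentiableAt ℂ (fun q : ℂ × ℂ × ℂ => cubicKernel (2 * R) y / (q.1 * q.2.1)) q := by
      refine differentiableAt_fun_div ?_ ?_ ?_
      · fun_prop
      · fun_prop
      · exact mul_ne_zero a3 a4
    have d4 : DifferentiableAt ℂ (fun q : ℂ × ℂ × ℂ => (q.1 ^ 2 + q.2.1 ^ 2) / (12 * q.1 * q.2.1) *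
        cschKernel (2 * R) y) q := by
      refine DifferentiableAt.mul_const (differentiableAt_fun_div ?_ ?_ ?_) _
      · fun_prop
      · fun_prop
      · exact mul_ne_zero (mul_ne_zero (by norm_num) a3) a4
    exact (d1.mul ((d2.sub d3).add d4)).differentiableWithinAt
  · intro q hq
    exact (integrableOn_remKernel hε hR hq.1.1.le hq.1.2.le hq.2.1.1.le hq.2.1.2.le
      hq.2.2).aestronglyMeasurable
  · intro q hq
    set δ : ℝ := (q.1.re + q.2.1.re - 2 * |q.2.2.im|) / 2 with hδd
    have hδ : 0 < δ := by have := hq.2.2; rw [hδd]; linarith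
    have ho : IsOpen {p : ℂ × ℂ × ℂ | δ < p.1.re + p.2.1.re - 2 * |p.2.2.im|} :=
      isOpen_lt (by fun_prop) (by fun_prop)
    refine ⟨stripBox ε R ∩ {p : ℂ × ℂ × ℂ | δ < p.1.re + p.2.1.re - 2 * |p.2.2.im|},
      inter_mem ((isOpen_stripBox ε R).mem_nhds hq) (ho.mem_nhds ?_),
      fun y => C * Real.exp (-(δ * y)), (integrableOn_exp_neg hδ).const_mul C, ?_⟩
    · show δ < q.1.re + q.2.1.re - 2 * |q.2.2.im|
      rw [hδd] at hδ ⊢; linarith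
    · filter_upwards [ae_restrict_mem measurableSet_Ioi] with y hy p hp
      exact norm_sin_mul_remKernel_le hC0 hC hp.1.1.1.le hp.1.1.2.le hp.1.2.1.1.le hp.1.2.1.2.le
        (le_of_lt hp.2) hy

theorem cosh_re (v : ℂ) : (Complex.cosh v).re = Real.cosh v.re * Real.cos v.im := by
  conv_lhs => rw [← Complex.re_add_im v, Complex.cosh_add, Complex.cosh_mul_I, Complex.sinh_mul_I]
  simp [← Complex.ofReal_cosh, ← Complex.ofReal_sinh, ← Complex.ofReal_cos, ← Complex.ofReal_sin]

theorem cosh_ne_zero_of_abs_im_lt {v : ℂ} (hv : |v.im| < Real.pi / 2) : Complex.cosh v ≠ 0 := by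
  intro h
  have h1 := cosh_re v
  rw [h, Complex.zero_re] at h1
  exact absurd h1.symm (mul_pos (Real.cosh_pos _) (Real.cos_pos_of_mem_Ioo (abs_lt.1 hv))).ne'

theorem pi_mul_div_im {z : ℂ} {c : ℝ} : (Real.pi * z / c : ℂ).im = Real.pi * z.im / c := by
  rw [Complex.div_ofReal_im, Complex.im_ofReal_mul]

theorem abs_pi_mul_div_im_lt {z : ℂ} {c : ℝ} (hc : 0 < c) (hz : |z.im| < c / 2) :
    |(Real.pi * z / c : ℂ).im| < Real.pi / 2 := by
  rw [pi_mul_div_im, abs_div, abs_mul, abs_of_pos hc, abs_of_pos Real.pi_pos, div_lt_iff₀ hc]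
  nlinarith [Real.pi_pos]

theorem differentiableOn_gInt :
    DifferentiableOn ℂ (fun q : ℂ × ℂ × ℂ => gInt q.1 q.2.1 q.2.2) stripDomain := by
  intro q hq
  obtain ⟨ε, R, hε, hR, hqb⟩ := exists_mem_stripBox hq
  have hmem := (isOpen_stripBox ε R).mem_nhds hqb
  have hc : 0 < 2 * R := by positivity
  have a3 := ne_zero_of_re_pos (hε.trans hqb.1.1)
  have a4 := ne_zero_of_re_pos (hε.trans hqb.1.2)
  have hz' : |q.2.2.im| < 2 * R / 2 := by
    have := (Complex.re_le_norm q.1).trans hqb.2.1.1.le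
    have := (Complex.re_le_norm q.2.1).trans hqb.2.1.2.le
    linarith [hqb.2.2]
  have ht : DifferentiableAt ℂ (fun q : ℂ × ℂ × ℂ =>
      Complex.tanh (Real.pi * q.2.2 / (2 * R : ℝ))) q := by
    simp only [Complex.tanh_eq_sinh_div_cosh]
    refine differentiableAt_fun_div ?_ ?_ ?_
    · fun_prop
    · fun_prop
    · exact cosh_ne_zero_of_abs_im_lt (abs_pi_mul_div_im_lt hc hz')
  have d : DifferentiableAt ℂ (fun q : ℂ × ℂ × ℂ =>
      1 / (q.1 * q.2.1) * (-(Real.pi / 2) * q.2.2 ^ 2 *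
        Complex.tanh (Real.pi * q.2.2 / (2 * R : ℝ))) -
      (q.1 ^ 2 + q.2.1 ^ 2) / (12 * q.1 * q.2.1) * (Real.pi / 2 *
        Complex.tanh (Real.pi * q.2.2 / (2 * R : ℝ))) + remInt (2 * R) q.1 q.2.1 q.2.2) q := by
    refine DifferentiableAt.fun_add (DifferentiableAt.fun_sub (DifferentiableAt.fun_mul
      (differentiableAt_fun_div ?_ ?_ ?_) ?_)
      (DifferentiableAt.fun_mul (differentiableAt_fun_div ?_ ?_ ?_) ?_))
      ((differentiableOn_remInt hε hR).differentiableAt hmem)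
    · fun_prop
    · fun_prop
    · exact mul_ne_zero a3 a4
    · exact DifferentiableAt.fun_mul (by fun_prop) ht
    · fun_prop
    · fun_prop
    · exact mul_ne_zero (mul_ne_zero (by norm_num) a3) a4
    · exact ht.const_mul _
  refine (d.congr_of_eventuallyEq ?_).differentiableWithinAt
  filter_upwards [hmem] with p hp
  exact (gInt_eq hε hR hp.1.1.le hp.1.2.le hp.2.1.1.le hp.2.1.2.le hp.2.2).2

theorem tanh_sub_eq {v : ℂ} (hv : Complex.cosh v ≠ 0) {σ : ℝ} (hσ : σ = 1 ∨ σ = -1) :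
    Complex.tanh v - σ = -σ * Complex.exp (-(σ * v)) / Complex.cosh v := by
  rw [eq_div_iff hv, sub_mul, Complex.tanh_eq_sinh_div_cosh, div_mul_cancel₀ _ hv]
  rcases hσ with rfl | rfl
  · rw [Complex.sinh, Complex.cosh]; push_cast; rw [one_mul]; ring_nf
  · rw [Complex.sinh, Complex.cosh]; push_cast; rw [neg_one_mul, neg_neg]; ring_nf

theorem norm_tanh_sub_le {v : ℂ} (hv : |v.im| < Real.pi / 2) {σ : ℝ} (hσ : σ = 1 ∨ σ = -1)
    (hσv : σ * v.re = |v.re|) :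
    ‖Complex.tanh v - σ‖ ≤ Real.exp (-|v.re|) / Real.cos v.im := by
  have hcos := Real.cos_pos_of_mem_Ioo (abs_lt.1 hv)
  have h1 : Real.cos v.im ≤ ‖Complex.cosh v‖ := by
    refine le_trans ?_ (Complex.re_le_norm _)
    rw [cosh_re]
    exact le_mul_of_one_le_left hcos.le (Real.one_le_cosh _)
  have h2 : ‖(-σ : ℂ)‖ = 1 := by rcases hσ with rfl | rfl <;> simp
  rw [tanh_sub_eq (cosh_ne_zero_of_abs_im_lt hv) hσ, norm_div, norm_mul, h2, one_mul,
    Complex.norm_exp, Complex.neg_re, Complex.re_ofReal_mul, hσv]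
  gcongr

/-- The asymptotic behaviour of `gInt` for `|Re z| → ∞`. -/
theorem exists_norm_gInt_add_le {ε R η : ℝ} (hε : 0 < ε) (hR : 0 < R) (hη : 0 < η) :
    ∃ C, ∀ w₁ w₂ z : ℂ, ε ≤ w₁.re → ε ≤ w₂.re → ‖w₁‖ ≤ R → ‖w₂‖ ≤ R →
      |z.im| ≤ (w₁.re + w₂.re) / 2 - η → ∀ σ : ℝ, (σ = 1 ∨ σ = -1) → σ * z.re = |z.re| →
        ‖gInt w₁ w₂ z + Real.pi * σ * z ^ 2 / (2 * w₁ * w₂)‖ ≤ C := by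
  obtain ⟨C, hC⟩ := exists_norm_remInt_le hε hR hη
  set c : ℝ := 2 * R with hcd
  have hc : 0 < c := by positivity
  have hπ := Real.pi_pos
  -- A positive lower bound for `cos v.im`, with `v = π z / c`: the distance of `|v.im|` from `π /
  -- 2` is at least the argument of this sine.
  set κ : ℝ := Real.sin (min (Real.pi * η / c) (Real.pi / 2)) with hκd
  have hm0 : 0 < min (Real.pi * η / c) (Real.pi / 2) := lt_min (by positivity) (by positivity)
  have hκ : 0 < κ := Real.sin_pos_of_pos_of_lt_pi hm0 (by
    linarith [min_le_right (Real.pi * η / c) (Real.pi / 2)])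
  set B : ℝ := 2 * (c / Real.pi) ^ 2 + R ^ 2 with hB
  refine ⟨1 / (ε * ε) * (Real.pi / 2 * B / κ) +
    (R ^ 2 + R ^ 2) / (12 * ε * ε) * (Real.pi / 2 * (1 + 1 / κ)) + C,
    fun w₁ w₂ z h₁ h₂ hw₁ hw₂ hz σ hσ hσz => ?_⟩
  have r1 := (Complex.re_le_norm w₁).trans hw₁
  have r2 := (Complex.re_le_norm w₂).trans hw₂
  have a1 := ne_zero_of_re_pos (hε.trans_le h₁)
  have a2 := ne_zero_of_re_pos (hε.trans_le h₂)
  have n1 := h₁.trans (Complex.re_le_norm w₁)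
  have n2 := h₂.trans (Complex.re_le_norm w₂)
  set v : ℂ := Real.pi * z / (c : ℝ) with hv
  have hvi : |v.im| ≤ Real.pi / 2 - min (Real.pi * η / c) (Real.pi / 2) := by
    have hle : |z.im| ≤ c / 2 - η := by rw [hcd]; linarith
    rw [hv, pi_mul_div_im, abs_div, abs_mul, abs_of_pos hc, abs_of_pos hπ]
    have : Real.pi * |z.im| / c ≤ Real.pi / 2 - Real.pi * η / c := by
      rw [div_le_iff₀ hc]
      field_simp
      nlinarith
    linarith [min_le_left (Real.pi * η / c) (Real.pi / 2)]
  have hvi' : |v.im| < Real.pi / 2 := by linarith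
  have hcos : κ ≤ Real.cos v.im := by
    rw [hκd, ← Real.cos_pi_div_two_sub, ← Real.cos_abs v.im]
    exact Real.cos_le_cos_of_nonneg_of_le_pi (abs_nonneg _) (by linarith) hvi
  have hvr : v.re = Real.pi * z.re / c := by
    rw [hv, Complex.div_ofReal_re, Complex.re_ofReal_mul]
  have hσv : σ * v.re = |v.re| := by
    rw [hvr, abs_div, abs_mul, abs_of_pos hπ, abs_of_pos hc, ← hσz]; ring
  have ht : ‖Complex.tanh v - σ‖ ≤ Real.exp (-|v.re|) / κ :=
    (norm_tanh_sub_le hvi' hσ hσv).trans (by gcongr)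
  have ht1 : ‖Complex.tanh v‖ ≤ 1 + 1 / κ := by
    have h2 : ‖(σ : ℂ)‖ = 1 := by rcases hσ with rfl | rfl <;> simp
    calc ‖Complex.tanh v‖ = ‖(σ : ℂ) + (Complex.tanh v - σ)‖ := by congr 1; ring
      _ ≤ 1 + Real.exp (-|v.re|) / κ := (norm_add_le _ _).trans (by rw [h2]; gcongr)
      _ ≤ 1 + 1 / κ := by
        gcongr
        exact Real.exp_le_one_iff.2 (by simp)
  have hz2 : ‖z‖ ^ 2 * Real.exp (-|v.re|) ≤ B := by
    have e1 : ‖z‖ ^ 2 = (c / Real.pi) ^ 2 * |v.re| ^ 2 + |z.im| ^ 2 := by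
      rw [← Complex.normSq_eq_norm_sq, Complex.normSq_apply, sq_abs, sq_abs, hvr]
      field_simp
    have e2 := Real.quadratic_le_exp_of_nonneg (abs_nonneg v.re)
    have e3 : |z.im| ≤ R := by linarith
    have e4 : |v.re| ^ 2 * Real.exp (-|v.re|) ≤ 2 := by
      rw [Real.exp_neg, ← div_eq_mul_inv, div_le_iff₀ (Real.exp_pos _)]
      nlinarith [abs_nonneg v.re]
    have e5 : Real.exp (-|v.re|) ≤ 1 := Real.exp_le_one_iff.2 (by simp)
    rw [e1, hB, add_mul, mul_assoc]
    have e6 : |z.im| ^ 2 * Real.exp (-|v.re|) ≤ R ^ 2 * 1 := by gcongr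
    nlinarith [mul_le_mul_of_nonneg_left e4 (sq_nonneg (c / Real.pi))]
  have hz' : |z.im| < (w₁.re + w₂.re) / 2 := by linarith
  -- Adding the leading term replaces `tanh v` by `tanh v - σ` next to `z ^ 2`, and the exponential
  -- decay of that difference absorbs the square.
  have key : gInt w₁ w₂ z + Real.pi * σ * z ^ 2 / (2 * w₁ * w₂) =
      1 / (w₁ * w₂) * (-(Real.pi / 2) * z ^ 2 * (Complex.tanh v - σ)) -
      (w₁ ^ 2 + w₂ ^ 2) / (12 * w₁ * w₂) * (Real.pi / 2 * Complex.tanh v) +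
      remInt c w₁ w₂ z := by
    rw [(gInt_eq hε hR h₁ h₂ hw₁ hw₂ hz').2, ← hcd, ← hv]
    field_simp
    ring
  have hp2 : ‖(Real.pi / 2 : ℂ)‖ = Real.pi / 2 := by
    rw [norm_div, Complex.norm_real, Real.norm_of_nonneg hπ.le]; simp
  rw [key]
  refine (norm_add_le _ _).trans (add_le_add ((norm_sub_le _ _).trans (add_le_add ?_ ?_))
    (hC w₁ w₂ z h₁ h₂ hw₁ hw₂ hz))
  · rw [norm_mul, norm_mul, norm_mul, norm_neg, norm_pow, hp2, norm_div, norm_mul, norm_one]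
    have : Real.pi / 2 * ‖z‖ ^ 2 * ‖Complex.tanh v - σ‖ ≤ Real.pi / 2 * B / κ := by
      calc _ ≤ Real.pi / 2 * ‖z‖ ^ 2 * (Real.exp (-|v.re|) / κ) := by gcongr
        _ = Real.pi / 2 * (‖z‖ ^ 2 * Real.exp (-|v.re|)) / κ := by ring
        _ ≤ _ := by gcongr
    gcongr
  · rw [norm_mul, norm_mul, hp2, norm_div, norm_mul, norm_mul]
    have : ‖w₁ ^ 2 + w₂ ^ 2‖ ≤ R ^ 2 + R ^ 2 := by
      refine (norm_add_le _ _).trans ?_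
      rw [norm_pow, norm_pow]
      gcongr
    have h12 : ‖(12 : ℂ)‖ = 12 := by simp
    rw [h12]
    gcongr

end Decomposition

/-! ### The difference equation on the strip. -/

section Difference

theorem integrableOn_gInt {w₁ w₂ z : ℂ} (h₁ : 0 < w₁.re) (h₂ : 0 < w₂.re)
    (hz : |z.im| < (w₁.re + w₂.re) / 2) :
    IntegrableOn (fun y : ℝ => (Complex.sin (2 * y * z) / (2 * Complex.sinh (w₁ * y) *
      Complex.sinh (w₂ * y)) - z / (w₁ * w₂ * y)) / y) (Ioi 0) := by
  obtain ⟨ε, R, hε, hR, hq⟩ := exists_mem_stripBox (q := (w₁, w₂, z)) ⟨h₁, h₂, by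
    rw [half_re]; exact hz⟩
  exact (gInt_eq hε hR hq.1.1.le hq.1.2.le hq.2.1.1.le hq.2.1.2.le hz).1

/-- The logarithm of `1 / (2 cosh (π z / w))` as an integral. -/
def logCoshInt (w z : ℂ) : ℂ :=
  ∫ y in Ioi (0 : ℝ), (Complex.cos (2 * y * z) / Complex.sinh (w * y) - 1 / (w * y)) / y

/-- The difference of the two sines is `2 i cos (2 y z) sinh (w₁ y)`, which cancels one `sinh` of
the denominator. The integrability of the new integrand, free of `w₁`, comes along. -/
theorem gInt_sub {w₁ w₂ z : ℂ} (h₁ : 0 < w₁.re) (h₂ : 0 < w₂.re) (hz : |z.im| < w₂.re / 2) :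
    IntegrableOn (fun y : ℝ =>
      (Complex.cos (2 * y * z) / Complex.sinh (w₂ * y) - 1 / (w₂ * y)) / y) (Ioi 0) ∧
    gInt w₁ w₂ (z + Complex.I * w₁ / 2) - gInt w₁ w₂ (z - Complex.I * w₁ / 2) =
      Complex.I * logCoshInt w₂ z := by
  have hi : (Complex.I * w₁ / 2).im = w₁.re / 2 := by
    rw [show Complex.I * w₁ / 2 = ((1 / 2 : ℝ) : ℂ) * (Complex.I * w₁) by push_cast; ring,
      Complex.im_ofReal_mul, Complex.I_mul_im]
    ring
  have hz' := abs_lt.1 hz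
  have i1 := integrableOn_gInt (z := z + Complex.I * w₁ / 2) h₁ h₂ (by
    rw [Complex.add_im, hi, abs_lt]; constructor <;> linarith)
  have i2 := integrableOn_gInt (z := z - Complex.I * w₁ / 2) h₁ h₂ (by
    rw [Complex.sub_im, hi, abs_lt]; constructor <;> linarith)
  have e : ∀ y ∈ Ioi (0 : ℝ),
      (Complex.sin (2 * y * (z + Complex.I * w₁ / 2)) / (2 * Complex.sinh (w₁ * y) *
        Complex.sinh (w₂ * y)) - (z + Complex.I * w₁ / 2) / (w₁ * w₂ * y)) / y -
      (Complex.sin (2 * y * (z - Complex.I * w₁ / 2)) / (2 * Complex.sinh (w₁ * y) *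
        Complex.sinh (w₂ * y)) - (z - Complex.I * w₁ / 2) / (w₁ * w₂ * y)) / y =
      Complex.I * ((Complex.cos (2 * y * z) / Complex.sinh (w₂ * y) - 1 / (w₂ * y)) / y) := by
    intro y hy
    have hy0 : (y : ℂ) ≠ 0 := by exact_mod_cast (show (0 : ℝ) < y from hy).ne'
    have a1 := sinh_mul_ofReal_ne_zero h₁ hy
    have a2 := sinh_mul_ofReal_ne_zero h₂ hy
    have a3 := ne_zero_of_re_pos h₁
    have a4 := ne_zero_of_re_pos h₂
    rw [show 2 * (y : ℂ) * (z + Complex.I * w₁ / 2) = 2 * y * z + w₁ * y * Complex.I by ring,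
      show 2 * (y : ℂ) * (z - Complex.I * w₁ / 2) = 2 * y * z - w₁ * y * Complex.I by ring,
      Complex.sin_add, Complex.sin_sub, Complex.sin_mul_I, Complex.cos_mul_I]
    generalize Complex.sinh (w₁ * y) = S₁ at *
    generalize Complex.sinh (w₂ * y) = S₂ at *
    field_simp
    ring
  have i3 : IntegrableOn (fun y : ℝ => Complex.I *
      ((Complex.cos (2 * y * z) / Complex.sinh (w₂ * y) - 1 / (w₂ * y)) / y)) (Ioi 0) :=
    IntegrableOn.congr_fun (Integrable.sub i1 i2 : IntegrableOn _ _ _) e measurableSet_Ioi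
  refine ⟨?_, ?_⟩
  · have := Integrable.const_mul i3 (-Complex.I)
    refine IntegrableOn.congr_fun (this : IntegrableOn _ _ _) (fun y _ => ?_) measurableSet_Ioi
    show -Complex.I * (Complex.I * _) = _
    rw [← mul_assoc, neg_mul, Complex.I_mul_I, neg_neg, one_mul]
  · rw [gInt, gInt, ← integral_sub i1 i2, setIntegral_congr_fun measurableSet_Ioi e,
      integral_const_mul, logCoshInt]

theorem integrableOn_logCoshInt {w z : ℂ} (hw : 0 < w.re) (hz : |z.im| < w.re / 2) :
    IntegrableOn (fun y : ℝ =>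
      (Complex.cos (2 * y * z) / Complex.sinh (w * y) - 1 / (w * y)) / y) (Ioi 0) :=
  (gInt_sub (w₁ := 1) (by simp) hw hz).1

theorem hasDerivAt_logCoshInt_one {z : ℂ} (hz : |z.im| < 1 / 2) :
    HasDerivAt (logCoshInt 1) (-(Real.pi * Complex.tanh (Real.pi * z))) z := by
  have h1 : (1 : ℂ).re / 2 = 1 / 2 := by simp
  set δ : ℝ := (1 / 2 + |z.im|) / 2 with hδ
  have hδ1 : δ < 1 / 2 := by rw [hδ]; linarith
  have hδ2 : |z.im| < δ := by rw [hδ]; linarith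
  set s : Set ℂ := {x | |x.im| < δ ∧ ‖x‖ < ‖z‖ + 1} with hs
  have hso : IsOpen s := by
    have a : IsOpen {x : ℂ | |x.im| < δ} := isOpen_lt (by fun_prop) (by fun_prop)
    have b : IsOpen {x : ℂ | ‖x‖ < ‖z‖ + 1} := isOpen_lt (by fun_prop) (by fun_prop)
    exact a.inter b
  have hzs : z ∈ s := ⟨hδ2, by linarith⟩
  have := hasDerivAt_integral_of_dominated_loc_of_deriv_le (μ := volume.restrict (Ioi (0 : ℝ)))
    (F := fun (x : ℂ) (y : ℝ) =>
      (Complex.cos (2 * y * x) / Complex.sinh (1 * y) - 1 / (1 * y)) / y)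
    (F' := fun (x : ℂ) (y : ℝ) => -2 * (Complex.sin (2 * y * x) / Complex.sinh y))
    (bound := fun y => 2 * (2 * (‖z‖ + 1) * ((1 + 2 * y) * Real.exp (-((1 - 2 * δ) * y)))))
    (x₀ := z) (hso.mem_nhds hzs) ?_ ?_ ?_ ?_ ?_ ?_
  · have h := this.2
    rw [integral_const_mul, integral_sin_div_sinh hz] at h
    exact h.congr_deriv (by ring)
  · filter_upwards [hso.mem_nhds hzs] with x hx
    exact (integrableOn_logCoshInt (by simp) (by rw [h1]; exact hx.1.trans hδ1)).aestronglyMeasurable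
  · exact integrableOn_logCoshInt (by simp) (by rw [h1]; exact hz)
  · exact ((integrableOn_sin_div_sinh hz).aestronglyMeasurable).const_mul _
  · filter_upwards [ae_restrict_mem measurableSet_Ioi] with y hy x hx
    have hy0 : (0 : ℝ) < y := hy
    rw [norm_mul, norm_neg, Complex.norm_two]
    refine mul_le_mul_of_nonneg_left ((norm_sin_div_sinh_le x hy).trans ?_) zero_le_two
    gcongr
    · exact hx.2.le
    · exact hx.1.le
  · exact (((integrableOn_one_add_mul_exp (by linarith)).const_mul _).const_mul _)
  · filter_upwards [ae_restrict_mem measurableSet_Ioi] with y hy x hx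
    have hy0 : (y : ℂ) ≠ 0 := by exact_mod_cast (show (0 : ℝ) < y from hy).ne'
    have a1 : HasDerivAt (fun x : ℂ => 2 * (y : ℂ) * x) (2 * y) x := by
      simpa using (hasDerivAt_id x).const_mul (2 * (y : ℂ))
    have a2 := ((a1.ccos.div_const (Complex.sinh (1 * y))).sub_const (1 / (1 * (y : ℂ)))).div_const
      (y : ℂ)
    refine a2.congr_deriv ?_
    rw [one_mul]
    field_simp

/-- The substitution `y ↦ 2 y` together with `sinh (2 y) = 2 sinh y cosh y`. This relation serves to
fix the constant in `exp_neg_logCoshInt_one`. -/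
theorem logCoshInt_one_quarter :
    2 * logCoshInt 1 (Complex.I / 4) = logCoshInt 1 0 := by
  have him : (Complex.I / 4).im = 1 / 4 := by
    rw [show Complex.I / 4 = ((1 / 4 : ℝ) : ℂ) * Complex.I by push_cast; ring]; simp
  have key := integral_comp_mul_left_Ioi (fun y : ℝ =>
    (Complex.cos (2 * y * (Complex.I / 4)) / Complex.sinh (1 * y) - 1 / (1 * y)) / (y : ℂ)) 0
    (b := 2) two_pos
  rw [mul_zero] at key
  have h0 : logCoshInt 1 0 = ∫ y in Ioi (0 : ℝ),
      (1 / Complex.sinh y - 1 / y) / (y : ℂ) := by simp [logCoshInt]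
  have e : ∀ y ∈ Ioi (0 : ℝ), (Complex.cos (2 * (2 * y : ℝ) * (Complex.I / 4)) /
      Complex.sinh (1 * (2 * y : ℝ)) - 1 / (1 * (2 * y : ℝ))) / ((2 * y : ℝ) : ℂ) =
      (1 / 4) * ((1 / Complex.sinh y - 1 / y) / (y : ℂ)) := by
    intro y hy
    have hy0 : (y : ℂ) ≠ 0 := by exact_mod_cast (show (0 : ℝ) < y from hy).ne'
    have a1 : Complex.sinh (y : ℂ) ≠ 0 := sinh_ne_zero_of_re_pos (by simpa using hy)
    have a2 : Complex.cosh (y : ℂ) ≠ 0 := cosh_ne_zero_of_abs_im_lt (by simp [Real.pi_pos])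
    push_cast
    rw [show 2 * (2 * (y : ℂ)) * (Complex.I / 4) = y * Complex.I by ring, Complex.cos_mul_I,
      one_mul, Complex.sinh_two_mul]
    field_simp
    ring
  rw [setIntegral_congr_fun measurableSet_Ioi e, integral_const_mul, ← h0] at key
  rw [logCoshInt]
  have : (2 : ℝ)⁻¹ • logCoshInt 1 (Complex.I / 4) = 1 / 4 * logCoshInt 1 0 := key.symm
  rw [Complex.real_smul] at this
  push_cast at this
  change 2 * logCoshInt 1 (Complex.I / 4) = _
  linear_combination 4 * this

/-- The logarithmic derivatives agree, so the quotient `k` by `cosh (π z)` is constant on the strip.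
By `logCoshInt_one_quarter` and `cosh (π i / 4) ^ 2 = 1 / 2`, the constant satisfies `k ^ 2 = 2 k`,
and it is not zero. -/
theorem exp_neg_logCoshInt_one {z : ℂ} (hz : |z.im| < 1 / 2) :
    Complex.exp (-logCoshInt 1 z) = 2 * Complex.cosh (Real.pi * z) := by
  have hcosh : ∀ x : ℂ, |x.im| < 1 / 2 → Complex.cosh (Real.pi * x) ≠ 0 := by
    intro x hx
    refine cosh_ne_zero_of_abs_im_lt ?_
    rw [Complex.im_ofReal_mul, abs_mul, abs_of_pos Real.pi_pos]
    nlinarith [Real.pi_pos]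
  set k : ℂ → ℂ := fun x => Complex.exp (-logCoshInt 1 x) / Complex.cosh (Real.pi * x) with hk
  have hd : ∀ x : ℂ, |x.im| < 1 / 2 → HasDerivAt k 0 x := by
    intro x hx
    have a1 : HasDerivAt (fun x : ℂ => (Real.pi : ℂ) * x) Real.pi x := by
      simpa using (hasDerivAt_id x).const_mul (Real.pi : ℂ)
    have a2 := ((hasDerivAt_logCoshInt_one hx).neg.cexp).div a1.ccosh (hcosh x hx)
    refine a2.congr_deriv ?_
    rw [Complex.tanh_eq_sinh_div_cosh]
    have := hcosh x hx
    field_simp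
    simp
  set s : Set ℂ := {x | |x.im| < 1 / 2} with hs
  have hso : IsOpen s := isOpen_lt (by fun_prop) (by fun_prop)
  have hsc : Convex ℝ s := by
    have : s = Complex.imLm ⁻¹' (Ioo (-(1 / 2)) (1 / 2)) := by
      ext x; simp [hs, abs_lt]
    rw [this]
    exact (convex_Ioo _ _).linear_preimage _
  have hconst : ∀ x ∈ s, ∀ y ∈ s, k x = k y := fun x hx y hy =>
    hso.is_const_of_deriv_eq_zero hsc.isPreconnected
      (fun u hu => (hd u hu).differentiableAt.differentiableWithinAt)
      (fun u hu => (hd u hu).deriv) hx hy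
  have him : (Complex.I / 4).im = 1 / 4 := by
    rw [show Complex.I / 4 = ((1 / 4 : ℝ) : ℂ) * Complex.I by push_cast; ring]; simp
  have h0 : (0 : ℂ) ∈ s := by simp [hs]
  have h4 : Complex.I / 4 ∈ s := by
    show |(Complex.I / 4).im| < 1 / 2
    rw [him]; norm_num [abs_of_pos]
  have hc4 : Complex.cosh (Real.pi * (Complex.I / 4)) ^ 2 = 1 / 2 := by
    rw [show (Real.pi : ℂ) * (Complex.I / 4) = ((Real.pi / 4 : ℝ) : ℂ) * Complex.I by
      push_cast; ring, Complex.cosh_mul_I, ← Complex.ofReal_cos, Real.cos_pi_div_four,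
      ← Complex.ofReal_pow, div_pow, Real.sq_sqrt (by norm_num)]
    norm_num
  have e0 : k 0 = Complex.exp (-logCoshInt 1 0) := by simp [hk]
  have e4 : k (Complex.I / 4) ^ 2 = 2 * Complex.exp (-logCoshInt 1 0) := by
    simp only [hk]
    rw [div_pow, hc4, ← Complex.exp_nat_mul, ← logCoshInt_one_quarter]
    push_cast
    rw [mul_neg, div_eq_iff (by norm_num)]
    ring
  have hk0 : k 0 = 2 := by
    have h1 := hconst _ h4 0 h0
    rw [h1, ← e0] at e4
    have : k 0 ≠ 0 := by rw [e0]; exact Complex.exp_ne_zero _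
    exact mul_right_cancel₀ this (by rw [← e4]; ring)
  have := hconst z hz 0 h0
  rw [hk0] at this
  exact (div_eq_iff (hcosh z hz)).1 this

theorem logCoshInt_ofReal {w : ℝ} (hw : 0 < w) (z : ℂ) :
    logCoshInt w z = logCoshInt 1 (z / w) := by
  have hw0 : (w : ℂ) ≠ 0 := by exact_mod_cast hw.ne'
  have key := integral_comp_mul_left_Ioi (fun y : ℝ =>
    (Complex.cos (2 * y * (z / w)) / Complex.sinh (1 * y) - 1 / (1 * y)) / (y : ℂ)) 0 hw
  rw [mul_zero] at key
  have e : ∀ y ∈ Ioi (0 : ℝ), (Complex.cos (2 * (w * y : ℝ) * (z / w)) /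
      Complex.sinh (1 * (w * y : ℝ)) - 1 / (1 * (w * y : ℝ))) / ((w * y : ℝ) : ℂ) =
      (1 / w) * ((Complex.cos (2 * y * z) / Complex.sinh (w * y) - 1 / (w * y)) / (y : ℂ)) := by
    intro y hy
    have hy0 : (y : ℂ) ≠ 0 := by exact_mod_cast (show (0 : ℝ) < y from hy).ne'
    push_cast
    rw [show 2 * ((w : ℂ) * y) * (z / w) = 2 * y * z by field_simp, one_mul]
    field_simp
  rw [setIntegral_congr_fun measurableSet_Ioi e, integral_const_mul] at key
  have : (1 / w : ℂ) * logCoshInt w z = w⁻¹ • logCoshInt 1 (z / w) := key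
  rw [Complex.real_smul, Complex.ofReal_inv] at this
  field_simp at this
  exact this

/-- The domain `|Im z| < Re w / 2` is convex. -/
theorem convex_halfStrip : Convex ℝ {q : ℂ × ℂ | |q.2.im| < q.1.re / 2} := by
  intro x hx y hy a b ha hb hab
  simp only [mem_ofPred_eq, abs_lt] at hx hy ⊢
  simp only [Prod.fst_add, Prod.smul_fst, Prod.snd_add, Prod.smul_snd, Complex.add_re,
    Complex.add_im, Complex.real_smul, Complex.re_ofReal_mul, Complex.im_ofReal_mul]
  rcases eq_or_lt_of_le ha with rfl | ha'
  · obtain rfl : b = 1 := by linarith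
    simpa using hy
  constructor <;> nlinarith [mul_lt_mul_of_pos_left hx.1 ha', mul_lt_mul_of_pos_left hx.2 ha',
    mul_le_mul_of_nonneg_left hy.1.le hb, mul_le_mul_of_nonneg_left hy.2.le hb]

theorem isOpen_halfStrip : IsOpen {q : ℂ × ℂ | |q.2.im| < q.1.re / 2} :=
  isOpen_lt (by fun_prop) (by fun_prop)

/-- Scaling gives the case of real `w`; complex `w` follows from the identity theorem in `(w, z)`.
Holomorphy is borrowed from `gInt` by applying `gInt_sub` with first period `1`. -/
theorem exp_neg_logCoshInt {w z : ℂ} (hz : |z.im| < w.re / 2) :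
    Complex.exp (-logCoshInt w z) = 2 * Complex.cosh (Real.pi * z / w) := by
  have hpos : ∀ q : ℂ × ℂ, |q.2.im| < q.1.re / 2 → 0 < q.1.re := fun q hq => by
    have := abs_nonneg q.2.im; linarith
  have hd : DifferentiableOn ℂ (fun q : ℂ × ℂ => Complex.exp (-logCoshInt q.1 q.2) -
      2 * Complex.cosh (Real.pi * q.2 / q.1)) {q : ℂ × ℂ | |q.2.im| < q.1.re / 2} := by
    have e : ∀ q ∈ {q : ℂ × ℂ | |q.2.im| < q.1.re / 2}, logCoshInt q.1 q.2 =
        -Complex.I * (gInt 1 q.1 (q.2 + Complex.I / 2) - gInt 1 q.1 (q.2 - Complex.I / 2)) := by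
      intro q hq
      have := (gInt_sub (w₁ := 1) (by simp) (hpos q hq) hq).2
      rw [mul_one] at this
      rw [this, ← mul_assoc, neg_mul, Complex.I_mul_I, neg_neg, one_mul]
    intro q hq
    have hI : (Complex.I / 2).im = 1 / 2 := by
      rw [show Complex.I / 2 = ((1 / 2 : ℝ) : ℂ) * Complex.I by push_cast; ring]; simp
    have hq' := abs_lt.1 (show |q.2.im| < q.1.re / 2 from hq)
    have hm : ∀ T : ℂ × ℂ → ℂ × ℂ × ℂ, DifferentiableAt ℂ T q → T q ∈ stripDomain →
        DifferentiableAt ℂ (fun q => gInt (T q).1 (T q).2.1 (T q).2.2) q := fun T hT hTq =>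
      (differentiableOn_gInt.differentiableAt (isOpen_stripDomain.mem_nhds hTq)).comp
        (f := T) q hT
    have d1 := hm (fun q => (1, q.1, q.2 + Complex.I / 2)) (by fun_prop) ⟨by simp, hpos q hq, by
      rw [half_re, Complex.add_im, hI, Complex.one_re, abs_lt]; constructor <;> linarith⟩
    have d2 := hm (fun q => (1, q.1, q.2 - Complex.I / 2)) (by fun_prop) ⟨by simp, hpos q hq, by
      rw [half_re, Complex.sub_im, hI, Complex.one_re, abs_lt]; constructor <;> linarith⟩
    have d3 : DifferentiableAt ℂ (fun q : ℂ × ℂ => logCoshInt q.1 q.2) q := by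
      refine ((d1.sub d2).const_mul (-Complex.I)).congr_of_eventuallyEq ?_
      filter_upwards [isOpen_halfStrip.mem_nhds hq] with p hp using e p hp
    have d4 : DifferentiableAt ℂ (fun q : ℂ × ℂ => (Real.pi : ℂ) * q.2 / q.1) q :=
      differentiableAt_fun_div (by fun_prop) (by fun_prop) (ne_zero_of_re_pos (hpos q hq))
    exact (d3.fun_neg.cexp.fun_sub (d4.ccosh.const_mul 2)).differentiableWithinAt
  have h0 := eq_zero_of_eq_zero_on_real isOpen_halfStrip convex_halfStrip hd (p := (1, 0))
    (by simp) (by simp [Prod.ext_iff]) ?_ (w, z) hz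
  · exact sub_eq_zero.1 h0
  · filter_upwards [isOpen_halfStrip.mem_nhds (show ((1 : ℂ), (0 : ℂ)) ∈ _ by simp)] with q hq hqs
    obtain ⟨r, hr⟩ := Complex.conj_eq_iff_real.1 (congrArg Prod.fst hqs : star q.1 = q.1)
    have hqq : |q.2.im| < q.1.re / 2 := hq
    have hrp := hpos q hq
    rw [hr, Complex.ofReal_re] at hrp hqq
    rw [hr, logCoshInt_ofReal hrp, exp_neg_logCoshInt_one (abs_div_im_lt hrp hqq), mul_div_assoc,
      sub_self]

theorem GStrip_add {w₁ w₂ z : ℂ} (h₁ : 0 < w₁.re) (h₂ : 0 < w₂.re) (hz : |z.im| < w₂.re / 2) :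
    GStrip w₁ w₂ (z + Complex.I * w₁ / 2) =
      2 * Complex.cosh (Real.pi * z / w₂) * GStrip w₁ w₂ (z - Complex.I * w₁ / 2) := by
  rw [← exp_neg_logCoshInt hz, GStrip, GStrip, ← Complex.exp_add]
  congr 1
  have := (gInt_sub h₁ h₂ hz).2
  linear_combination Complex.I * this + logCoshInt w₂ z * Complex.I_mul_I

theorem gInt_neg (w₁ w₂ z : ℂ) : gInt w₁ w₂ (-z) = -gInt w₁ w₂ z := by
  rw [gInt, gInt, ← integral_neg]
  congr 1
  ext y
  rw [mul_neg, Complex.sin_neg]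
  ring

end Difference

/-! ### Continuation, reflection and difference equation of `G`. -/

section Structure

theorem GStrip_neg (w₁ w₂ z : ℂ) : GStrip w₁ w₂ (-z) = (GStrip w₁ w₂ z)⁻¹ := by
  rw [GStrip, GStrip, gInt_neg, mul_neg, Complex.exp_neg]

/-- The continuation of the hyperbolic gamma function by `n` steps upwards. -/
def GUp (n : ℕ) (w₁ w₂ z : ℂ) : ℂ :=
  (∏ k ∈ Finset.range n, 2 * Complex.cosh (Real.pi * (z - Complex.I * w₁ * (k + 1 / 2)) / w₂)) *
    GStrip w₁ w₂ (z - Complex.I * n * w₁)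

theorem im_I_mul_natCast_mul (n : ℕ) (w : ℂ) : (Complex.I * n * w).im = n * w.re := by
  rw [show Complex.I * n * w = ((n : ℝ) : ℂ) * (Complex.I * w) by push_cast; ring,
    Complex.im_ofReal_mul, Complex.I_mul_im]

theorem im_I_mul_add_half (n : ℕ) (w : ℂ) :
    (Complex.I * w * (n + 1 / 2)).im = (n + 1 / 2) * w.re := by
  rw [show Complex.I * w * (n + 1 / 2) = ((n + 1 / 2 : ℝ) : ℂ) * (Complex.I * w) by
    push_cast; ring, Complex.im_ofReal_mul, Complex.I_mul_im]

/-- If `n` and `n + 1` steps both reach the strip, the midpoint of the two arguments is within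
`w₂.re / 2` of the real line, which is where the difference equation on the strip applies. -/
theorem GUp_succ {w₁ w₂ z : ℂ} (h₁ : 0 < w₁.re) (h₂ : 0 < w₂.re) {n : ℕ}
    (hn : |z.im - n * w₁.re| < (w₁.re + w₂.re) / 2)
    (hn' : |z.im - (n + 1 : ℕ) * w₁.re| < (w₁.re + w₂.re) / 2) :
    GUp (n + 1) w₁ w₂ z = GUp n w₁ w₂ z := by
  rw [abs_lt] at hn hn'
  push_cast at hn'
  have h := GStrip_add (z := z - Complex.I * w₁ * (n + 1 / 2)) h₁ h₂ (by
    rw [Complex.sub_im, im_I_mul_add_half, abs_lt]; constructor <;> linarith)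
  rw [GUp, GUp, Finset.prod_range_succ, mul_assoc]
  congr 1
  push_cast
  rw [show z - Complex.I * n * w₁ = z - Complex.I * w₁ * (n + 1 / 2) + Complex.I * w₁ / 2 by ring,
    h]
  congr 2
  ring

theorem GUp_eq_of_le {w₁ w₂ z : ℂ} (h₁ : 0 < w₁.re) (h₂ : 0 < w₂.re) {m n : ℕ} (hmn : m ≤ n)
    (hm : |z.im - m * w₁.re| < (w₁.re + w₂.re) / 2)
    (hn : |z.im - n * w₁.re| < (w₁.re + w₂.re) / 2) :
    GUp n w₁ w₂ z = GUp m w₁ w₂ z := by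
  induction n, hmn using Nat.le_induction with
  | base => rfl
  | succ n hmn ih =>
    have hn' : |z.im - n * w₁.re| < (w₁.re + w₂.re) / 2 := by
      rw [abs_lt] at hm hn ⊢
      push_cast at hn
      have : (m : ℝ) * w₁.re ≤ n * w₁.re := by gcongr
      constructor <;> linarith
    rw [GUp_succ h₁ h₂ hn' hn, ih hn']

theorem GUp_eq {w₁ w₂ z : ℂ} (h₁ : 0 < w₁.re) (h₂ : 0 < w₂.re) {m n : ℕ}
    (hm : |z.im - m * w₁.re| < (w₁.re + w₂.re) / 2)
    (hn : |z.im - n * w₁.re| < (w₁.re + w₂.re) / 2) :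
    GUp n w₁ w₂ z = GUp m w₁ w₂ z := by
  rcases le_total m n with h | h
  · exact GUp_eq_of_le h₁ h₂ h hm hn
  · exact (GUp_eq_of_le h₁ h₂ h hn hm).symm

theorem GUp_zero (w₁ w₂ z : ℂ) : GUp 0 w₁ w₂ z = GStrip w₁ w₂ z := by simp [GUp]

theorem G_of_strip {w₁ w₂ z : ℂ} (hz : |z.im| < (w₁.re + w₂.re) / 2) :
    G w₁ w₂ z = GStrip w₁ w₂ z := by
  rw [G, if_pos (by rw [half_re]; exact hz)]

theorem abs_sub_round_mul_le {w : ℂ} (hw : 0 < w.re) (t : ℝ) :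
    |t - round (t / w.re) * w.re| ≤ w.re / 2 := by
  have h := abs_sub_round (t / w.re)
  have e : t - round (t / w.re) * w.re = (t / w.re - round (t / w.re)) * w.re := by
    field_simp
  rw [e, abs_mul, abs_of_pos hw]
  nlinarith

/-- This frees `G` from the rounding in its definition: any admissible number of steps may be used,
and one number serves for a whole neighbourhood. -/
theorem G_eq_GUp {w₁ w₂ z : ℂ} (h₁ : 0 < w₁.re) (h₂ : 0 < w₂.re) {n : ℕ}
    (hn : |z.im - n * w₁.re| < (w₁.re + w₂.re) / 2) : G w₁ w₂ z = GUp n w₁ w₂ z := by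
  by_cases hz : |z.im| < (w₁.re + w₂.re) / 2
  · rw [G_of_strip hz, ← GUp_zero, GUp_eq h₁ h₂ hn (by simpa using hz)]
  · rw [G, if_neg (by rw [half_re]; exact hz)]
    have hr := abs_sub_round_mul_le h₁ z.im
    set m := round (z.im / w₁.re) with hm
    have hm0 : 0 ≤ m := by
      by_contra hneg
      have h1 : (m : ℝ) ≤ -1 := by exact_mod_cast (by lia : m ≤ -1)
      rw [not_lt, le_abs] at hz
      rw [abs_le] at hr
      rw [abs_lt] at hn
      have h3 : (0 : ℝ) ≤ n * w₁.re := by positivity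
      rcases hz with hz | hz <;> nlinarith
    obtain ⟨k, hk⟩ := Int.eq_ofNat_of_zero_le hm0
    simp only
    rw [if_pos hm0, GUp_eq h₁ h₂ (n := n) (m := k) ?_ hn, hk, GUp]
    · simp
    · have : ((m : ℤ) : ℝ) = k := by rw [hk]; simp
      rw [this] at hr
      linarith

theorem G_eq_GUp_neg {w₁ w₂ z : ℂ} (h₁ : 0 < w₁.re) (h₂ : 0 < w₂.re) {n : ℕ}
    (hn : |z.im + n * w₁.re| < (w₁.re + w₂.re) / 2) : G w₁ w₂ z = (GUp n w₁ w₂ (-z))⁻¹ := by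
  have hn' : |(-z).im - n * w₁.re| < (w₁.re + w₂.re) / 2 := by
    rw [Complex.neg_im, ← abs_neg]; convert hn using 2; ring
  by_cases hz : |z.im| < (w₁.re + w₂.re) / 2
  · rw [G_of_strip hz, GUp_eq h₁ h₂ (m := 0) (by simpa using hz) hn', GUp_zero, GStrip_neg, inv_inv]
  · rw [G, if_neg (by rw [half_re]; exact hz)]
    have hr := abs_sub_round_mul_le h₁ z.im
    set m := round (z.im / w₁.re) with hm
    have hm0 : m < 0 := by
      by_contra hneg
      have h1 : (0 : ℝ) ≤ m := by exact_mod_cast (not_lt.1 hneg)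
      rw [not_lt, le_abs] at hz
      rw [abs_le] at hr
      rw [abs_lt] at hn
      have h3 : (0 : ℝ) ≤ n * w₁.re := by positivity
      rcases hz with hz | hz <;> nlinarith
    obtain ⟨k, hk⟩ := Int.eq_ofNat_of_zero_le (neg_nonneg.2 hm0.le)
    have hmk : m = -(k : ℤ) := by lia
    simp only
    rw [if_neg (not_le.2 hm0), GUp_eq h₁ h₂ (n := n) (m := k) ?_ hn', hmk, GUp, mul_inv, div_eq_mul_inv,
      mul_comm]
    · congr 1
      · simp only [neg_neg, Int.toNat_natCast]
        congr 1
        refine Finset.prod_congr rfl fun i _ => ?_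
        rw [← Complex.cosh_neg]
        congr 2
        ring
      · rw [← GStrip_neg]
        congr 1
        push_cast
        ring
    · have : ((m : ℤ) : ℝ) = -k := by rw [hmk]; simp
      rw [this, ← abs_neg] at hr
      rw [Complex.neg_im]
      have e : -z.im - k * w₁.re = -(z.im - -(k : ℝ) * w₁.re) := by ring
      rw [e]
      linarith

theorem exists_natCast_abs_sub_lt {w₁ w₂ z : ℂ} (h₁ : 0 < w₁.re) (h₂ : 0 < w₂.re)
    (hz : -((w₁.re + w₂.re) / 2) < z.im) :
    ∃ n : ℕ, |z.im - n * w₁.re| < (w₁.re + w₂.re) / 2 := by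
  by_cases h : |z.im| < (w₁.re + w₂.re) / 2
  · exact ⟨0, by simpa using h⟩
  · have hr := abs_sub_round_mul_le h₁ z.im
    set m := round (z.im / w₁.re) with hm
    have hm0 : 0 ≤ m := by
      by_contra hneg
      have h1 : (m : ℝ) ≤ -1 := by exact_mod_cast (by lia : m ≤ -1)
      rw [not_lt, le_abs] at h
      rw [abs_le] at hr
      rcases h with h | h <;> nlinarith
    obtain ⟨k, hk⟩ := Int.eq_ofNat_of_zero_le hm0
    have : ((m : ℤ) : ℝ) = k := by rw [hk]; simp
    rw [this] at hr
    exact ⟨k, by linarith⟩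

/-- Inherited from the oddness of `gInt`, since steps down are inverses of steps up at `-z`. It
holds for every `z`: the value `0` at the poles agrees with `0⁻¹ = 0`. -/
theorem G_neg {w₁ w₂ : ℂ} (h₁ : 0 < w₁.re) (h₂ : 0 < w₂.re) (z : ℂ) :
    G w₁ w₂ (-z) = (G w₁ w₂ z)⁻¹ := by
  rcases le_total 0 z.im with h | h
  · obtain ⟨n, hn⟩ := exists_natCast_abs_sub_lt h₁ h₂ (z := z) (by linarith)
    rw [G_eq_GUp h₁ h₂ hn, G_eq_GUp_neg h₁ h₂ (n := n), neg_neg]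
    rw [Complex.neg_im, ← abs_neg]; convert hn using 2; ring
  · obtain ⟨n, hn⟩ := exists_natCast_abs_sub_lt h₁ h₂ (z := -z) (by
      rw [Complex.neg_im]; linarith)
    rw [G_eq_GUp h₁ h₂ hn, G_eq_GUp_neg h₁ h₂ (n := n), inv_inv]
    rw [Complex.neg_im, ← abs_neg] at hn; convert hn using 2; ring

/-- The difference equation, above the poles. -/
theorem G_add {w₁ w₂ z : ℂ} (h₁ : 0 < w₁.re) (h₂ : 0 < w₂.re) (hz : -(w₂.re / 2) < z.im) :
    G w₁ w₂ (z + Complex.I * w₁ / 2) =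
      2 * Complex.cosh (Real.pi * z / w₂) * G w₁ w₂ (z - Complex.I * w₁ / 2) := by
  have hi : (Complex.I * w₁ / 2).im = w₁.re / 2 := by
    have := im_I_mul_add_half 0 w₁
    rw [show Complex.I * w₁ / 2 = Complex.I * w₁ * ((0 : ℕ) + 1 / 2) by push_cast; ring, this]
    push_cast; ring
  obtain ⟨n, hn⟩ := exists_natCast_abs_sub_lt h₁ h₂ (z := z - Complex.I * w₁ / 2) (by
    rw [Complex.sub_im, hi]; linarith)
  have hn' : |(z + Complex.I * w₁ / 2).im - (n + 1 : ℕ) * w₁.re| < (w₁.re + w₂.re) / 2 := by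
    rw [Complex.sub_im, hi] at hn
    rw [Complex.add_im, hi]
    convert hn using 2
    push_cast; ring
  -- The upper argument needs one step more; its factor with index `0` is the `cosh` of the equation
  -- and the others shift by one index.
  rw [G_eq_GUp h₁ h₂ hn, G_eq_GUp h₁ h₂ hn', GUp, GUp, Finset.prod_range_succ',
    mul_comm (∏ k ∈ Finset.range n, _) (2 * Complex.cosh _), mul_assoc (2 * Complex.cosh _)]
  congr 1
  · congr 3
    push_cast; ring
  · congr 1
    · refine Finset.prod_congr rfl fun k _ => ?_
      congr 3
      push_cast; ring
    · congr 1
      push_cast; ring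

/-- The difference equation, below the zeros. -/
theorem G_sub {w₁ w₂ z : ℂ} (h₁ : 0 < w₁.re) (h₂ : 0 < w₂.re) (hz : z.im < w₂.re / 2) :
    G w₁ w₂ (z - Complex.I * w₁ / 2) =
      G w₁ w₂ (z + Complex.I * w₁ / 2) / (2 * Complex.cosh (Real.pi * z / w₂)) := by
  have h := G_add (z := -z) h₁ h₂ (by rw [Complex.neg_im]; linarith)
  rw [show -z + Complex.I * w₁ / 2 = -(z - Complex.I * w₁ / 2) by ring,
    show -z - Complex.I * w₁ / 2 = -(z + Complex.I * w₁ / 2) by ring, G_neg h₁ h₂, G_neg h₁ h₂,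
    mul_neg, neg_div, Complex.cosh_neg] at h
  rw [← inv_inv (G w₁ w₂ (z - Complex.I * w₁ / 2)), h, mul_inv, inv_inv, mul_comm]
  rfl

/-- The domain above the poles of `G`. -/
def upperDomain : Set (ℂ × ℂ × ℂ) :=
  {q | 0 < q.1.re ∧ 0 < q.2.1.re ∧ -((q.1.re + q.2.1.re) / 2) < q.2.2.im}

theorem isOpen_upperDomain : IsOpen upperDomain := by
  have h1 : IsOpen {q : ℂ × ℂ × ℂ | 0 < q.1.re} := isOpen_lt (by fun_prop) (by fun_prop)
  have h2 : IsOpen {q : ℂ × ℂ × ℂ | 0 < q.2.1.re} := isOpen_lt (by fun_prop) (by fun_prop)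
  have h3 : IsOpen {q : ℂ × ℂ × ℂ | -((q.1.re + q.2.1.re) / 2) < q.2.2.im} :=
    isOpen_lt (by fun_prop) (by fun_prop)
  exact h1.inter (h2.inter h3)

theorem convex_upperDomain : Convex ℝ upperDomain := by
  have h1 : Convex ℝ {q : ℂ × ℂ × ℂ | 0 < q.1.re} :=
    convex_halfSpace_gt ⟨by intros; simp, by intros; simp⟩ 0
  have h2 : Convex ℝ {q : ℂ × ℂ × ℂ | 0 < q.2.1.re} :=
    convex_halfSpace_gt ⟨by intros; simp, by intros; simp⟩ 0
  have h3 : Convex ℝ {q : ℂ × ℂ × ℂ | 0 < (q.1.re + q.2.1.re) / 2 + q.2.2.im} :=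
    convex_halfSpace_gt ⟨by intros; simp; ring, by intros; simp; ring⟩ 0
  have e : upperDomain = {q : ℂ × ℂ × ℂ | 0 < q.1.re} ∩ ({q : ℂ × ℂ × ℂ | 0 < q.2.1.re} ∩
      {q : ℂ × ℂ × ℂ | 0 < (q.1.re + q.2.1.re) / 2 + q.2.2.im}) := by
    ext q
    refine and_congr_right fun _ => and_congr_right fun _ => ?_
    exact neg_lt_iff_pos_add'
  rw [e]
  exact h1.inter (h2.inter h3)

theorem differentiableAt_prod {E ι : Type*} [NormedAddCommGroup E] [NormedSpace ℂ E]
    (s : Finset ι) {f : ι → E → ℂ} {x : E} (h : ∀ i ∈ s, DifferentiableAt ℂ (f i) x) :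
    DifferentiableAt ℂ (fun y => ∏ i ∈ s, f i y) x := by
  classical
  induction s using Finset.induction_on with
  | empty => simp
  | insert a s ha ih =>
    simp only [Finset.prod_insert ha]
    exact (h a (Finset.mem_insert_self a s)).fun_mul
      (ih fun i hi => h i (Finset.mem_insert_of_mem hi))

theorem DifferentiableAt.gStrip {E : Type*} [NormedAddCommGroup E] [NormedSpace ℂ E]
    {a b c : E → ℂ} {x : E} (ha : DifferentiableAt ℂ a x) (hb : DifferentiableAt ℂ b x)
    (hc : DifferentiableAt ℂ c x) (h₁ : 0 < (a x).re) (h₂ : 0 < (b x).re)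
    (hz : |(c x).im| < ((a x).re + (b x).re) / 2) :
    DifferentiableAt ℂ (fun y => GStrip (a y) (b y) (c y)) x := by
  have := (differentiableOn_gInt.differentiableAt (x := (a x, b x, c x))
    (isOpen_stripDomain.mem_nhds ⟨h₁, h₂, by rw [half_re]; exact hz⟩)).comp
    (f := fun y => (a y, b y, c y)) x (ha.prodMk (hb.prodMk hc))
  exact (this.const_mul Complex.I).cexp

theorem differentiableOn_G :
    DifferentiableOn ℂ (fun q : ℂ × ℂ × ℂ => G q.1 q.2.1 q.2.2) upperDomain := by
  intro q hq
  obtain ⟨h1, h2, h3⟩ := hq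
  obtain ⟨n, hn⟩ := exists_natCast_abs_sub_lt h1 h2 h3
  have ho : IsOpen {q : ℂ × ℂ × ℂ | |q.2.2.im - n * q.1.re| < (q.1.re + q.2.1.re) / 2} :=
    isOpen_lt (by fun_prop) (by fun_prop)
  have hd : DifferentiableAt ℂ (fun q : ℂ × ℂ × ℂ => GUp n q.1 q.2.1 q.2.2) q := by
    unfold GUp
    refine DifferentiableAt.fun_mul ?_ ?_
    · refine differentiableAt_prod _ fun k _ => ?_
      refine (DifferentiableAt.ccosh ?_).const_mul 2
      exact differentiableAt_fun_div (by fun_prop) (by fun_prop) (ne_zero_of_re_pos h2)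
    · refine DifferentiableAt.gStrip (by fun_prop) (by fun_prop) (by fun_prop) h1 h2 ?_
      rw [Complex.sub_im, im_I_mul_natCast_mul]
      exact hn
  refine (hd.congr_of_eventuallyEq ?_).differentiableWithinAt
  filter_upwards [ho.mem_nhds hn, isOpen_upperDomain.mem_nhds ⟨h1, h2, h3⟩] with p hp hp'
  exact G_eq_GUp hp'.1 hp'.2.1 hp

/-- The pairs of periods for which `G` is defined. -/
def periodDomain : Set (ℂ × ℂ × ℂ) := {q | 0 < q.1.re ∧ 0 < q.2.1.re}

/-- Above its poles `G` is holomorphic and not identically zero on a convex set, as `G 1 1 0 ≠ 0`.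
Below, it is the reciprocal of such a function by reflection. -/
theorem isMeromorphicUnitOn_G :
    IsMeromorphicUnitOn (fun q : ℂ × ℂ × ℂ => G q.1 q.2.1 q.2.2) periodDomain := by
  have hup : IsMeromorphicUnitOn (fun q : ℂ × ℂ × ℂ => G q.1 q.2.1 q.2.2) upperDomain := by
    intro p hp
    have hp0 : ((1, 1, 0) : ℂ × ℂ × ℂ) ∈ upperDomain := by
      refine ⟨by simp, by simp, by simp⟩
    refine ⟨upperDomain, isOpen_upperDomain, hp, subset_rfl, _, fun _ => 1, differentiableOn_G,
      by fun_prop, ?_, ?_, fun q _ _ => (div_one _).symm⟩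
    · refine subset_closure_ne_zero isOpen_upperDomain convex_upperDomain differentiableOn_G hp0 ?_
      show G 1 1 0 ≠ 0
      rw [G_of_strip (by simp)]
      exact Complex.exp_ne_zero _
    · simpa using subset_closure
  set T : ℂ × ℂ × ℂ → ℂ × ℂ × ℂ := fun q => (q.1, q.2.1, -q.2.2) with hT
  have hTc : Continuous T := by fun_prop
  have hTo : IsOpenMap T := by
    intro s hs
    have : T '' s = T ⁻¹' s := by
      ext q
      constructor
      · rintro ⟨x, hx, rfl⟩; simpa [hT] using hx
      · intro hq; exact ⟨T q, hq, by simp [hT]⟩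
    rw [this]
    exact hs.preimage hTc
  have hdn := (hup.comp (T := T) (by fun_prop) hTo rfl).inv
  intro p hp
  rcases le_total 0 p.2.2.im with h | h
  · obtain ⟨V, h1, h2, h3, h4⟩ := hup p ⟨hp.1, hp.2, by linarith [hp.1, hp.2]⟩
    exact ⟨V, h1, h2, h3.trans fun q hq => ⟨hq.1, hq.2.1⟩, h4⟩
  · obtain ⟨V, h1, h2, h3, g, k, h4, h5, h6, h7, h8⟩ := hdn p ⟨hp.1, hp.2, by
      show _ < (-p.2.2).im
      rw [Complex.neg_im]
      have := hp.1
      have := hp.2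
      show -((p.1.re + p.2.1.re) / 2) < _
      linarith⟩
    refine ⟨V, h1, h2, h3.trans fun q hq => ⟨hq.1, hq.2.1⟩, g, k, h4, h5, h6, h7, fun q hq hk => ?_⟩
    rw [← h8 q hq hk]
    have := h3 hq
    show _ = (G q.1 q.2.1 (-q.2.2))⁻¹
    rw [G_neg this.1 this.2.1, inv_inv]

end Structure

/-! ### Cancelling the first poles of `G` by linear factors. -/

section Lattice

/-- The hyperbolic gamma function with its argument shifted such that its poles are the points
`-i (k w₁ + l w₂)`. -/
def GShift (w₁ w₂ z : ℂ) : ℂ := G w₁ w₂ (z - Complex.I * (w₁ + w₂) / 2)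

/-- The factor in the difference equation of `GShift`. -/
def stepFactor (w z : ℂ) : ℂ := 2 * Complex.cosh (Real.pi * (z - Complex.I * w / 2) / w)

theorem im_I_mul_half (w : ℂ) : (Complex.I * w / 2).im = w.re / 2 := by
  have := im_I_mul_add_half 0 w
  rw [show Complex.I * w / 2 = Complex.I * w * ((0 : ℕ) + 1 / 2) by push_cast; ring, this]
  push_cast; ring

theorem im_I_mul_lattice (k l : ℕ) (w₁ w₂ : ℂ) :
    (Complex.I * (k * w₁ + l * w₂)).im = k * w₁.re + l * w₂.re := by
  rw [Complex.I_mul_im, Complex.add_re, ← Complex.ofReal_natCast, ← Complex.ofReal_natCast,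
    Complex.re_ofReal_mul, Complex.re_ofReal_mul]

theorem GShift_eq_div {w₁ w₂ z : ℂ} (h₁ : 0 < w₁.re) (h₂ : 0 < w₂.re) (hz : z.im < w₂.re) :
    GShift w₁ w₂ z = GShift w₁ w₂ (z + Complex.I * w₁) / stepFactor w₂ z := by
  have := G_sub (z := z - Complex.I * w₂ / 2) h₁ h₂ (by
    rw [Complex.sub_im, im_I_mul_half]; linarith)
  rw [GShift, GShift, stepFactor]
  convert this using 2 <;> ring_nf

theorem stepFactor_eq_sin {w : ℂ} (hw : w ≠ 0) (z : ℂ) :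
    stepFactor w z = 2 * Complex.sin (Real.pi * (-Complex.I * z / w)) := by
  rw [stepFactor, ← Complex.cos_mul_I]
  rw [show Real.pi * (z - Complex.I * w / 2) / w * Complex.I =
    Real.pi / 2 - Real.pi * (-Complex.I * z / w) by
      field_simp
      linear_combination (-(w : ℂ)) * Complex.I_sq, Complex.cos_pi_div_two_sub]

/-- The reflection formula with `L` factors moved into the Gamma function, so that it remains valid
at the first `L` zeros `0, -1, …` of the sine, where both sides vanish. -/
theorem Gamma_add_natCast_mul_Gamma_one_sub_mul_sin {s : ℂ} {L : ℕ}
    (h₁ : ∀ m : ℕ, s ≠ m + 1) (h₂ : ∀ m : ℕ, s + L ≠ -m) :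
    Complex.Gamma (s + L) * Complex.Gamma (1 - s) * Complex.sin (Real.pi * s) =
      Real.pi * ∏ l ∈ Finset.range L, (s + l) := by
  have hπ : (Real.pi : ℂ) ≠ 0 := by exact_mod_cast Real.pi_ne_zero
  by_cases h : ∃ l ∈ Finset.range L, s + l = 0
  · obtain ⟨l, hl, hs⟩ := h
    rw [Finset.prod_eq_zero hl hs, mul_zero]
    have : Complex.sin (Real.pi * s) = 0 := by
      rw [Complex.sin_eq_zero_iff]
      refine ⟨-l, ?_⟩
      push_cast
      linear_combination Real.pi * hs
    rw [this, mul_zero]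
  · push Not at h
    have hG : Complex.Gamma (s + L) = (∏ l ∈ Finset.range L, (s + l)) * Complex.Gamma s := by
      clear h₂
      induction L with
      | zero => simp
      | succ L ih =>
        have := ih fun l hl => h l (Finset.mem_range.2 ((Finset.mem_range.1 hl).trans L.lt_succ_self))
        push_cast
        rw [← add_assoc, Complex.Gamma_add_one _ (h L (Finset.self_mem_range_succ L)), this,
          Finset.prod_range_succ]
        ring
    have hs : Complex.sin (Real.pi * s) ≠ 0 := by
      intro h0
      obtain ⟨k, hk⟩ := Complex.sin_eq_zero_iff.1 h0
      have hk' : s = k := mul_left_cancel₀ hπ (by rw [hk]; ring)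
      rcases lt_or_ge 0 k with hk0 | hk0
      · obtain ⟨m, hm⟩ := Int.eq_ofNat_of_zero_le (show 0 ≤ k - 1 by lia)
        exact h₁ m (by rw [hk', show k = m + 1 by lia]; push_cast; rfl)
      · obtain ⟨m, hm⟩ := Int.eq_ofNat_of_zero_le (show 0 ≤ -k by lia)
        have hsm : s = -m := by rw [hk', show k = -m by lia]; push_cast; rfl
        rcases lt_or_ge m L with hmL | hmL
        · exact h m (Finset.mem_range.2 hmL) (by rw [hsm]; ring)
        · refine h₂ (m - L) ?_
          rw [hsm, Nat.cast_sub hmL]; ring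
    rw [hG, mul_assoc (_ * _), mul_comm (Complex.Gamma (1 - s)), ← mul_assoc, mul_assoc _ _ (Complex.sin _),
      mul_assoc]
    have := Complex.Gamma_mul_Gamma_one_sub s
    rw [eq_div_iff hs] at this
    linear_combination (∏ l ∈ Finset.range L, (s + l)) * this

/-- The product of the linear factors that vanish at the first poles of `GShift`. -/
def latticeProd (K L : ℕ) (w₁ w₂ z : ℂ) : ℂ :=
  ∏ k ∈ Finset.range K, ∏ l ∈ Finset.range L, (z + Complex.I * (k * w₁ + l * w₂))

theorem latticeProd_succ (K L : ℕ) (w₁ w₂ z : ℂ) :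
    latticeProd (K + 1) L w₁ w₂ z = latticeProd K L w₁ w₂ (z + Complex.I * w₁) *
      ∏ l ∈ Finset.range L, (z + Complex.I * (l * w₂)) := by
  rw [latticeProd, Finset.prod_range_succ', latticeProd]
  congr 1
  · refine Finset.prod_congr rfl fun k _ => Finset.prod_congr rfl fun l _ => ?_
    push_cast; ring
  · refine Finset.prod_congr rfl fun l _ => ?_
    push_cast; ring

/-- The quotient of a product of linear factors by `stepFactor`. -/
def stepQuot (L : ℕ) (w z : ℂ) : ℂ :=
  (Complex.I * w) ^ L / (2 * Real.pi) *
    (Complex.Gamma (-Complex.I * z / w + L) * Complex.Gamma (1 - -Complex.I * z / w))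

theorem ne_of_im_lt {w z : ℂ} (hw : 0 < w.re) (hz : z.im < w.re) (m : ℕ) :
    -Complex.I * z / w ≠ m + 1 := by
  intro h
  have hw0 := ne_zero_of_re_pos hw
  have : z = Complex.I * ((m + 1 : ℕ) : ℝ) * w := by
    rw [div_eq_iff hw0] at h
    push_cast
    linear_combination Complex.I * h + z * Complex.I_sq
  have h2 : z.im = (m + 1 : ℕ) * w.re := by
    rw [this, ← im_I_mul_natCast_mul]; push_cast; rfl
  push_cast at h2
  have : (0 : ℝ) ≤ m * w.re := by positivity
  linarith

theorem ne_of_lt_im {w z : ℂ} (hw : 0 < w.re) {L : ℕ} (hz : -(L * w.re) < z.im) (m : ℕ) :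
    -Complex.I * z / w + L ≠ -m := by
  intro h
  have hw0 := ne_zero_of_re_pos hw
  have : -z = Complex.I * ((m + L : ℕ) : ℝ) * w := by
    have h' : -Complex.I * z / w = -(m + L) := by linear_combination h
    rw [div_eq_iff hw0] at h'
    push_cast
    linear_combination -Complex.I * h' - z * Complex.I_sq
  have h2 : (-z).im = (m + L : ℕ) * w.re := by
    rw [this, ← im_I_mul_natCast_mul]; push_cast; rfl
  push_cast at h2
  rw [Complex.neg_im] at h2
  have : (0 : ℝ) ≤ m * w.re := by positivity
  linarith

/-- The linear factors cancel the zeros of `stepFactor` in this range. The closed form by Gamma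
functions makes the quotient holomorphic jointly in `w` and `z` without an argument on removable
singularities. -/
theorem stepQuot_mul {w z : ℂ} (hw : 0 < w.re) (hz : z.im < w.re) {L : ℕ}
    (hz' : -(L * w.re) < z.im) :
    stepQuot L w z * stepFactor w z = ∏ l ∈ Finset.range L, (z + Complex.I * (l * w)) := by
  have hw0 := ne_zero_of_re_pos hw
  have hπ : (Real.pi : ℂ) ≠ 0 := by exact_mod_cast Real.pi_ne_zero
  have h := Gamma_add_natCast_mul_Gamma_one_sub_mul_sin (L := L) (ne_of_im_lt hw hz)
    (ne_of_lt_im hw hz')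
  have e : ∏ l ∈ Finset.range L, (z + Complex.I * (l * w)) =
      (Complex.I * w) ^ L * ∏ l ∈ Finset.range L, (-Complex.I * z / w + l) := by
    rw [← Finset.card_range L, ← Finset.prod_const, Finset.card_range, ← Finset.prod_mul_distrib]
    refine Finset.prod_congr rfl fun l _ => ?_
    field_simp
    linear_combination z * Complex.I_sq
  rw [e, stepFactor_eq_sin hw0, stepQuot]
  generalize -Complex.I * z / w = s at *
  calc _ = (Complex.I * w) ^ L / Real.pi *
      (Complex.Gamma (s + L) * Complex.Gamma (1 - s) * Complex.sin (Real.pi * s)) := by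
        field_simp
    _ = _ := by rw [h]; field_simp

theorem stepFactor_ne_zero {w z : ℂ} (hw : 0 < w.re) (hz : 0 < z.im) (hz' : z.im < w.re) :
    stepFactor w z ≠ 0 := by
  intro h
  -- For `L = 0` the product is empty, so `stepFactor` has an inverse.
  have h1 := stepQuot_mul (L := 0) hw hz' (by simpa using hz)
  rw [h] at h1
  simp at h1

theorem differentiableAt_stepQuot (L : ℕ) {q : ℂ × ℂ × ℂ} (hw : 0 < q.2.1.re)
    (hz : q.2.2.im < q.2.1.re) (hz' : -(L * q.2.1.re) < q.2.2.im) :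
    DifferentiableAt ℂ (fun q : ℂ × ℂ × ℂ => stepQuot L q.2.1 q.2.2) q := by
  have d : DifferentiableAt ℂ (fun q : ℂ × ℂ × ℂ => -Complex.I * q.2.2 / q.2.1) q :=
    differentiableAt_fun_div (by fun_prop) (by fun_prop) (ne_zero_of_re_pos hw)
  have d1 : DifferentiableAt ℂ (fun q : ℂ × ℂ × ℂ =>
      Complex.Gamma (-Complex.I * q.2.2 / q.2.1 + L)) q :=
    (Complex.differentiableAt_Gamma _ (ne_of_lt_im hw hz')).comp
      (f := fun q : ℂ × ℂ × ℂ => -Complex.I * q.2.2 / q.2.1 + L) q (d.add_const _)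
  have d2 : DifferentiableAt ℂ (fun q : ℂ × ℂ × ℂ =>
      Complex.Gamma (1 - -Complex.I * q.2.2 / q.2.1)) q := by
    refine (Complex.differentiableAt_Gamma _ fun m hm => ne_of_im_lt hw hz m ?_).comp
      (f := fun q : ℂ × ℂ × ℂ => 1 - -Complex.I * q.2.2 / q.2.1) q (d.const_sub _)
    linear_combination -hm
  unfold stepQuot
  refine DifferentiableAt.fun_mul ?_ (d1.fun_mul d2)
  fun_prop

/-- The points above the zeros of `latticeProd` that are poles of `GShift`. -/
def latticeDomain (K L : ℕ) : Set (ℂ × ℂ × ℂ) :=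
  {q | 0 < q.1.re ∧ 0 < q.2.1.re ∧ -(K * q.1.re) < q.2.2.im ∧ -(L * q.2.1.re) < q.2.2.im}

theorem isOpen_latticeDomain (K L : ℕ) : IsOpen (latticeDomain K L) := by
  have h1 : IsOpen {q : ℂ × ℂ × ℂ | 0 < q.1.re} := isOpen_lt (by fun_prop) (by fun_prop)
  have h2 : IsOpen {q : ℂ × ℂ × ℂ | 0 < q.2.1.re} := isOpen_lt (by fun_prop) (by fun_prop)
  have h3 : IsOpen {q : ℂ × ℂ × ℂ | -(K * q.1.re) < q.2.2.im} :=
    isOpen_lt (by fun_prop) (by fun_prop)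
  have h4 : IsOpen {q : ℂ × ℂ × ℂ | -(L * q.2.1.re) < q.2.2.im} :=
    isOpen_lt (by fun_prop) (by fun_prop)
  exact h1.inter (h2.inter (h3.inter h4))

theorem differentiableAt_GShift {q : ℂ × ℂ × ℂ} (h₁ : 0 < q.1.re) (h₂ : 0 < q.2.1.re)
    (hz : 0 < q.2.2.im) :
    DifferentiableAt ℂ (fun q : ℂ × ℂ × ℂ => GShift q.1 q.2.1 q.2.2) q := by
  have hm : (q.1, q.2.1, q.2.2 - Complex.I * (q.1 + q.2.1) / 2) ∈ upperDomain := by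
    refine ⟨h₁, h₂, ?_⟩
    rw [Complex.sub_im, im_I_mul_half, Complex.add_re]
    show -((q.1.re + q.2.1.re) / 2) < _
    linarith
  exact (differentiableOn_G.differentiableAt (isOpen_upperDomain.mem_nhds hm)).comp
    (f := fun q : ℂ × ℂ × ℂ => (q.1, q.2.1, q.2.2 - Complex.I * (q.1 + q.2.1) / 2)) q
    (by fun_prop)

theorem differentiable_latticeProd (K L : ℕ) :
    Differentiable ℂ (fun q : ℂ × ℂ × ℂ => latticeProd K L q.1 q.2.1 q.2.2) := by
  intro q
  unfold latticeProd
  exact differentiableAt_prod _ fun k _ => differentiableAt_prod _ fun l _ => by fun_prop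

/-- The first poles of `GShift` are cancelled by `latticeProd`. -/
theorem exists_GShift_mul_latticeProd (K L : ℕ) :
    ∃ A : ℂ × ℂ × ℂ → ℂ, DifferentiableOn ℂ A (latticeDomain K L) ∧
      ∀ q ∈ latticeDomain K L, latticeProd K L q.1 q.2.1 q.2.2 ≠ 0 →
        GShift q.1 q.2.1 q.2.2 * latticeProd K L q.1 q.2.1 q.2.2 = A q := by
  induction K with
  | zero =>
    refine ⟨fun q => GShift q.1 q.2.1 q.2.2, fun q hq => ?_, fun q _ _ => by simp [latticeProd]⟩
    exact (differentiableAt_GShift hq.1 hq.2.1 (by simpa using hq.2.2.1)).differentiableWithinAt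
  | succ K ih =>
    obtain ⟨A, hA, hAe⟩ := ih
    set T : ℂ × ℂ × ℂ → ℂ × ℂ × ℂ := fun q => (q.1, q.2.1, q.2.2 + Complex.I * q.1) with hT
    have hTm : ∀ q ∈ latticeDomain (K + 1) L, T q ∈ latticeDomain K L := by
      intro q hq
      have h1 := hq.1
      have h3 := hq.2.2.1
      have h4 := hq.2.2.2
      push_cast at h3
      have e : (q.2.2 + Complex.I * q.1).im = q.2.2.im + q.1.re := by
        rw [Complex.add_im, Complex.I_mul_im]
      refine ⟨h1, hq.2.1, ?_, ?_⟩
      · show -(K * q.1.re) < (q.2.2 + Complex.I * q.1).im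
        rw [e]; linarith
      · show -(L * q.2.1.re) < (q.2.2 + Complex.I * q.1).im
        rw [e]; linarith
    -- The difference equation in `w₁` reduces `K + 1` rows of poles to `K` rows at the shifted
    -- point; the row `k = 0` comes from the zeros of `stepFactor` in the other period and is
    -- cancelled by `stepQuot`.
    set B : ℂ × ℂ × ℂ → ℂ := fun q => A (T q) * stepQuot L q.2.1 q.2.2 with hB
    classical
    -- `B` is available only for `q.2.2.im < q.2.1.re`; above the real line the product itself is
    -- holomorphic, and the two agree on the overlap.
    set A' : ℂ × ℂ × ℂ → ℂ := fun q =>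
      if 0 < q.2.2.im then GShift q.1 q.2.1 q.2.2 * latticeProd (K + 1) L q.1 q.2.1 q.2.2
      else B q with hA'
    have key : ∀ q ∈ latticeDomain (K + 1) L, q.2.2.im < q.2.1.re → stepFactor q.2.1 q.2.2 ≠ 0 →
        latticeProd K L q.1 q.2.1 (q.2.2 + Complex.I * q.1) ≠ 0 →
        GShift q.1 q.2.1 q.2.2 * latticeProd (K + 1) L q.1 q.2.1 q.2.2 = B q := by
      intro q hq hlt hs hP
      rw [hB, GShift_eq_div hq.1 hq.2.1 hlt, latticeProd_succ,
        ← stepQuot_mul hq.2.1 hlt hq.2.2.2]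
      simp only
      rw [← hAe (T q) (hTm q hq) hP]
      simp only [hT]
      field_simp
    refine ⟨A', fun q hq => ?_, fun q hq hP => ?_⟩
    · by_cases h0 : 0 < q.2.2.im
      · refine DifferentiableAt.differentiableWithinAt ?_
        refine ((differentiableAt_GShift hq.1 hq.2.1 h0).fun_mul
          (differentiable_latticeProd (K + 1) L q)).congr_of_eventuallyEq ?_
        have ho : IsOpen {q : ℂ × ℂ × ℂ | 0 < q.2.2.im} := isOpen_lt (by fun_prop) (by fun_prop)
        filter_upwards [ho.mem_nhds h0] with p hp
        exact if_pos hp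
      · refine DifferentiableAt.differentiableWithinAt ?_
        have hlt : q.2.2.im < q.2.1.re := by linarith [hq.2.1]
        have d1 : DifferentiableAt ℂ B q := by
          refine DifferentiableAt.fun_mul ?_ (differentiableAt_stepQuot L hq.2.1 hlt hq.2.2.2)
          exact (hA.differentiableAt ((isOpen_latticeDomain K L).mem_nhds (hTm q hq))).comp
            (f := T) q (by rw [hT]; fun_prop)
        refine d1.congr_of_eventuallyEq ?_
        have ho : IsOpen {q : ℂ × ℂ × ℂ | q.2.2.im < q.2.1.re} :=
          isOpen_lt (by fun_prop) (by fun_prop)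
        filter_upwards [ho.mem_nhds hlt, (isOpen_latticeDomain (K + 1) L).mem_nhds hq] with p hp hp'
        by_cases h0p : 0 < p.2.2.im
        · rw [hA']
          simp only
          rw [if_pos h0p]
          refine key p hp' hp (stepFactor_ne_zero hp'.2.1 h0p hp) ?_
          refine Finset.prod_ne_zero_iff.2 fun k _ => Finset.prod_ne_zero_iff.2 fun l _ h => ?_
          have := congrArg Complex.im h
          rw [Complex.zero_im, Complex.add_im, Complex.add_im, Complex.I_mul_im,
            im_I_mul_lattice] at this
          have := hp'.1
          have := hp'.2.1
          have : (0 : ℝ) ≤ k * p.1.re + l * p.2.1.re := by positivity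
          linarith
        · exact if_neg h0p
    · by_cases h0 : 0 < q.2.2.im
      · exact (if_pos h0).symm
      · have hlt : q.2.2.im < q.2.1.re := by linarith [hq.2.1]
        rw [latticeProd_succ] at hP
        have h2 := right_ne_zero_of_mul hP
        rw [← stepQuot_mul hq.2.1 hlt hq.2.2.2] at h2
        rw [key q hq hlt (right_ne_zero_of_mul h2) (left_ne_zero_of_mul hP)]
        exact (if_neg h0).symm

end Lattice

/-! ### Uniform growth of `G` on horizontal strips. -/

section Growth

/-- The leading asymptotics of the hyperbolic gamma function for `σ Re u → ∞`. -/
def gaussExp (σ : ℝ) (w₁ w₂ u : ℂ) : ℂ :=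
  Complex.exp (-Complex.I * Real.pi * σ * u ^ 2 / (2 * w₁ * w₂))

theorem norm_two_mul_cosh_bounds {v : ℂ} {σ : ℝ} (hσ : σ = 1 ∨ σ = -1) (hv : 1 ≤ σ * v.re) :
    ‖2 * Complex.cosh v‖ ≤ 2 * Real.exp (σ * v.re) ∧
      Real.exp (σ * v.re) ≤ 2 * ‖2 * Complex.cosh v‖ := by
  have e : 2 * Complex.cosh v = Complex.exp (σ * v) + Complex.exp (-(σ * v)) := by
    rw [Complex.cosh]
    rcases hσ with rfl | rfl <;> push_cast
    · rw [one_mul]; ring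
    · rw [neg_one_mul, neg_neg]; ring
  have n1 : ‖Complex.exp (σ * v)‖ = Real.exp (σ * v.re) := by
    rw [Complex.norm_exp, Complex.re_ofReal_mul]
  have n2 : ‖Complex.exp (-(σ * v))‖ = Real.exp (-(σ * v.re)) := by
    rw [Complex.norm_exp, Complex.neg_re, Complex.re_ofReal_mul]
  have h1 : Real.exp (-(σ * v.re)) ≤ 1 := Real.exp_le_one_iff.2 (by linarith)
  have h2 : 2 ≤ Real.exp (σ * v.re) := by linarith [Real.add_one_le_exp (σ * v.re)]
  rw [e]
  constructor
  · have := norm_add_le (Complex.exp (σ * v)) (Complex.exp (-(σ * v)))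
    rw [n1, n2] at this
    linarith
  · have := norm_sub_norm_le (Complex.exp (σ * v)) (-Complex.exp (-(σ * v)))
    rw [sub_neg_eq_add, norm_neg, n1, n2] at this
    linarith

theorem exists_norm_G_bounds_strip {ε R : ℝ} (hε : 0 < ε) (hR : 0 < R) :
    ∃ K, 0 < K ∧ ∀ w₁ w₂ u : ℂ, ε ≤ w₁.re → ε ≤ w₂.re → ‖w₁‖ ≤ R → ‖w₂‖ ≤ R →
      |u.im| ≤ w₁.re / 2 → ∀ σ : ℝ, (σ = 1 ∨ σ = -1) → σ * u.re = |u.re| →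
        ‖G w₁ w₂ u‖ ≤ K * ‖gaussExp σ w₁ w₂ u‖ ∧ ‖gaussExp σ w₁ w₂ u‖ ≤ K * ‖G w₁ w₂ u‖ := by
  obtain ⟨C, hC⟩ := exists_norm_gInt_add_le hε hR (half_pos hε)
  refine ⟨Real.exp C, Real.exp_pos C, fun w₁ w₂ u h₁ h₂ hw₁ hw₂ hu σ hσ hσu => ?_⟩
  have h := hC w₁ w₂ u h₁ h₂ hw₁ hw₂ (by linarith) σ hσ hσu
  set a := Complex.I * gInt w₁ w₂ u with ha
  set b := -Complex.I * Real.pi * σ * u ^ 2 / (2 * w₁ * w₂) with hb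
  have hab : |a.re - b.re| ≤ C := by
    rw [← Complex.sub_re]
    refine (Complex.abs_re_le_norm _).trans (le_of_eq_of_le ?_ h)
    rw [show a - b = Complex.I * (gInt w₁ w₂ u + Real.pi * σ * u ^ 2 / (2 * w₁ * w₂)) by
      rw [ha, hb]; ring, norm_mul, Complex.norm_I, one_mul]
  rw [abs_le] at hab
  rw [G_of_strip (by linarith), GStrip, gaussExp, Complex.norm_exp, Complex.norm_exp,
    ← Real.exp_add, ← Real.exp_add]
  constructor <;> refine Real.exp_le_exp.2 ?_ <;> linarith

/-- For complex `w` the real part of `v / w` contains `v.im * w.im`, of size at most `M * R`; the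
threshold makes `v.re * w.re` outweigh this and `‖w‖²`. -/
theorem one_le_mul_re_div {ε R M : ℝ} (hε : 0 < ε) {w v : ℂ} (hw : ε ≤ w.re)
    (hwR : ‖w‖ ≤ R) (hvM : |v.im| ≤ M) {σ : ℝ} (hσ : σ = 1 ∨ σ = -1)
    (hσv : (R ^ 2 + M * R) / ε ≤ σ * v.re) : 1 ≤ σ * (Real.pi * v / w).re := by
  have hM : 0 ≤ M := (abs_nonneg _).trans hvM
  have hw0 : 0 < Complex.normSq w := Complex.normSq_pos.2 (ne_zero_of_re_pos (hε.trans_le hw))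
  have hns : Complex.normSq w ≤ R ^ 2 := by
    rw [Complex.normSq_eq_norm_sq]; gcongr
  rw [div_le_iff₀ hε] at hσv
  have h1 : |σ * (v.im * w.im)| ≤ M * R := by
    have : |σ| = 1 := by rcases hσ with rfl | rfl <;> simp
    rw [abs_mul, abs_mul, this, one_mul]
    gcongr
    exact (Complex.abs_im_le_norm w).trans hwR
  have h2 : 0 ≤ σ * v.re := by
    by_contra hneg
    push Not at hneg
    have := (abs_nonneg _).trans h1
    nlinarith [sq_nonneg R]
  have h3 : Complex.normSq w ≤ σ * (v.re * w.re + v.im * w.im) := by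
    have := (abs_le.1 h1).1
    nlinarith [mul_le_mul_of_nonneg_left hw h2]
  have e : σ * (Real.pi * v / w).re =
      Real.pi * (σ * (v.re * w.re + v.im * w.im) / Complex.normSq w) := by
    rw [mul_div_assoc, Complex.re_ofReal_mul, Complex.div_re]
    ring
  rw [e]
  have h4 : 1 ≤ σ * (v.re * w.re + v.im * w.im) / Complex.normSq w := (one_le_div hw0).2 h3
  nlinarith [Real.pi_gt_three]

/-- The Gaussian obeys the difference equation of `G` with `2 cosh` replaced by its dominant
exponential. -/
theorem gaussExp_step {w₁ w₂ : ℂ} (h₁ : w₁ ≠ 0) (h₂ : w₂ ≠ 0) (σ : ℝ) (u : ℂ) :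
    gaussExp σ w₁ w₂ u = Complex.exp (σ * (Real.pi * (u - Complex.I * w₁ / 2) / w₂)) *
      gaussExp σ w₁ w₂ (u - Complex.I * w₁) := by
  rw [gaussExp, gaussExp, ← Complex.exp_add]
  congr 1
  field_simp
  ring_nf
  rw [Complex.I_sq, show Complex.I ^ 3 = -Complex.I by rw [pow_succ, Complex.I_sq]; ring]
  ring

/-- Each step up multiplies `G` and the Gaussian by factors that agree up to a factor `2`. The lower
bound for `G` is kept because reflection turns it into the upper bound in the lower half plane. -/
theorem exists_norm_G_bounds_up {ε R : ℝ} (hε : 0 < ε) (hR : 0 < R) (n : ℕ) :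
    ∃ K X, 0 < K ∧ 0 ≤ X ∧ ∀ w₁ w₂ u : ℂ, ε ≤ w₁.re → ε ≤ w₂.re → ‖w₁‖ ≤ R → ‖w₂‖ ≤ R →
      -(w₁.re / 2) ≤ u.im → u.im ≤ (n + 1 / 2) * w₁.re → X ≤ |u.re| →
      ∀ σ : ℝ, (σ = 1 ∨ σ = -1) → σ * u.re = |u.re| →
        ‖G w₁ w₂ u‖ ≤ K * ‖gaussExp σ w₁ w₂ u‖ ∧ ‖gaussExp σ w₁ w₂ u‖ ≤ K * ‖G w₁ w₂ u‖ := by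
  induction n with
  | zero =>
    obtain ⟨K, hK, h⟩ := exists_norm_G_bounds_strip hε hR
    refine ⟨K, 0, hK, le_rfl, fun w₁ w₂ u h₁ h₂ hw₁ hw₂ hu hu' _ σ hσ hσu => ?_⟩
    refine h w₁ w₂ u h₁ h₂ hw₁ hw₂ ?_ σ hσ hσu
    push_cast at hu'
    rw [abs_le]; constructor <;> linarith
  | succ n ih =>
    obtain ⟨K, X, hK, hX, h⟩ := ih
    have hY : 0 ≤ (R ^ 2 + (n + 1) * R * R) / ε := by positivity
    -- The summand `R` allows for the change of the real part under the shift by `i w₁`; the last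
    -- one is the threshold of `one_le_mul_re_div` with `M = (n + 1) * R`.
    refine ⟨2 * K, X + R + (R ^ 2 + (n + 1) * R * R) / ε, by positivity, by positivity,
      fun w₁ w₂ u h₁ h₂ hw₁ hw₂ hu hu' huX σ hσ hσu => ?_⟩
    by_cases hc : u.im ≤ (n + 1 / 2) * w₁.re
    · obtain ⟨a, b⟩ := h w₁ w₂ u h₁ h₂ hw₁ hw₂ hu hc (by linarith) σ hσ hσu
      constructor
      · refine a.trans ?_; gcongr; linarith
      · refine b.trans ?_; gcongr; linarith
    push Not at hc
    push_cast at hu'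
    have hp₁ := hε.trans_le h₁
    have hp₂ := hε.trans_le h₂
    have hr₁ := (Complex.re_le_norm w₁).trans hw₁
    have hi₁ : |w₁.im| ≤ R := (Complex.abs_im_le_norm w₁).trans hw₁
    have hσi : |σ * w₁.im| ≤ R := by
      have : |σ| = 1 := by rcases hσ with rfl | rfl <;> simp
      rwa [abs_mul, this, one_mul]
    rw [abs_le] at hσi
    have hnw : (0 : ℝ) ≤ n * w₁.re := by positivity
    have hure : (u - Complex.I * w₁).re = u.re + w₁.im := by
      rw [Complex.sub_re, Complex.I_mul_re]; ring
    have huim : (u - Complex.I * w₁).im = u.im - w₁.re := by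
      rw [Complex.sub_im, Complex.I_mul_im]
    have hσu' : X ≤ σ * (u - Complex.I * w₁).re := by
      rw [hure, mul_add, hσu]; linarith
    have habs : σ * (u - Complex.I * w₁).re = |(u - Complex.I * w₁).re| := by
      rw [← abs_of_nonneg (hX.trans hσu'), abs_mul]
      rcases hσ with rfl | rfl <;> simp
    obtain ⟨a, b⟩ := h w₁ w₂ (u - Complex.I * w₁) h₁ h₂ hw₁ hw₂ (by rw [huim]; linarith)
      (by rw [huim]; linarith) (by rw [← habs]; exact hσu') σ hσ habs
    set v := u - Complex.I * w₁ / 2 with hv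
    have hvre : v.re = u.re + w₁.im / 2 := by
      rw [hv, show u - Complex.I * w₁ / 2 = u - ((1 / 2 : ℝ) : ℂ) * (Complex.I * w₁) by
        push_cast; ring, Complex.sub_re, Complex.re_ofReal_mul, Complex.I_mul_re]; ring
    have hvim : v.im = u.im - w₁.re / 2 := by rw [hv, Complex.sub_im, im_I_mul_half]
    have hcosh := norm_two_mul_cosh_bounds (v := Real.pi * v / w₂) hσ
      (one_le_mul_re_div (M := (n + 1) * R) hε h₂ hw₂ (by
        rw [hvim, abs_le]
        have : (n + 1) * w₁.re ≤ (n + 1) * R := by gcongr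
        constructor <;> linarith) hσ (by
        rw [hvre, mul_add, hσu]; linarith))
    have hG : G w₁ w₂ u = 2 * Complex.cosh (Real.pi * v / w₂) * G w₁ w₂ (u - Complex.I * w₁) := by
      have := G_add (z := v) hp₁ hp₂ (by rw [hvim]; linarith)
      rw [hv] at this ⊢
      convert this using 2 <;> ring_nf
    rw [hG, gaussExp_step (ne_zero_of_re_pos hp₁) (ne_zero_of_re_pos hp₂), norm_mul _ (G _ _ _),
      norm_mul _ (gaussExp _ _ _ _), Complex.norm_exp, Complex.re_ofReal_mul]
    constructor
    · calc _ ≤ (2 * Real.exp (σ * (Real.pi * v / w₂).re)) *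
            (K * ‖gaussExp σ w₁ w₂ (u - Complex.I * w₁)‖) :=
          mul_le_mul hcosh.1 a (norm_nonneg _) (by positivity)
        _ = _ := by ring
    · calc _ ≤ (2 * ‖2 * Complex.cosh (Real.pi * v / w₂)‖) *
            (K * ‖G w₁ w₂ (u - Complex.I * w₁)‖) :=
          mul_le_mul hcosh.2 b (norm_nonneg _) (by positivity)
        _ = _ := by ring

theorem gaussExp_neg (σ : ℝ) (w₁ w₂ u : ℂ) :
    gaussExp (-σ) w₁ w₂ (-u) = (gaussExp σ w₁ w₂ u)⁻¹ := by
  rw [gaussExp, gaussExp, ← Complex.exp_neg]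
  congr 1
  push_cast
  ring

/-- The growth of the hyperbolic gamma function on horizontal strips. -/
theorem exists_norm_G_le {ε R M : ℝ} (hε : 0 < ε) (hR : 0 < R) :
    ∃ K X, 0 < K ∧ 0 ≤ X ∧ ∀ w₁ w₂ u : ℂ, ε ≤ w₁.re → ε ≤ w₂.re → ‖w₁‖ ≤ R → ‖w₂‖ ≤ R →
      |u.im| ≤ M → X ≤ |u.re| → ∀ σ : ℝ, (σ = 1 ∨ σ = -1) → σ * u.re = |u.re| →
        ‖G w₁ w₂ u‖ ≤ K * ‖gaussExp σ w₁ w₂ u‖ := by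
  obtain ⟨n, hn⟩ := exists_nat_ge (M / ε)
  rw [div_le_iff₀ hε] at hn
  obtain ⟨K, X, hK, hX, h⟩ := exists_norm_G_bounds_up hε hR n
  refine ⟨K, X, hK, hX, fun w₁ w₂ u h₁ h₂ hw₁ hw₂ hu huX σ hσ hσu => ?_⟩
  have hn' : M ≤ (n + 1 / 2) * w₁.re := by
    have : (n : ℝ) * ε ≤ n * w₁.re := by gcongr
    linarith
  rw [abs_le] at hu
  have hp₁ := hε.trans_le h₁
  have hp₂ := hε.trans_le h₂
  rcases le_total 0 u.im with h0 | h0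
  · exact (h w₁ w₂ u h₁ h₂ hw₁ hw₂ (by linarith) (by linarith) huX σ hσ hσu).1
  · have := (h w₁ w₂ (-u) h₁ h₂ hw₁ hw₂ (by rw [Complex.neg_im]; linarith)
      (by rw [Complex.neg_im]; linarith) (by rwa [Complex.neg_re, abs_neg]) (-σ)
      (by rcases hσ with rfl | rfl <;> simp)
      (by rw [Complex.neg_re, abs_neg, ← hσu]; ring)).2
    rw [gaussExp_neg, G_neg hp₁ hp₂, norm_inv, norm_inv] at this
    have hg : 0 < ‖gaussExp σ w₁ w₂ u‖ := norm_pos_iff.2 (Complex.exp_ne_zero _)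
    by_cases hG : ‖G w₁ w₂ u‖ = 0
    · rw [hG]; positivity
    have hG' : 0 < ‖G w₁ w₂ u‖ := lt_of_le_of_ne (norm_nonneg _) (Ne.symm hG)
    rw [← div_eq_mul_inv, inv_le_comm₀ hg (by positivity), inv_div, div_le_iff₀ hK] at this
    linarith

end Growth

/-! ### Exponential decay of the hypergeometric integrand. -/

section Decay

/-- The integrand of the hypergeometric integral with poles at `a j - i (k w₁ + l w₂)` and
`b j + i (k w₁ + l w₂)`. -/
def pairProd (w₁ w₂ : ℂ) (a b : Fin 4 → ℂ) (z : ℂ) : ℂ :=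
  (∏ j, GShift w₁ w₂ (z - a j)) * ∏ j, GShift w₁ w₂ (b j - z)

/-- The arguments `z - a j` and `b j - z` tend to opposite ends, so the squares of `z` cancel. The
balancing condition `hs` makes the sum of `b j - a j - i (w₁ + w₂)` equal to `-2 i (w₁ + w₂)`, and
this coefficient of the linear term produces the decay. -/
theorem prod_gaussExp (σ : ℝ) {w₁ w₂ : ℂ} (h₁ : w₁ ≠ 0) (h₂ : w₂ ≠ 0) (a b : Fin 4 → ℂ) (z : ℂ)
    (hs : ∑ j, (b j - a j) = 2 * Complex.I * (w₁ + w₂)) :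
    (∏ j, gaussExp σ w₁ w₂ (z - a j - Complex.I * (w₁ + w₂) / 2)) *
      ∏ j, gaussExp (-σ) w₁ w₂ (b j - z - Complex.I * (w₁ + w₂) / 2) =
    Complex.exp (-(σ * (2 * Real.pi) * (w₁⁻¹ * z + w₂⁻¹ * z)) + Complex.I * Real.pi * σ *
      (w₁⁻¹ * w₂⁻¹) / 2 * ∑ j, (a j + b j) * (b j - a j - Complex.I * (w₁ + w₂))) := by
  simp only [gaussExp, ← Complex.exp_sum, ← Complex.exp_add]
  congr 1
  have e : ∀ j, -Complex.I * Real.pi * σ * (z - a j - Complex.I * (w₁ + w₂) / 2) ^ 2 /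
      (2 * w₁ * w₂) + -Complex.I * Real.pi * (-σ : ℝ) *
      (b j - z - Complex.I * (w₁ + w₂) / 2) ^ 2 / (2 * w₁ * w₂) =
      -Complex.I * Real.pi * σ / (2 * w₁ * w₂) * (2 * z * (b j - a j - Complex.I * (w₁ + w₂))) +
      Complex.I * Real.pi * σ * (w₁⁻¹ * w₂⁻¹) / 2 *
        ((a j + b j) * (b j - a j - Complex.I * (w₁ + w₂))) := by
    intro j
    push_cast
    field_simp
    ring
  rw [← Finset.sum_add_distrib, Finset.sum_congr rfl fun j _ => e j, Finset.sum_add_distrib,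
    ← Finset.mul_sum, ← Finset.mul_sum, ← Finset.mul_sum]
  congr 1
  rw [Finset.sum_sub_distrib, hs]
  simp only [Finset.sum_const, Finset.card_univ, Fintype.card_fin, nsmul_eq_mul]
  push_cast
  field_simp
  linear_combination (2 * z * σ * (w₁ + w₂)) * Complex.I_sq

theorem norm_prod_le_pow_mul {ι : Type*} [Fintype ι] {f g : ι → ℂ} {K : ℝ}
    (h : ∀ i, ‖f i‖ ≤ K * ‖g i‖) :
    ‖∏ i, f i‖ ≤ K ^ Fintype.card ι * ‖∏ i, g i‖ := by
  rw [norm_prod, norm_prod]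
  refine (Finset.prod_le_prod (fun i _ => norm_nonneg _) fun i _ => h i).trans (le_of_eq ?_)
  rw [Finset.prod_mul_distrib, Finset.prod_const, Finset.card_univ]

theorem abs_re_add_le {z s : ℂ} {B X σ : ℝ} (hσ : σ = 1 ∨ σ = -1) (hs : ‖s‖ ≤ B) (hX : 0 ≤ X)
    (hz : X + B ≤ σ * z.re) : X ≤ |(z + s).re| ∧ σ * (z + s).re = |(z + s).re| := by
  have h1 := (Complex.abs_re_le_norm s).trans hs
  have h2 : X ≤ σ * (z + s).re := by
    rw [Complex.add_re]
    rw [abs_le] at h1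
    rcases hσ with rfl | rfl <;> linarith
  have h3 : σ * (z + s).re = |(z + s).re| := by
    rw [← abs_of_nonneg (hX.trans h2), abs_mul]
    rcases hσ with rfl | rfl <;> simp
  exact ⟨h3 ▸ h2, h3⟩

theorem exists_norm_pairProd_le {ε R B M : ℝ} (hε : 0 < ε) (hR : 0 < R) (hB : 0 ≤ B) :
    ∃ C c X, 0 < C ∧ 0 < c ∧ ∀ (w₁ w₂ : ℂ) (a b : Fin 4 → ℂ) (z : ℂ), ε ≤ w₁.re → ε ≤ w₂.re →
      ‖w₁‖ ≤ R → ‖w₂‖ ≤ R → (∀ j, ‖a j‖ ≤ B) → (∀ j, ‖b j‖ ≤ B) →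
      ∑ j, (b j - a j) = 2 * Complex.I * (w₁ + w₂) → |z.im| ≤ M → X ≤ |z.re| →
      ‖pairProd w₁ w₂ a b z‖ ≤ C * Real.exp (-(c * |z.re|)) := by
  obtain ⟨K, X, hK, hX, h⟩ := exists_norm_G_le (M := M + (B + R)) hε hR
  set D : ℝ := Real.pi * (ε⁻¹ * ε⁻¹) / 2 * ∑ _j : Fin 4, (B + B) * (B + B + (R + R)) with hD
  set D' : ℝ := 2 * Real.pi * (M * (ε⁻¹ + ε⁻¹)) with hD'
  refine ⟨K ^ 4 * K ^ 4 * Real.exp (D' + D), 2 * Real.pi * (ε / R ^ 2 + ε / R ^ 2), X + (B + R),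
    by positivity, by positivity, fun w₁ w₂ a b z h₁ h₂ hw₁ hw₂ ha hb hs hz hzX => ?_⟩
  have hp₁ := hε.trans_le h₁
  have hp₂ := hε.trans_le h₂
  obtain ⟨σ, hσ, hσz⟩ : ∃ σ : ℝ, (σ = 1 ∨ σ = -1) ∧ σ * z.re = |z.re| := by
    rcases le_total 0 z.re with h0 | h0
    · exact ⟨1, Or.inl rfl, by rw [one_mul, abs_of_nonneg h0]⟩
    · exact ⟨-1, Or.inr rfl, by rw [abs_of_nonpos h0]; ring⟩
  have hσ' : -σ = 1 ∨ -σ = -1 := by rcases hσ with rfl | rfl <;> simp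
  have hσ1 : |σ| = 1 := by rcases hσ with rfl | rfl <;> simp
  have hw : ‖Complex.I * (w₁ + w₂) / 2‖ ≤ R := by
    rw [norm_div, norm_mul, Complex.norm_I, one_mul, Complex.norm_two, div_le_iff₀ two_pos]
    linarith [norm_add_le w₁ w₂]
  have b1 : ∀ j, ‖GShift w₁ w₂ (z - a j)‖ ≤
      K * ‖gaussExp σ w₁ w₂ (z - a j - Complex.I * (w₁ + w₂) / 2)‖ := by
    intro j
    have hn : ‖-a j - Complex.I * (w₁ + w₂) / 2‖ ≤ B + R := by
      refine (norm_sub_le _ _).trans (add_le_add ?_ hw)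
      rw [norm_neg]; exact ha j
    have e : z - a j - Complex.I * (w₁ + w₂) / 2 = z + (-a j - Complex.I * (w₁ + w₂) / 2) := by ring
    obtain ⟨r1, r2⟩ := abs_re_add_le hσ hn hX (by rw [hσz]; exact hzX)
    rw [GShift, e]
    refine h w₁ w₂ _ h₁ h₂ hw₁ hw₂ ?_ r1 σ hσ r2
    rw [Complex.add_im]
    exact (abs_add_le _ _).trans (add_le_add hz ((Complex.abs_im_le_norm _).trans hn))
  have b2 : ∀ j, ‖GShift w₁ w₂ (b j - z)‖ ≤
      K * ‖gaussExp (-σ) w₁ w₂ (b j - z - Complex.I * (w₁ + w₂) / 2)‖ := by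
    intro j
    have hn : ‖b j - Complex.I * (w₁ + w₂) / 2‖ ≤ B + R :=
      (norm_sub_le _ _).trans (add_le_add (hb j) hw)
    have e : b j - z - Complex.I * (w₁ + w₂) / 2 = -z + (b j - Complex.I * (w₁ + w₂) / 2) := by ring
    obtain ⟨r1, r2⟩ := abs_re_add_le (z := -z) hσ' hn hX (by
      rw [Complex.neg_re, neg_mul_neg, hσz]; exact hzX)
    rw [GShift, e]
    refine h w₁ w₂ _ h₁ h₂ hw₁ hw₂ ?_ r1 (-σ) hσ' r2
    rw [Complex.add_im]
    refine (abs_add_le _ _).trans (add_le_add ?_ ((Complex.abs_im_le_norm _).trans hn))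
    rwa [Complex.neg_im, abs_neg]
  have c1 := norm_prod_le_pow_mul b1
  have c2 := norm_prod_le_pow_mul b2
  rw [Fintype.card_fin] at c1 c2
  have hinv : ∀ w : ℂ, ε ≤ w.re → ‖w⁻¹‖ ≤ ε⁻¹ := by
    intro w hw
    rw [norm_inv]
    exact inv_anti₀ hε (hw.trans (Complex.re_le_norm w))
  -- The real part of `w⁻¹` is at least `ε / R ^ 2`, which is the source of the rate; the imaginary
  -- part of `z` costs only a constant.
  have hre : ∀ w : ℂ, ε ≤ w.re → ‖w‖ ≤ R →
      ε / R ^ 2 * |z.re| - M * ε⁻¹ ≤ σ * (w⁻¹ * z).re := by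
    intro w hw hwR
    have hn0 : 0 < Complex.normSq w := Complex.normSq_pos.2 (ne_zero_of_re_pos (hε.trans_le hw))
    have hns : Complex.normSq w ≤ R ^ 2 := by rw [Complex.normSq_eq_norm_sq]; gcongr
    have i1 : ε / R ^ 2 ≤ (w⁻¹).re := by
      rw [Complex.inv_re]
      exact div_le_div₀ (hε.le.trans hw) hw hn0 hns
    have i2 : |σ * ((w⁻¹).im * z.im)| ≤ ε⁻¹ * M := by
      rw [abs_mul, hσ1, one_mul, abs_mul]
      gcongr
      exact (Complex.abs_im_le_norm _).trans (hinv w hw)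
    have i3 := (abs_le.1 i2).2
    have i4 := mul_le_mul_of_nonneg_right i1 (abs_nonneg z.re)
    rw [Complex.mul_re, mul_sub, ← mul_assoc, mul_comm σ, mul_assoc, hσz]
    linarith
  have hDle : (Complex.I * Real.pi * σ * (w₁⁻¹ * w₂⁻¹) / 2 *
      ∑ j, (a j + b j) * (b j - a j - Complex.I * (w₁ + w₂))).re ≤ D := by
    refine (Complex.re_le_norm _).trans ?_
    rw [hD, norm_mul, norm_div, norm_mul, norm_mul, norm_mul, norm_mul, Complex.norm_I, one_mul,
      Complex.norm_real, Complex.norm_real, Real.norm_eq_abs, Real.norm_eq_abs, hσ1, mul_one,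
      abs_of_pos Real.pi_pos, Complex.norm_two]
    have := hinv w₁ h₁
    have := hinv w₂ h₂
    gcongr
    refine norm_sum_le_of_le _ fun j _ => ?_
    rw [norm_mul]
    have n1 := norm_add_le_of_le (ha j) (hb j)
    have n2 := norm_sub_le_of_le (norm_sub_le_of_le (hb j) (ha j))
      (show ‖Complex.I * (w₁ + w₂)‖ ≤ R + R by
        rw [norm_mul, Complex.norm_I, one_mul]; exact norm_add_le_of_le hw₁ hw₂)
    gcongr
  rw [pairProd, norm_mul]
  calc _ ≤ (K ^ 4 * ‖∏ j, gaussExp σ w₁ w₂ (z - a j - Complex.I * (w₁ + w₂) / 2)‖) *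
        (K ^ 4 * ‖∏ j, gaussExp (-σ) w₁ w₂ (b j - z - Complex.I * (w₁ + w₂) / 2)‖) :=
        mul_le_mul c1 c2 (norm_nonneg _) (by positivity)
    _ = K ^ 4 * K ^ 4 * ‖(∏ j, gaussExp σ w₁ w₂ (z - a j - Complex.I * (w₁ + w₂) / 2)) *
        ∏ j, gaussExp (-σ) w₁ w₂ (b j - z - Complex.I * (w₁ + w₂) / 2)‖ := by
        rw [norm_mul]; ring
    _ ≤ K ^ 4 * K ^ 4 * (Real.exp (D' + D) *
        Real.exp (-(2 * Real.pi * (ε / R ^ 2 + ε / R ^ 2) * |z.re|))) := by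
        rw [prod_gaussExp σ (ne_zero_of_re_pos hp₁) (ne_zero_of_re_pos hp₂) a b z hs,
          Complex.norm_exp, Complex.add_re, ← Real.exp_add]
        refine mul_le_mul_of_nonneg_left (Real.exp_le_exp.2 ?_) (by positivity)
        have e1 : (-(σ * (2 * Real.pi) * (w₁⁻¹ * z + w₂⁻¹ * z)) : ℂ).re =
            -(2 * Real.pi * (σ * (w₁⁻¹ * z).re + σ * (w₂⁻¹ * z).re)) := by
          rw [show (σ * (2 * Real.pi) * (w₁⁻¹ * z + w₂⁻¹ * z) : ℂ) =
            ((σ * (2 * Real.pi) : ℝ) : ℂ) * (w₁⁻¹ * z + w₂⁻¹ * z) by push_cast; ring,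
            Complex.neg_re, Complex.re_ofReal_mul, Complex.add_re]
          ring
        rw [e1]
        have := mul_le_mul_of_nonneg_left (add_le_add (hre w₁ h₁ hw₁) (hre w₂ h₂ hw₂))
          (show 0 ≤ 2 * Real.pi by positivity)
        rw [hD'] at *
        linarith
    _ = _ := by ring

end Decay

/-! ### The algebraic identity that separates lower from upper poles. -/

section Bezout

/-- A product of sums lies in the ideal generated by the two products of the terms. -/
theorem exists_prod_add_eq {A ι κ : Type*} [CommRing A] (S : Subring A) (s : Finset ι)
    (t : Finset κ) {x : ι → A} {y : κ → A} (hx : ∀ i, x i ∈ S) (hy : ∀ j, y j ∈ S) :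
    ∃ α ∈ S, ∃ β ∈ S, ∏ i ∈ s, ∏ j ∈ t, (x i + y j) = α * ∏ i ∈ s, x i + β * ∏ j ∈ t, y j := by
  classical
  -- Modulo `x i` the product is that of the `y j`; multiplying over `i`, every term retains either
  -- all the `x i` or the product of the `y j`.
  have one : ∀ i, ∃ γ ∈ S, ∏ j ∈ t, (x i + y j) = x i * γ + ∏ j ∈ t, y j := by
    intro i
    induction t using Finset.induction_on with
    | empty => exact ⟨0, S.zero_mem, by simp⟩
    | insert k t hk ih =>
      obtain ⟨γ, hγ, h⟩ := ih
      refine ⟨x i * γ + ∏ j ∈ t, y j + y k * γ, S.add_mem (S.add_mem (S.mul_mem (hx i) hγ)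
        (S.prod_mem fun j _ => hy j)) (S.mul_mem (hy k) hγ), ?_⟩
      rw [Finset.prod_insert hk, Finset.prod_insert hk, h]
      ring
  induction s using Finset.induction_on with
  | empty => exact ⟨1, S.one_mem, 0, S.zero_mem, by simp⟩
  | insert i s hi ih =>
    obtain ⟨α, hα, β, hβ, h⟩ := ih
    obtain ⟨γ, hγ, hγe⟩ := one i
    refine ⟨α * γ, S.mul_mem hα hγ, α * (∏ k ∈ s, x k) + β * (x i * γ) + β * ∏ j ∈ t, y j,
      S.add_mem (S.add_mem (S.mul_mem hα (S.prod_mem fun k _ => hx k))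
        (S.mul_mem hβ (S.mul_mem (hx i) hγ))) (S.mul_mem hβ (S.prod_mem fun j _ => hy j)), ?_⟩
    rw [Finset.prod_insert hi, Finset.prod_insert hi, h, hγe]
    ring

variable {E : Type*} [NormedAddCommGroup E] [NormedSpace ℂ E]

/-- The holomorphic functions on `U × ℂ` that are polynomially bounded in the last variable. -/
def polyBounded (U : Set E) : Subring (E × ℂ → ℂ) where
  carrier := {φ | DifferentiableOn ℂ φ (U ×ˢ univ) ∧
    ∃ (C : ℝ) (n : ℕ), ∀ p ∈ U, ∀ z, ‖φ (p, z)‖ ≤ C * (1 + ‖z‖) ^ n}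
  mul_mem' := by
    rintro φ ψ ⟨hφ, C, n, h⟩ ⟨hψ, C', n', h'⟩
    refine ⟨hφ.mul hψ, C * C', n + n', fun p hp z => ?_⟩
    rw [Pi.mul_apply, norm_mul, pow_add, mul_mul_mul_comm]
    exact mul_le_mul (h p hp z) (h' p hp z) (norm_nonneg _) ((norm_nonneg _).trans (h p hp z))
  one_mem' := ⟨differentiableOn_const 1, 1, 0, fun p _ z => by simp⟩
  add_mem' := by
    rintro φ ψ ⟨hφ, C, n, h⟩ ⟨hψ, C', n', h'⟩
    refine ⟨hφ.add hψ, |C| + |C'|, n + n', fun p hp z => ?_⟩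
    have h1 : (1 : ℝ) ≤ 1 + ‖z‖ := by linarith [norm_nonneg z]
    rw [add_mul]
    refine norm_add_le_of_le ((h p hp z).trans ?_) ((h' p hp z).trans ?_)
    · exact mul_le_mul (le_abs_self C) (pow_le_pow_right₀ h1 (by lia)) (by positivity)
        (abs_nonneg _)
    · exact mul_le_mul (le_abs_self C') (pow_le_pow_right₀ h1 (by lia)) (by positivity)
        (abs_nonneg _)
  zero_mem' := ⟨differentiableOn_const 0, 0, 0, fun p _ z => by simp⟩
  neg_mem' := by
    rintro φ ⟨hφ, C, n, h⟩
    exact ⟨hφ.neg, C, n, fun p hp z => by rw [Pi.neg_apply, norm_neg]; exact h p hp z⟩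

theorem one_add_pow_le_exp {c : ℝ} (hc : 0 < c) {M : ℝ} (n : ℕ) :
    ∃ C, 0 < C ∧ ∀ z : ℂ, |z.im| ≤ M → (1 + ‖z‖) ^ n ≤ C * Real.exp (c * |z.re|) := by
  refine ⟨c⁻¹ ^ n * n.factorial * Real.exp (c * (1 + M)), by positivity, fun z hz => ?_⟩
  have h1 : ‖z‖ ≤ |z.re| + M := (Complex.norm_le_abs_re_add_abs_im z).trans (by linarith)
  have h2 := Real.pow_div_factorial_le_exp (c * (1 + ‖z‖)) (by positivity) n
  rw [div_le_iff₀ (by positivity), mul_pow] at h2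
  have h3 : Real.exp (c * (1 + ‖z‖)) ≤ Real.exp (c * (1 + M)) * Real.exp (c * |z.re|) := by
    rw [← Real.exp_add]
    refine Real.exp_le_exp.2 ?_
    nlinarith
  calc (1 + ‖z‖) ^ n = c⁻¹ ^ n * (c ^ n * (1 + ‖z‖) ^ n) := by
        rw [← mul_assoc, ← mul_pow, inv_mul_cancel₀ hc.ne', one_pow, one_mul]
    _ ≤ c⁻¹ ^ n * (Real.exp (c * (1 + M)) * Real.exp (c * |z.re|) * n.factorial) := by
        exact mul_le_mul_of_nonneg_left (h2.trans (mul_le_mul_of_nonneg_right h3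
          (by positivity))) (by positivity)
    _ = _ := by ring

end Bezout

/-! ### Meromorphic continuation of the hypergeometric integral. -/

section Continuation

variable {E : Type*} [NormedAddCommGroup E] [NormedSpace ℂ E]

/-- A bounded holomorphic family of parameters of the hypergeometric integral. -/
structure IsBoundedFamily (U : Set E) (w₁ w₂ : E → ℂ) (a b : Fin 4 → E → ℂ) (ε R B : ℝ) :
    Prop where
  isOpen : IsOpen U
  diff₁ : DifferentiableOn ℂ w₁ U
  diff₂ : DifferentiableOn ℂ w₂ U
  diff_a : ∀ j, DifferentiableOn ℂ (a j) U
  diff_b : ∀ j, DifferentiableOn ℂ (b j) U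
  pos_ε : 0 < ε
  pos_R : 0 < R
  le_re₁ : ∀ p ∈ U, ε ≤ (w₁ p).re
  le_re₂ : ∀ p ∈ U, ε ≤ (w₂ p).re
  norm₁ : ∀ p ∈ U, ‖w₁ p‖ ≤ R
  norm₂ : ∀ p ∈ U, ‖w₂ p‖ ≤ R
  nonneg_B : 0 ≤ B
  norm_a : ∀ p ∈ U, ∀ j, ‖a j p‖ ≤ B
  norm_b : ∀ p ∈ U, ∀ j, ‖b j p‖ ≤ B
  sum_eq : ∀ p ∈ U, ∑ j, (b j p - a j p) = 2 * Complex.I * (w₁ p + w₂ p)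

variable {U : Set E} {w₁ w₂ : E → ℂ} {a b : Fin 4 → E → ℂ} {ε R B : ℝ}

theorem IsBoundedFamily.reflect (h : IsBoundedFamily U w₁ w₂ a b ε R B) :
    IsBoundedFamily U w₁ w₂ (fun j p => -b j p) (fun j p => -a j p) ε R B where
  isOpen := h.isOpen
  diff₁ := h.diff₁
  diff₂ := h.diff₂
  diff_a j := (h.diff_b j).neg
  diff_b j := (h.diff_a j).neg
  pos_ε := h.pos_ε
  pos_R := h.pos_R
  le_re₁ := h.le_re₁
  le_re₂ := h.le_re₂
  norm₁ := h.norm₁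
  norm₂ := h.norm₂
  nonneg_B := h.nonneg_B
  norm_a p hp j := by rw [norm_neg]; exact h.norm_b p hp j
  norm_b p hp j := by rw [norm_neg]; exact h.norm_a p hp j
  sum_eq p hp := by
    rw [← h.sum_eq p hp]
    exact Finset.sum_congr rfl fun j _ => by ring

/-- The linear factors of the product of the `latticeProd`s. -/
def linFactor {X : Type*} (w₁ w₂ : X → ℂ) (a : Fin 4 → X → ℂ) (i : Fin 4 × ℕ × ℕ) : X × ℂ → ℂ :=
  fun q => q.2 - a i.1 q.1 + Complex.I * (i.2.1 * w₁ q.1 + i.2.2 * w₂ q.1)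

theorem differentiableOn_comp_fst {f : E → ℂ} (hf : DifferentiableOn ℂ f U) :
    DifferentiableOn ℂ (fun q : E × ℂ => f q.1) (U ×ˢ univ) :=
  hf.comp differentiableOn_fst fun _ hq => hq.1

theorem IsBoundedFamily.linFactor_mem (h : IsBoundedFamily U w₁ w₂ a b ε R B)
    (i : Fin 4 × ℕ × ℕ) : linFactor w₁ w₂ a i ∈ polyBounded U := by
  refine ⟨?_, 1 + B + (i.2.1 * R + i.2.2 * R), 1, fun p hp z => ?_⟩
  · have d1 := differentiableOn_comp_fst h.diff₁
    have d2 := differentiableOn_comp_fst h.diff₂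
    have d3 := differentiableOn_comp_fst (h.diff_a i.1)
    exact (differentiableOn_snd.fun_sub d3).fun_add
      (((d1.const_mul (i.2.1 : ℂ)).fun_add (d2.const_mul (i.2.2 : ℂ))).const_mul Complex.I)
  · have hR := h.pos_R
    have hB := h.nonneg_B
    have n1 : ‖z - a i.1 p + Complex.I * (i.2.1 * w₁ p + i.2.2 * w₂ p)‖ ≤
        ‖z‖ + B + (i.2.1 * R + i.2.2 * R) := by
      refine norm_add_le_of_le (norm_sub_le_of_le le_rfl (h.norm_a p hp _)) ?_
      rw [norm_mul, Complex.norm_I, one_mul]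
      refine norm_add_le_of_le ?_ ?_
      · rw [norm_mul, Complex.norm_natCast]
        exact mul_le_mul_of_nonneg_left (h.norm₁ p hp) (by positivity)
      · rw [norm_mul, Complex.norm_natCast]
        exact mul_le_mul_of_nonneg_left (h.norm₂ p hp) (by positivity)
    have n2 : 0 ≤ (B + (i.2.1 * R + i.2.2 * R)) * ‖z‖ := by positivity
    rw [pow_one]
    refine n1.trans ?_
    nlinarith

/-- The index set of the linear factors. -/
def factorIndex (K : ℕ) : Finset (Fin 4 × ℕ × ℕ) :=
  Finset.univ ×ˢ Finset.range K ×ˢ Finset.range K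

theorem prod_linFactor {X : Type*} {w₁ w₂ : X → ℂ} {a : Fin 4 → X → ℂ} (K : ℕ) (p : X) (z : ℂ) :
    ∏ i ∈ factorIndex K, linFactor w₁ w₂ a i (p, z) =
      ∏ j, latticeProd K K (w₁ p) (w₂ p) (z - a j p) := by
  rw [factorIndex, Finset.prod_product]
  refine Finset.prod_congr rfl fun j _ => ?_
  rw [Finset.prod_product]
  rfl

theorem IsBoundedFamily.linFactor_ne_zero (h : IsBoundedFamily U w₁ w₂ a b ε R B) {K : ℕ}
    {i : Fin 4 × ℕ × ℕ} (hi : i ∈ factorIndex K) {p : E} (hp : p ∈ U) {z : ℂ}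
    (hz : B + 2 * K * R < |z.re|) : linFactor w₁ w₂ a i (p, z) ≠ 0 := by
  intro h0
  simp only [factorIndex, Finset.mem_product, Finset.mem_univ, Finset.mem_range, true_and] at hi
  have hR := h.pos_R
  have k1 : (i.2.1 : ℝ) ≤ K := by exact_mod_cast hi.1.le
  have k2 : (i.2.2 : ℝ) ≤ K := by exact_mod_cast hi.2.le
  have e : z = a i.1 p - Complex.I * (i.2.1 * w₁ p + i.2.2 * w₂ p) := by
    simp only [linFactor] at h0
    linear_combination h0
  have n1 : ‖z‖ ≤ B + (K * R + K * R) := by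
    rw [e]
    refine norm_sub_le_of_le (h.norm_a p hp _) ?_
    rw [norm_mul, Complex.norm_I, one_mul]
    refine norm_add_le_of_le ?_ ?_
    · rw [norm_mul, Complex.norm_natCast]
      exact mul_le_mul k1 (h.norm₁ p hp) (norm_nonneg _) (by positivity)
    · rw [norm_mul, Complex.norm_natCast]
      exact mul_le_mul k2 (h.norm₂ p hp) (norm_nonneg _) (by positivity)
  linarith [Complex.abs_re_le_norm z]

/-- The factors `latticeProd` remove the lower poles that the contour has to cross. On a line below
every `b j` the integral is holomorphic on all of `U`, wherever the `a j` and `b j` lie; for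
separated parameters Cauchy's theorem brings the line back to the real axis. -/
theorem IsBoundedFamily.exists_integral_lower [FiniteDimensional ℂ E]
    (h : IsBoundedFamily U w₁ w₂ a b ε R B) {K : ℕ}
    (hK : 2 * B + 1 < K * ε) {φ : E × ℂ → ℂ} (hφ : φ ∈ polyBounded U) :
    ∃ H : E → ℂ, DifferentiableOn ℂ H U ∧
      ∀ p ∈ U, (∀ j, (a j p).im < 0 ∧ 0 < (b j p).im) →
        Integrable (fun t : ℝ => φ (p, t) *
          (∏ j, latticeProd K K (w₁ p) (w₂ p) (t - a j p)) *
          pairProd (w₁ p) (w₂ p) (fun j => a j p) (fun j => b j p) t) ∧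
        ∫ t : ℝ, φ (p, t) * (∏ j, latticeProd K K (w₁ p) (w₂ p) (t - a j p)) *
          pairProd (w₁ p) (w₂ p) (fun j => a j p) (fun j => b j p) t = H p := by
  obtain ⟨A, hA, hAe⟩ := exists_GShift_mul_latticeProd K K
  have hB := h.nonneg_B
  have hR := h.pos_R
  have hε := h.pos_ε
  -- As `‖b j‖ ≤ B`, the line `Im z = -M` is below every `b j`. As `M + B < K * ε`, the `K` rows and
  -- columns of cancelled poles reach beyond it.
  set M : ℝ := B + 1 with hM
  have hM0 : 0 ≤ M := by positivity
  set Φ : E → ℂ → ℂ := fun p z => φ (p, z) * (∏ j, A (w₁ p, w₂ p, z - a j p)) *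
    ∏ j, GShift (w₁ p) (w₂ p) (b j p - z) with hΦ
  have hmem : ∀ p ∈ U, ∀ z : ℂ, -M ≤ z.im → ∀ j, (w₁ p, w₂ p, z - a j p) ∈ latticeDomain K K := by
    intro p hp z hz j
    have r1 := h.le_re₁ p hp
    have r2 := h.le_re₂ p hp
    have i1 := (abs_le.1 ((Complex.abs_im_le_norm _).trans (h.norm_a p hp j))).2
    have k1 : (K : ℝ) * ε ≤ K * (w₁ p).re := by gcongr
    have k2 : (K : ℝ) * ε ≤ K * (w₂ p).re := by gcongr
    refine ⟨hε.trans_le r1, hε.trans_le r2, ?_, ?_⟩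
    · show -(K * (w₁ p).re) < (z - a j p).im
      rw [Complex.sub_im]; linarith
    · show -(K * (w₂ p).re) < (z - a j p).im
      rw [Complex.sub_im]; linarith
  have hdiff : ∀ p ∈ U, ∀ z : ℂ, -M ≤ z.im → (∀ j, z.im < (b j p).im) →
      DifferentiableAt ℂ (fun q : E × ℂ => Φ q.1 q.2) (p, z) := by
    intro p hp z hz hzb
    have hU := h.isOpen.mem_nhds hp
    have cf : ∀ f : E → ℂ, DifferentiableOn ℂ f U →
        DifferentiableAt ℂ (fun q : E × ℂ => f q.1) (p, z) := fun f hf =>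
      (hf.differentiableAt hU).comp (f := Prod.fst) (p, z) differentiableAt_fst
    have d1 := cf _ h.diff₁
    have d2 := cf _ h.diff₂
    refine DifferentiableAt.fun_mul (DifferentiableAt.fun_mul ?_ ?_) ?_
    · exact hφ.1.differentiableAt (prod_mem_nhds hU univ_mem)
    · refine differentiableAt_prod _ fun j _ => ?_
      exact (hA.differentiableAt ((isOpen_latticeDomain K K).mem_nhds (hmem p hp z hz j))).comp
        (f := fun q : E × ℂ => (w₁ q.1, w₂ q.1, q.2 - a j q.1)) (p, z)
        (d1.prodMk (d2.prodMk (differentiableAt_snd.fun_sub (cf _ (h.diff_a j)))))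
    · refine differentiableAt_prod _ fun j _ => ?_
      have := differentiableAt_GShift (q := (w₁ p, w₂ p, b j p - z)) (hε.trans_le (h.le_re₁ p hp))
        (hε.trans_le (h.le_re₂ p hp)) (by
          show 0 < (b j p - z).im
          rw [Complex.sub_im]; linarith [hzb j])
      exact this.comp (f := fun q : E × ℂ => (w₁ q.1, w₂ q.1, b j q.1 - q.2)) (p, z)
        (d1.prodMk (d2.prodMk ((cf _ (h.diff_b j)).fun_sub differentiableAt_snd)))
  have heq : ∀ p ∈ U, ∀ z : ℂ, -M ≤ z.im →
      (∀ j, latticeProd K K (w₁ p) (w₂ p) (z - a j p) ≠ 0) →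
      Φ p z = φ (p, z) * (∏ j, latticeProd K K (w₁ p) (w₂ p) (z - a j p)) *
        pairProd (w₁ p) (w₂ p) (fun j => a j p) (fun j => b j p) z := by
    intro p hp z hz hne
    simp only [hΦ, pairProd]
    rw [← Finset.prod_congr rfl fun j _ => hAe _ (hmem p hp z hz j) (hne j),
      Finset.prod_mul_distrib]
    ring
  obtain ⟨C, c, X, hC, hc, hdec⟩ := exists_norm_pairProd_le (M := M) hε hR hB
  have hψ : φ * ∏ i ∈ factorIndex K, linFactor w₁ w₂ a i ∈ polyBounded U :=
    mul_mem hφ (Subring.prod_mem _ fun i _ => h.linFactor_mem i)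
  obtain ⟨-, C', n, hpoly⟩ := hψ
  obtain ⟨C'', hC'', hexp⟩ := one_add_pow_le_exp (M := M) (half_pos hc) n
  -- Past `B + 2 * K * R` no linear factor vanishes, so there `Φ` is `pairProd` times a function of
  -- polynomial growth; half of the exponential rate pays for the latter.
  set Y : ℝ := max X (B + 2 * K * R + 1) with hY
  have hΦdec : ∀ p ∈ U, ∀ z : ℂ, |z.im| ≤ M → Y ≤ |z.re| →
      ‖Φ p z‖ ≤ |C'| * C'' * C * Real.exp (-(c / 2 * |z.re|)) := by
    intro p hp z hz hzY
    have hz1 : X ≤ |z.re| := (le_max_left _ _).trans hzY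
    have hz2 : B + 2 * K * R < |z.re| := by
      have := (le_max_right X (B + 2 * K * R + 1)).trans hzY
      linarith
    rw [heq p hp z (abs_le.1 hz).1 ?_, ← prod_linFactor, norm_mul]
    · have e1 := hpoly p hp z
      rw [Pi.mul_apply, Finset.prod_apply] at e1
      have e2 := hdec (w₁ p) (w₂ p) (fun j => a j p) (fun j => b j p) z (h.le_re₁ p hp)
        (h.le_re₂ p hp) (h.norm₁ p hp) (h.norm₂ p hp) (h.norm_a p hp) (h.norm_b p hp)
        (h.sum_eq p hp) hz hz1
      have e3 : C' * (1 + ‖z‖) ^ n ≤ |C'| * (C'' * Real.exp (c / 2 * |z.re|)) :=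
        mul_le_mul (le_abs_self _) (hexp z hz) (by positivity) (abs_nonneg _)
      calc _ ≤ (|C'| * (C'' * Real.exp (c / 2 * |z.re|))) * (C * Real.exp (-(c * |z.re|))) :=
            mul_le_mul (e1.trans e3) e2 (norm_nonneg _) (by positivity)
        _ = |C'| * C'' * C * (Real.exp (c / 2 * |z.re|) * Real.exp (-(c * |z.re|))) := by ring
        _ = _ := by rw [← Real.exp_add]; congr 2; ring
    · intro j
      refine Finset.prod_ne_zero_iff.2 fun k hk => Finset.prod_ne_zero_iff.2 fun l hl => ?_
      exact h.linFactor_ne_zero (K := K) (i := (j, k, l)) (Finset.mem_product.2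
        ⟨Finset.mem_univ j, Finset.mem_product.2 ⟨hk, hl⟩⟩) hp hz2
  have hc2 := half_pos hc
  have hbim : ∀ p ∈ U, ∀ j, -M < (b j p).im := by
    intro p hp j
    have := (abs_le.1 ((Complex.abs_im_le_norm _).trans (h.norm_b p hp j))).1
    rw [hM]; linarith
  have him : ∀ t : ℝ, ((t : ℂ) + (-M : ℝ) * Complex.I).im = -M := by intro t; simp
  have hre : ∀ t : ℝ, ((t : ℂ) + (-M : ℝ) * Complex.I).re = t := by intro t; simp
  have hline : ∀ p ∈ U, ∀ t : ℝ, DifferentiableAt ℂ (fun q : E × ℂ => Φ q.1 q.2)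
      (p, (t : ℂ) + (-M : ℝ) * Complex.I) := fun p hp t =>
    hdiff p hp _ (him t).ge fun j => by rw [him]; exact hbim p hp j
  have hcont : ∀ p ∈ U, Continuous fun t : ℝ => Φ p (t + (-M : ℝ) * Complex.I) := by
    intro p hp
    refine continuous_iff_continuousAt.2 fun t => ?_
    exact ContinuousAt.comp (f := fun t : ℝ => (p, (t : ℂ) + (-M : ℝ) * Complex.I))
      (hline p hp t).continuousAt (by fun_prop)
  refine ⟨fun p => ∫ t : ℝ, Φ p (t + (-M : ℝ) * Complex.I), ?_, fun p hp hab => ?_⟩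
  · refine differentiableOn_integral h.isOpen (Eventually.of_forall fun t p hp => ?_)
      (fun p hp => (hcont p hp).aestronglyMeasurable) fun p hp => ?_
    · exact ((hline p hp t).comp (f := fun p : E => (p, (t : ℂ) + (-M : ℝ) * Complex.I)) p
        (by fun_prop)).differentiableWithinAt
    · obtain ⟨D, hD⟩ := (isCompact_Icc (a := -Y) (b := Y)).exists_bound_of_continuousOn
        (hcont p hp).continuousOn
      have hloc := (isCompact_Icc (a := -Y) (b := Y)).eventually_forall_of_forall_eventually
        (x₀ := p) (P := fun q t => ‖Φ q (t + (-M : ℝ) * Complex.I)‖ < D + 1) (fun t ht => by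
          have hct : ContinuousAt (fun x : E × ℝ => ‖Φ x.1 (x.2 + (-M : ℝ) * Complex.I)‖) (p, t) :=
            (ContinuousAt.comp (f := fun x : E × ℝ => (x.1, (x.2 : ℂ) + (-M : ℝ) * Complex.I))
              (x := (p, t)) (hline p hp t).continuousAt (by fun_prop)).norm
          exact hct.eventually_lt continuousAt_const (by
            show ‖Φ p (t + (-M : ℝ) * Complex.I)‖ < D + 1
            linarith [hD t ht]))
      refine ⟨_, inter_mem hloc (h.isOpen.mem_nhds hp), fun t =>
        (|C'| * C'' * C + |D + 1| * Real.exp (c / 2 * Y)) * Real.exp (-(c / 2 * |t|)),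
        (integrable_exp_neg_abs hc2).const_mul _, Eventually.of_forall fun t q hq => ?_⟩
      rcases le_or_gt Y |t| with ht | ht
      · have := hΦdec q hq.2 (t + (-M : ℝ) * Complex.I) (by rw [him, abs_neg, abs_of_nonneg hM0])
          (by rwa [hre])
        rw [hre] at this
        refine this.trans (mul_le_mul_of_nonneg_right ?_ (Real.exp_nonneg _))
        linarith [show 0 ≤ |D + 1| * Real.exp (c / 2 * Y) by positivity]
      · have h1 := (hq.1 t (abs_le.1 ht.le)).le.trans (le_abs_self _)
        have h2 : 1 ≤ Real.exp (c / 2 * Y) * Real.exp (-(c / 2 * |t|)) := by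
          rw [← Real.exp_add]
          refine Real.one_le_exp ?_
          have := mul_le_mul_of_nonneg_left ht.le hc2.le
          linarith
        beta_reduce
        rw [add_mul]
        have h3 : 0 ≤ |C'| * C'' * C * Real.exp (-(c / 2 * |t|)) := by positivity
        have h4 : |D + 1| ≤ |D + 1| * Real.exp (c / 2 * Y) * Real.exp (-(c / 2 * |t|)) := by
          rw [mul_assoc]; exact le_mul_of_one_le_right (abs_nonneg _) h2
        linarith
  · have hreal : ∀ t : ℝ, φ (p, t) * (∏ j, latticeProd K K (w₁ p) (w₂ p) (t - a j p)) *
        pairProd (w₁ p) (w₂ p) (fun j => a j p) (fun j => b j p) t = Φ p t := by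
      intro t
      refine (heq p hp t (by simpa using hM0) fun j => ?_).symm
      refine Finset.prod_ne_zero_iff.2 fun k _ => Finset.prod_ne_zero_iff.2 fun l _ h0 => ?_
      have := congrArg Complex.im h0
      rw [Complex.zero_im, Complex.add_im, Complex.sub_im, im_I_mul_lattice, Complex.ofReal_im] at this
      have r1 := hε.trans_le (h.le_re₁ p hp)
      have r2 := hε.trans_le (h.le_re₂ p hp)
      have r3 := (hab j).1
      have : 0 ≤ (k : ℝ) * (w₁ p).re + l * (w₂ p).re := by positivity
      linarith
    simp only [hreal]
    have hd : ∀ z : ℂ, -M ≤ z.im → z.im ≤ 0 → DifferentiableAt ℂ (Φ p) z := fun z hz hz' =>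
      (hdiff p hp z hz fun j => hz'.trans_lt (hab j).2).comp (f := fun z : ℂ => (p, z)) z
        (by fun_prop)
    have hdec' : ∀ z : ℂ, -M ≤ z.im → z.im ≤ 0 → Y ≤ |z.re| →
        ‖Φ p z‖ ≤ |C'| * C'' * C * Real.exp (-(c / 2 * |z.re|)) := fun z hz hz' =>
      hΦdec p hp z (abs_le.2 ⟨hz, hz'.trans hM0⟩)
    have hshift := integral_horizontal_eq (neg_nonpos.2 hM0) hc2 hd hdec'
    refine ⟨integrable_of_continuous_of_decay (C := |C'| * C'' * C) (X := Y) ?_ hc2 ?_, ?_⟩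
    · refine continuous_iff_continuousAt.2 fun t => ?_
      exact ContinuousAt.comp (f := fun t : ℝ => (t : ℂ)) (g := Φ p)
        (hd t (by simpa using hM0) (by simp)).continuousAt (by fun_prop)
    · intro t ht
      have := hdec' t (by simpa using hM0) (by simp) (by simpa using ht)
      simpa using this
    · rw [hshift]
      simp

theorem pairProd_neg (w₁ w₂ : ℂ) (a b : Fin 4 → ℂ) (z : ℂ) :
    pairProd w₁ w₂ (fun j => -b j) (fun j => -a j) (-z) = pairProd w₁ w₂ a b z := by
  rw [pairProd, pairProd, mul_comm]
  congr 1
  · exact Finset.prod_congr rfl fun j _ => by congr 1; ring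
  · exact Finset.prod_congr rfl fun j _ => by congr 1; ring

/-- The hypergeometric integral has a meromorphic continuation to any bounded family. -/
theorem IsBoundedFamily.exists_continuation [FiniteDimensional ℂ E]
    (h : IsBoundedFamily U w₁ w₂ a b ε R B) :
    ∃ H D : E → ℂ, DifferentiableOn ℂ H U ∧ DifferentiableOn ℂ D U ∧
      ∀ p ∈ U, (∀ j, (a j p).im < 0 ∧ 0 < (b j p).im) → D p ≠ 0 ∧
        Integrable (fun t : ℝ =>
          pairProd (w₁ p) (w₂ p) (fun j => a j p) (fun j => b j p) t) ∧
        ∫ t : ℝ, pairProd (w₁ p) (w₂ p) (fun j => a j p) (fun j => b j p) t = H p / D p := by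
  obtain ⟨K, hK⟩ := exists_nat_gt ((2 * B + 1) / ε)
  rw [div_lt_iff₀ h.pos_ε] at hK
  set N : E × ℂ → E × ℂ := fun q => (q.1, -q.2) with hN
  have hrefl : ∀ φ ∈ polyBounded U, (fun q => φ (N q)) ∈ polyBounded U := by
    rintro φ ⟨hφ, C, n, hb⟩
    refine ⟨hφ.comp (f := N) (by rw [hN]; fun_prop) fun q hq => ⟨hq.1, trivial⟩, C, n,
      fun p hp z => ?_⟩
    simpa [hN] using hb p hp (-z)
  -- The factors of the upper poles are the lower ones of the reflected family at `-z`. They contain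
  -- `-z`, so their sums with the factors of the lower poles do not depend on `z`.
  set y : Fin 4 × ℕ × ℕ → E × ℂ → ℂ := fun i q => linFactor w₁ w₂ (fun j p => -b j p) i (N q) with hy
  obtain ⟨α, hα, β, hβ, hbez⟩ := exists_prod_add_eq (polyBounded U) (factorIndex K) (factorIndex K)
    (x := linFactor w₁ w₂ a) (y := y) h.linFactor_mem
    fun i => hrefl _ (h.reflect.linFactor_mem i)
  obtain ⟨H₁, hH₁, hi₁⟩ := h.exists_integral_lower hK hα
  obtain ⟨H₂, hH₂, hi₂⟩ := h.reflect.exists_integral_lower hK (hrefl β hβ)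
  -- Evaluated at `z = 0`, which is immaterial. For separated parameters each factor has positive
  -- imaginary part.
  set D : E → ℂ := fun p => ∏ i ∈ factorIndex K, ∏ j ∈ factorIndex K,
    (linFactor w₁ w₂ a i (p, 0) + y j (p, 0)) with hD
  refine ⟨fun p => H₁ p + H₂ p, D, hH₁.fun_add hH₂, ?_, fun p hp hab => ?_⟩
  · have hmem : (∏ i ∈ factorIndex K, ∏ j ∈ factorIndex K, (linFactor w₁ w₂ a i + y j)) ∈
        polyBounded U :=
      Subring.prod_mem _ fun i _ => Subring.prod_mem _ fun j _ =>
        add_mem (h.linFactor_mem i) (hrefl _ (h.reflect.linFactor_mem j))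
    have := hmem.1.comp (f := fun p : E => (p, (0 : ℂ))) (s := U) (by fun_prop)
      fun p hp => ⟨hp, trivial⟩
    refine this.congr fun p _ => ?_
    simp [hD, Finset.prod_apply]
  · have r1 := h.pos_ε.trans_le (h.le_re₁ p hp)
    have r2 := h.pos_ε.trans_le (h.le_re₂ p hp)
    have hD0 : D p ≠ 0 := by
      refine Finset.prod_ne_zero_iff.2 fun i _ => Finset.prod_ne_zero_iff.2 fun j _ h0 => ?_
      have := congrArg Complex.im h0
      simp only [hy, hN, linFactor] at this
      rw [Complex.zero_im, Complex.add_im, Complex.add_im, Complex.add_im, im_I_mul_lattice,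
        im_I_mul_lattice, Complex.sub_im, Complex.sub_im, Complex.neg_im, Complex.neg_im,
        Complex.zero_im] at this
      have r3 := (hab i.1).1
      have r4 := (hab j.1).2
      have : 0 ≤ (i.2.1 : ℝ) * (w₁ p).re + i.2.2 * (w₂ p).re := by positivity
      have : 0 ≤ (j.2.1 : ℝ) * (w₁ p).re + j.2.2 * (w₂ p).re := by positivity
      linarith
    obtain ⟨I₁, e₁⟩ := hi₁ p hp hab
    obtain ⟨I₂, e₂⟩ := hi₂ p hp fun j => by
      rw [Complex.neg_im, Complex.neg_im]
      exact ⟨by linarith [(hab j).2], by linarith [(hab j).1]⟩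
    set P := pairProd (w₁ p) (w₂ p) (fun j => a j p) (fun j => b j p) with hP
    set f₁ : ℝ → ℂ := fun t => α (p, t) *
      (∏ j, latticeProd K K (w₁ p) (w₂ p) (t - a j p)) * P t with hf₁
    set g₂ : ℝ → ℂ := fun t => β (N (p, t)) *
      (∏ j, latticeProd K K (w₁ p) (w₂ p) (t - -b j p)) *
      pairProd (w₁ p) (w₂ p) (fun j => -b j p) (fun j => -a j p) t with hg₂
    have I₂' : Integrable (fun t : ℝ => g₂ (-t)) := Integrable.comp_neg I₂
    have e₂' : ∫ t : ℝ, g₂ (-t) = H₂ p := by rw [integral_neg_eq_self g₂ volume]; exact e₂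
    -- The Bézout identity times the integrand: `f₁` is free of the relevant lower poles and `g₂`,
    -- after reflection, of the upper ones.
    have key : ∀ t : ℝ, f₁ t + g₂ (-t) = D p * P t := by
      intro t
      have hb := congrFun hbez (p, (t : ℂ))
      simp only [Finset.prod_apply, Pi.add_apply, Pi.mul_apply] at hb
      have hDt : D p = ∏ i ∈ factorIndex K, ∏ j ∈ factorIndex K,
          (linFactor w₁ w₂ a i (p, (t : ℂ)) + y j (p, (t : ℂ))) := by
        refine Finset.prod_congr rfl fun i _ => Finset.prod_congr rfl fun j _ => ?_
        simp only [hy, hN, linFactor]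
        ring
      have hyt : ∏ j ∈ factorIndex K, y j (p, (t : ℂ)) =
          ∏ j, latticeProd K K (w₁ p) (w₂ p) (-(t : ℂ) - -b j p) :=
        prod_linFactor (a := fun j p => -b j p) K p (-(t : ℂ))
      rw [hDt, hb, prod_linFactor, hyt]
      simp only [hf₁, hg₂, hN]
      push_cast
      rw [pairProd_neg, neg_neg, ← hP]
      ring
    have hint : Integrable (fun t : ℝ => D p * P t) := by
      have := Integrable.add I₁ I₂'
      refine this.congr (Eventually.of_forall fun t => ?_)
      exact key t
    have hPi : Integrable (fun t : ℝ => P t) := by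
      have := hint.const_mul (D p)⁻¹
      refine this.congr (Eventually.of_forall fun t => ?_)
      show (D p)⁻¹ * (D p * P t) = P t
      rw [← mul_assoc, inv_mul_cancel₀ hD0, one_mul]
    refine ⟨hD0, hPi, ?_⟩
    show _ = (H₁ p + H₂ p) / D p
    rw [eq_div_iff hD0, mul_comm, ← integral_const_mul, ← e₁, ← e₂', ← integral_add I₁ I₂']
    exact integral_congr_ae (Eventually.of_forall fun t => (key t).symm)

end Continuation

/-! ### Existence of the meromorphic function `ψ`. -/

section Psi

/-- The parameters of the poles of the integrand of `ψ` in the lower half plane. -/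
def lowerPole (j : Fin 4) (p : Params) : ℂ :=
  let w := (p.1 + p.2.1) / 2
  let I := Complex.I
  ![-p.2.2.2.1 - p.2.2.2.2 / 2 - I * w / 2 - I * tau p.2.2.1,
    -p.2.2.2.1 - p.2.2.2.2 / 2 - I * w / 2 + I * tau p.2.2.1,
    p.2.2.2.2 / 2 - I * w / 2 - I * sigma p.2.2.1,
    p.2.2.2.2 / 2 - I * w / 2 + I * sigma p.2.2.1] j

/-- The parameters of the poles of the integrand of `ψ` in the upper half plane. -/
def upperPole (j : Fin 4) (p : Params) : ℂ :=
  let w := (p.1 + p.2.1) / 2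
  let I := Complex.I
  ![-p.2.2.2.1 + p.2.2.2.2 / 2 + I * w / 2 - I * rho p.2.2.1,
    -p.2.2.2.1 + p.2.2.2.2 / 2 + I * w / 2 + I * rho p.2.2.1,
    -p.2.2.2.2 / 2 + I * w / 2 - I * upsilon p.2.2.1,
    -p.2.2.2.2 / 2 + I * w / 2 + I * upsilon p.2.2.1] j

theorem differentiable_lowerPole (j : Fin 4) : Differentiable ℂ (lowerPole j) := by
  unfold lowerPole tau sigma
  fin_cases j <;> simp <;> fun_prop

theorem differentiable_upperPole (j : Fin 4) : Differentiable ℂ (upperPole j) := by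
  unfold upperPole rho upsilon
  fin_cases j <;> simp <;> fun_prop

theorem sum_upperPole_sub_lowerPole (p : Params) :
    ∑ j, (upperPole j p - lowerPole j p) = 2 * Complex.I * (p.1 + p.2.1) := by
  simp [Fin.sum_univ_four, upperPole, lowerPole]
  ring

/-- By `G_neg` the four denominators become factors in `-z`. -/
theorem psiIntegrand_eq_pairProd {w₁ w₂ : ℂ} (h₁ : 0 < w₁.re) (h₂ : 0 < w₂.re) (γ : Fin 4 → ℂ)
    (x l z : ℂ) : psiIntegrand w₁ w₂ γ x l z =
      pairProd w₁ w₂ (fun j => lowerPole j (w₁, w₂, γ, x, l))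
        (fun j => upperPole j (w₁, w₂, γ, x, l)) z := by
  have e : ∀ u v : ℂ, v = -u → (G w₁ w₂ u)⁻¹ = G w₁ w₂ v := fun u v huv => by
    rw [huv, G_neg h₁ h₂]
  have m : ∀ {a b c d : ℂ}, a = b → c = d → a * c = b * d := fun h h' => by rw [h, h']
  rw [psiIntegrand, pairProd, Fin.prod_univ_four, Fin.prod_univ_four, div_eq_mul_inv]
  simp only [Gpm, GShift, mul_inv, ← mul_assoc]
  refine m (m (m (m (m (m (m ?_ ?_) ?_) ?_) ?_) ?_) ?_) ?_
  iterate 4 · congr 1; simp only [lowerPole, Matrix.cons_val]; ring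
  iterate 4 · refine e _ _ ?_; simp only [upperPole, Matrix.cons_val]; ring

/-- The parameters for which the poles of the integrand of `ψ` do not cross the real line. -/
def separatedDomain : Set Params :=
  {p | p ∈ fullDomain ∧ ∀ j, (lowerPole j p).im < 0 ∧ 0 < (upperPole j p).im}

theorem isOpen_fullDomain : IsOpen fullDomain := by
  have h1 : IsOpen {p : Params | 0 < p.1.re} := isOpen_lt (by fun_prop) (by fun_prop)
  have h2 : IsOpen {p : Params | 0 < p.2.1.re} := isOpen_lt (by fun_prop) (by fun_prop)
  exact h1.inter h2

theorem convex_halfSpaces (c : ℝ) : Convex ℝ {p : Params | c < p.1.re ∧ c < p.2.1.re} := by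
  have h1 : Convex ℝ {p : Params | c < p.1.re} :=
    convex_halfSpace_gt ⟨by intros; simp, by intros; simp⟩ c
  have h2 : Convex ℝ {p : Params | c < p.2.1.re} :=
    convex_halfSpace_gt ⟨by intros; simp, by intros; simp⟩ c
  exact h1.inter h2

theorem isOpen_separatedDomain : IsOpen separatedDomain := by
  have h : separatedDomain = fullDomain ∩ ⋂ j, {p | (lowerPole j p).im < 0 ∧
      0 < (upperPole j p).im} := by
    ext p; simp [separatedDomain]
  rw [h]
  refine isOpen_fullDomain.inter (isOpen_iInter_of_finite fun j => ?_)
  have h1 : IsOpen {p : Params | (lowerPole j p).im < 0} :=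
    isOpen_lt (Complex.continuous_im.comp (differentiable_lowerPole j).continuous) (by fun_prop)
  have h2 : IsOpen {p : Params | 0 < (upperPole j p).im} :=
    isOpen_lt (by fun_prop) (Complex.continuous_im.comp (differentiable_upperPole j).continuous)
  exact h1.inter h2

theorem mem_separatedDomain {w₁ w₂ : ℝ} {γ : Fin 4 → ℂ} {x l : ℂ} (h₁ : 0 < w₁) (h₂ : 0 < w₂)
    (hx : |x.im| < zeta w₁ w₂ γ l) : ((w₁, w₂, γ, x, l) : Params) ∈ separatedDomain := by
  have hξ : ∀ r ∈ ({(rho γ).re, (sigma γ).re, (tau γ).re, (upsilon γ).re} : Set ℝ),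
      |r| ≤ xi γ := by
    intro r hr
    simp only [mem_insert_iff, mem_singleton_iff] at hr
    rw [xi]
    rcases hr with rfl | rfl | rfl | rfl
    · exact (le_max_left _ _).trans (le_max_left _ _)
    · exact (le_max_right _ _).trans (le_max_left _ _)
    · exact (le_max_left _ _).trans (le_max_right _ _)
    · exact (le_max_right _ _).trans (le_max_right _ _)
  have r1 := abs_le.1 (hξ (rho γ).re (by simp))
  have r2 := abs_le.1 (hξ (sigma γ).re (by simp))
  have r3 := abs_le.1 (hξ (tau γ).re (by simp))
  have r4 := abs_le.1 (hξ (upsilon γ).re (by simp))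
  have hl := abs_le.1 (le_refl |(l / 2).im|)
  have hx' := abs_le.1 (le_refl |x.im|)
  have hl2 : (l / 2).im = l.im / 2 := by simp
  have hw : (Complex.I * (((w₁ : ℂ) + w₂) / 2) / 2).im = (w₁ + w₂) / 2 / 2 := by
    rw [im_I_mul_half, half_re]; simp
  rw [zeta] at hx
  rw [hl2] at hx hl
  refine ⟨⟨by simpa using h₁, by simpa using h₂⟩, fun j => ?_⟩
  have hn : ∀ u : ℂ, (-u / 2).im = -(u.im / 2) := fun u => by simp [neg_div]
  fin_cases j <;> simp only [lowerPole, upperPole, Matrix.cons_val, Fin.zero_eta, Fin.mk_one,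
    Fin.reduceFinMk, Complex.add_im, Complex.sub_im, Complex.neg_im, Complex.I_mul_im, hw, hl2, hn] <;>
    constructor <;> linarith

theorem isBoundedFamily_poles {U : Set Params} (hU : IsOpen U) {ε R : ℝ} (hε : 0 < ε) (hR : 0 < R)
    (h : ∀ p ∈ U, (ε < p.1.re ∧ ε < p.2.1.re) ∧ ‖p‖ < R) :
    ∃ B, IsBoundedFamily U (fun p => p.1) (fun p => p.2.1) lowerPole upperPole ε R B := by
  have hb : ∀ f : Params → ℂ, Differentiable ℂ f → ∃ B, ∀ p ∈ U, ‖f p‖ ≤ B := by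
    intro f hf
    obtain ⟨B, hB⟩ := (isCompact_closedBall (0 : Params) R).exists_bound_of_continuousOn
      hf.continuous.continuousOn
    exact ⟨B, fun p hp => hB p (mem_closedBall_zero_iff.2 (h p hp).2.le)⟩
  choose B₁ hB₁ using fun j => hb _ (differentiable_lowerPole j)
  choose B₂ hB₂ using fun j => hb _ (differentiable_upperPole j)
  have hle : ∀ j, B₁ j ≤ ∑ j, (|B₁ j| + |B₂ j|) ∧ B₂ j ≤ ∑ j, (|B₁ j| + |B₂ j|) := by
    intro j
    have h0 : |B₁ j| + |B₂ j| ≤ ∑ j, (|B₁ j| + |B₂ j|) := Finset.single_le_sum (f := fun j => |B₁ j| + |B₂ j|) (fun i _ => by positivity)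
      (Finset.mem_univ j)
    have := le_abs_self (B₁ j)
    have := le_abs_self (B₂ j)
    have := abs_nonneg (B₁ j)
    have := abs_nonneg (B₂ j)
    constructor <;> linarith
  refine ⟨∑ j, (|B₁ j| + |B₂ j|), hU, by fun_prop, by fun_prop,
    fun j => (differentiable_lowerPole j).differentiableOn,
    fun j => (differentiable_upperPole j).differentiableOn, hε, hR, fun p hp => (h p hp).1.1.le,
    fun p hp => (h p hp).1.2.le, fun p hp => (norm_fst_le p).trans (h p hp).2.le,
    fun p hp => ((norm_fst_le p.2).trans (norm_snd_le p)).trans (h p hp).2.le,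
    by positivity, fun p hp j => (hB₁ j p hp).trans (hle j).1,
    fun p hp j => (hB₂ j p hp).trans (hle j).2, fun p _ => sum_upperPole_sub_lowerPole p⟩

/-- A point near which the integral representation of `ψ` converges. -/
def basePoint : Params := (1, 1, 0, 0, 0)

/-- An exhaustion of the full domain by bounded convex sets. -/
def exhaustion (n : ℕ) : Set Params :=
  {p | ((1 / (n + 2) : ℝ) < p.1.re ∧ (1 / (n + 2) : ℝ) < p.2.1.re) ∧ ‖p‖ < n + 2}

theorem isOpen_exhaustion (n : ℕ) : IsOpen (exhaustion n) := by
  have h1 : IsOpen {p : Params | (1 / (n + 2) : ℝ) < p.1.re} :=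
    isOpen_lt (by fun_prop) (by fun_prop)
  have h2 : IsOpen {p : Params | (1 / (n + 2) : ℝ) < p.2.1.re} :=
    isOpen_lt (by fun_prop) (by fun_prop)
  have h3 : IsOpen {p : Params | ‖p‖ < n + 2} := isOpen_lt (by fun_prop) (by fun_prop)
  exact (h1.inter h2).inter h3

theorem convex_exhaustion (n : ℕ) : Convex ℝ (exhaustion n) := by
  have h3 : Convex ℝ {p : Params | ‖p‖ < n + 2} := by
    have : {p : Params | ‖p‖ < n + 2} = Metric.ball 0 (n + 2) := by ext; simp
    rw [this]
    exact convex_ball _ _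
  exact (convex_halfSpaces _).inter h3

theorem exhaustion_subset (n : ℕ) : exhaustion n ⊆ fullDomain := fun p hp => by
  have : (0 : ℝ) < 1 / (n + 2) := by positivity
  exact ⟨this.trans hp.1.1, this.trans hp.1.2⟩

theorem exists_mem_exhaustion {p : Params} (hp : p ∈ fullDomain) : ∃ n, p ∈ exhaustion n := by
  obtain ⟨h1, h2⟩ := hp
  obtain ⟨n, hn⟩ := exists_nat_gt (1 / p.1.re + 1 / p.2.1.re + ‖p‖)
  have a1 : 0 < 1 / p.1.re := by positivity
  have a2 : 0 < 1 / p.2.1.re := by positivity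
  have a3 := norm_nonneg p
  refine ⟨n, ⟨?_, ?_⟩, by linarith⟩
  · rw [one_div_lt (by positivity) h1]; linarith
  · rw [one_div_lt (by positivity) h2]; linarith

theorem norm_basePoint : ‖basePoint‖ = 1 := by
  simp [basePoint, Prod.norm_def]

theorem basePoint_mem_exhaustion (n : ℕ) : basePoint ∈ exhaustion n := by
  have h : (1 / (n + 2) : ℝ) < 1 := by
    rw [div_lt_one (by positivity)]
    have : (0 : ℝ) ≤ n := by positivity
    linarith
  refine ⟨⟨by simpa [basePoint] using h, by simpa [basePoint] using h⟩, ?_⟩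
  rw [norm_basePoint]
  have : (0 : ℝ) ≤ n := by positivity
  linarith

theorem basePoint_mem_separatedDomain : basePoint ∈ separatedDomain := by
  have := mem_separatedDomain (w₁ := 1) (w₂ := 1) (γ := 0) (x := 0) (l := 0) one_pos one_pos
    (by norm_num [zeta, xi, rho, sigma, tau, upsilon])
  simpa [basePoint] using this

theorem star_basePoint : star basePoint = basePoint := by
  simp [basePoint, Prod.ext_iff]

/-- Every set of the exhaustion contains `basePoint`, near which each `H n / D n` is the integral.
Cross-multiplied, two such quotients agree near `basePoint`, hence on the convex intersection of
their domains. -/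
theorem exists_isPsi : ∃ f, IsPsi f := by
  have hex : ∀ n : ℕ, ∃ H D : Params → ℂ, DifferentiableOn ℂ H (exhaustion n) ∧
      DifferentiableOn ℂ D (exhaustion n) ∧ ∀ p ∈ exhaustion n, p ∈ separatedDomain → D p ≠ 0 ∧
        Integrable (fun t : ℝ => psiIntegrand p.1 p.2.1 p.2.2.1 p.2.2.2.1 p.2.2.2.2 t) ∧
        ∫ t : ℝ, psiIntegrand p.1 p.2.1 p.2.2.1 p.2.2.2.1 p.2.2.2.2 t = H p / D p := by
    intro n
    obtain ⟨B, hB⟩ := isBoundedFamily_poles (isOpen_exhaustion n) (ε := 1 / (n + 2)) (R := n + 2)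
      (by positivity) (by positivity) fun p hp => hp
    obtain ⟨H, D, hH, hD, h⟩ := hB.exists_continuation
    refine ⟨H, D, hH, hD, fun p hp hs => ?_⟩
    simp only [psiIntegrand_eq_pairProd hs.1.1 hs.1.2]
    exact h p hp hs.2
  choose H D hH hD h using hex
  have hcons : ∀ m n p, p ∈ exhaustion m → p ∈ exhaustion n → D m p ≠ 0 → D n p ≠ 0 →
      H m p / D m p = H n p / D n p := by
    intro m n p hpm hpn hm hn
    have hz := eq_zero_of_eventually_eq_zero ((isOpen_exhaustion m).inter (isOpen_exhaustion n))
      ((convex_exhaustion m).inter (convex_exhaustion n))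
      (k := fun p => H m p * D n p - H n p * D m p)
      ((((hH m).mono inter_subset_left).fun_mul ((hD n).mono inter_subset_right)).fun_sub
        (((hH n).mono inter_subset_right).fun_mul ((hD m).mono inter_subset_left)))
      (p := basePoint) ⟨basePoint_mem_exhaustion m, basePoint_mem_exhaustion n⟩ ?_ p ⟨hpm, hpn⟩
    · rw [div_eq_div_iff hm hn]
      exact sub_eq_zero.1 hz
    · filter_upwards [(isOpen_exhaustion m).mem_nhds (basePoint_mem_exhaustion m),
        (isOpen_exhaustion n).mem_nhds (basePoint_mem_exhaustion n),
        isOpen_separatedDomain.mem_nhds basePoint_mem_separatedDomain] with q hqm hqn hq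
      obtain ⟨a1, -, a2⟩ := h m q hqm hq
      obtain ⟨b1, -, b2⟩ := h n q hqn hq
      rw [a2, div_eq_div_iff a1 b1] at b2
      exact sub_eq_zero.2 b2
  classical
  -- Any admissible `n` gives the same value; the default `0` is taken only where every available `D
  -- n` vanishes.
  set f : Params → ℂ := fun p => if hp : ∃ n, p ∈ exhaustion n ∧ D n p ≠ 0 then
    H hp.choose p / D hp.choose p else 0 with hf
  have hfe : ∀ n p, p ∈ exhaustion n → D n p ≠ 0 → f p = H n p / D n p := by
    intro n p hp hn
    have hp' : ∃ n, p ∈ exhaustion n ∧ D n p ≠ 0 := ⟨n, hp, hn⟩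
    rw [hf]
    simp only
    rw [dif_pos hp']
    exact hcons _ _ p hp'.choose_spec.1 hp hp'.choose_spec.2 hn
  refine ⟨f, fun p hp => ?_, fun w₁ w₂ γ x l h₁ h₂ _ hx => ?_⟩
  · obtain ⟨n, hn⟩ := exists_mem_exhaustion hp
    exact ⟨exhaustion n, isOpen_exhaustion n, hn, exhaustion_subset n, H n, D n, hH n, hD n,
      subset_closure_ne_zero (isOpen_exhaustion n) (convex_exhaustion n) (hD n)
        (basePoint_mem_exhaustion n)
        (h n _ (basePoint_mem_exhaustion n) basePoint_mem_separatedDomain).1,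
      hfe n⟩
  · have hs := mem_separatedDomain h₁ h₂ hx
    obtain ⟨n, hn⟩ := exists_mem_exhaustion hs.1
    obtain ⟨a, b, c⟩ := h n _ hn hs
    exact ⟨b, by rw [hfe n _ hn a]; exact c.symm⟩

theorem isPsi_psi : IsPsi psi := Classical.epsilon_spec exists_isPsi

end Psi

/-! ### Symmetry of `ψ` and `S`. -/

section Duality

theorem convex_fullDomain : Convex ℝ fullDomain := convex_halfSpaces 0

theorem basePoint_mem_fullDomain : basePoint ∈ fullDomain := basePoint_mem_separatedDomain.1

/-- Interchanging the variables and dualizing the parameters. -/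
def swap (p : Params) : Params := (p.1, p.2.1, dual p.2.2.1, p.2.2.2.2, p.2.2.2.1)

theorem dual_apply (γ : Fin 4 → ℂ) :
    dual γ 0 = (γ 0 + γ 1 + γ 2 + γ 3) / 2 ∧ dual γ 1 = (γ 0 + γ 1 - γ 2 - γ 3) / 2 ∧
      dual γ 2 = (γ 0 - γ 1 + γ 2 - γ 3) / 2 ∧ dual γ 3 = (γ 0 - γ 1 - γ 2 + γ 3) / 2 := by
  refine ⟨?_, ?_, ?_, ?_⟩ <;> simp [dual, dotProduct, Fin.sum_univ_four] <;> ring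

theorem dual_dual (γ : Fin 4 → ℂ) : dual (dual γ) = γ := by
  obtain ⟨h0, h1, h2, h3⟩ := dual_apply γ
  obtain ⟨k0, k1, k2, k3⟩ := dual_apply (dual γ)
  ext j
  fin_cases j
  · show dual (dual γ) 0 = γ 0
    rw [k0, h0, h1, h2, h3]; ring
  · show dual (dual γ) 1 = γ 1
    rw [k1, h0, h1, h2, h3]; ring
  · show dual (dual γ) 2 = γ 2
    rw [k2, h0, h1, h2, h3]; ring
  · show dual (dual γ) 3 = γ 3
    rw [k3, h0, h1, h2, h3]; ring

theorem swap_swap (p : Params) : swap (swap p) = p := by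
  simp only [swap, dual_dual]

theorem differentiable_dual : Differentiable ℂ dual := by
  rw [differentiable_pi]
  intro j
  have h : ∀ γ, dual γ j = ![(γ 0 + γ 1 + γ 2 + γ 3) / 2, (γ 0 + γ 1 - γ 2 - γ 3) / 2,
      (γ 0 - γ 1 + γ 2 - γ 3) / 2, (γ 0 - γ 1 - γ 2 + γ 3) / 2] j := by
    intro γ
    obtain ⟨h0, h1, h2, h3⟩ := dual_apply γ
    fin_cases j
    · exact h0
    · exact h1
    · exact h2
    · exact h3
  simp only [h]
  fin_cases j <;> simp <;> fun_prop

theorem differentiable_swap : Differentiable ℂ swap := by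
  have := differentiable_dual
  unfold swap
  fun_prop

theorem isOpenMap_swap : IsOpenMap swap :=
  IsOpenMap.of_sections fun p => ⟨swap, differentiable_swap.continuous.continuousAt, swap_swap p,
    swap_swap⟩

/-- The heart of the duality: `σ` and `τ` are self-dual and keep the arguments of the numerators
after the translation, while the two denominator factors are exchanged along with `ρ` and `υ`. -/
theorem psiIntegrand_dual (w₁ w₂ : ℂ) (γ : Fin 4 → ℂ) (x l z : ℂ) :
    psiIntegrand w₁ w₂ (dual γ) l x z = psiIntegrand w₁ w₂ γ x l (z + (l - x) / 2) := by
  obtain ⟨h1, h2, h3, h4⟩ := dual_interchange γ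
  simp only [psiIntegrand, h1, h2, h3, h4]
  rw [mul_comm (Gpm w₁ w₂ _ (Complex.I * upsilon γ))]
  congr 3 <;> congr 1 <;> ring

theorem eventually_zeta {T : Params → Params} (hT : Continuous T) (hT0 : T basePoint = basePoint) :
    ∀ᶠ q in 𝓝 basePoint, |(T q).2.2.2.1.im| <
      zeta (T q).1.re (T q).2.1.re (T q).2.2.1 (T q).2.2.2.2 := by
  have hc : Continuous fun p : Params => zeta p.1.re p.2.1.re p.2.2.1 p.2.2.2.2 := by
    unfold zeta xi rho sigma tau upsilon
    fun_prop
  have hc' : Continuous fun p : Params => |p.2.2.2.1.im| := by fun_prop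
  refine (hc'.comp hT).continuousAt.eventually_lt (hc.comp hT).continuousAt ?_
  show |(T basePoint).2.2.2.1.im| < _
  simp only [hT0]
  norm_num [basePoint, zeta, xi, rho, sigma, tau, upsilon]

theorem swap_basePoint : swap basePoint = basePoint := by
  obtain ⟨h0, h1, h2, h3⟩ := dual_apply 0
  have : dual 0 = 0 := by simp [dual]
  simp [swap, basePoint, this]

theorem IsPsi.apply {f : Params → ℂ} (hf : IsPsi f) {p : Params} (hp : p ∈ fullDomain)
    (hps : star p = p) (hz : |p.2.2.2.1.im| < zeta p.1.re p.2.1.re p.2.2.1 p.2.2.2.2) :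
    f p = ∫ z : ℝ, psiIntegrand p.1 p.2.1 p.2.2.1 p.2.2.2.1 p.2.2.2.2 z := by
  obtain ⟨w₁, w₂, γ, x, l⟩ := p
  obtain ⟨r₁, rfl⟩ := Complex.conj_eq_iff_real.1 (congrArg Prod.fst hps : star w₁ = w₁)
  obtain ⟨r₂, rfl⟩ := Complex.conj_eq_iff_real.1
    (congrArg (fun p => p.2.1) hps : star w₂ = w₂)
  have h1 : 0 < r₁ := by simpa using hp.1
  have h2 : 0 < r₂ := by simpa using hp.2
  simp only [Complex.ofReal_re] at hz
  exact (hf.2 r₁ r₂ γ x l h1 h2 ((abs_nonneg _).trans_lt hz) hz).2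

/-- `IsPsi` prescribes values only for real periods, so no open set of agreement is given; the
self-adjoint points near `basePoint` suffice. -/
theorem IsPsi.meromorphicEqOn {f g : Params → ℂ} (hf : IsPsi f) (hg : IsPsi g) :
    MeromorphicEqOn f g fullDomain := by
  refine meromorphicEqOn_of_eq_on_real convex_fullDomain hf.1 hg.1 basePoint_mem_fullDomain
    star_basePoint ?_
  filter_upwards [isOpen_fullDomain.mem_nhds basePoint_mem_fullDomain,
    eventually_zeta continuous_id rfl] with p hp hz hps
  rw [hf.apply hp hps hz, hg.apply hp hps hz]

theorem star_swap {p : Params} (hp : star p = p) : star (swap p) = swap p := by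
  obtain ⟨w₁, w₂, γ, x, l⟩ := p
  have h1 : star w₁ = w₁ := congrArg Prod.fst hp
  have h2 : star w₂ = w₂ := congrArg (fun p => p.2.1) hp
  have h3 : star γ = γ := congrArg (fun p => p.2.2.1) hp
  have h4 : star x = x := congrArg (fun p => p.2.2.2.1) hp
  have h5 : star l = l := congrArg (fun p => p.2.2.2.2) hp
  have h6 : star (dual γ) = dual γ := by
    have e : ∀ j, star (γ j) = γ j := fun j => congrFun h3 j
    obtain ⟨k0, k1, k2, k3⟩ := dual_apply γ
    ext j
    rw [Pi.star_apply]
    fin_cases j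
    · show star (dual γ 0) = dual γ 0
      rw [k0]; simp only [star_div₀, star_add, e]; simp
    · show star (dual γ 1) = dual γ 1
      rw [k1]; simp only [star_div₀, star_add, star_sub, e]; simp
    · show star (dual γ 2) = dual γ 2
      rw [k2]; simp only [star_div₀, star_add, star_sub, e]; simp
    · show star (dual γ 3) = dual γ 3
      rw [k3]; simp only [star_div₀, star_add, star_sub, e]; simp
  simp only [swap, Prod.ext_iff, Prod.fst_star, Prod.snd_star]
  exact ⟨h1, h2, h6, h5, h4⟩

theorem preimage_swap_fullDomain : swap ⁻¹' fullDomain = fullDomain := rfl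

theorem psi_meromorphicEqOn_swap :
    MeromorphicEqOn psi (fun p => psi (swap p)) fullDomain := by
  refine meromorphicEqOn_of_eq_on_real convex_fullDomain isPsi_psi.1
    (isPsi_psi.1.comp differentiable_swap isOpenMap_swap preimage_swap_fullDomain)
    basePoint_mem_fullDomain star_basePoint ?_
  filter_upwards [isOpen_fullDomain.mem_nhds basePoint_mem_fullDomain,
    eventually_zeta continuous_id rfl,
    eventually_zeta differentiable_swap.continuous swap_basePoint] with p hp hz hz' hps
  rw [isPsi_psi.apply hp hps hz, isPsi_psi.apply (p := swap p) hp (star_swap hps) hz']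
  obtain ⟨w₁, w₂, γ, x, l⟩ := p
  obtain ⟨x, rfl⟩ := Complex.conj_eq_iff_real.1 (congrArg (fun p => p.2.2.2.1) hps : star x = x)
  obtain ⟨l, rfl⟩ := Complex.conj_eq_iff_real.1 (congrArg (fun p => p.2.2.2.2) hps : star l = l)
  simp only [swap, psiIntegrand_dual]
  -- At self-adjoint points the shift `(l - x) / 2` is real, so no contour has to be moved.
  rw [← integral_add_right_eq_self _ ((l - x) / 2)]
  congr 1
  ext z
  push_cast
  rfl

/-- Each of the sums `γ 0 + γ j` with `j = 1, 2, 3` is invariant under `dual`. -/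
theorem N_dual (w₁ w₂ : ℂ) (γ : Fin 4 → ℂ) : N w₁ w₂ (dual γ) = N w₁ w₂ γ := by
  obtain ⟨h0, h1, h2, h3⟩ := dual_apply γ
  simp only [N, Fin.prod_univ_three]
  have e0 : (0 : Fin 3).succ = (1 : Fin 4) := rfl
  have e1 : (1 : Fin 3).succ = (2 : Fin 4) := rfl
  have e2 : (2 : Fin 3).succ = (3 : Fin 4) := rfl
  rw [e0, e1, e2, h0, h1, h2, h3]
  congr 1
  · congr 1 <;> congr 1 <;> ring
  · congr 1; ring

theorem S_eq_of_psi_eq {p : Params} (h : psi p = psi (swap p)) : S p = S (swap p) := by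
  obtain ⟨w₁, w₂, γ, x, l⟩ := p
  simp only [S, swap] at h ⊢
  rw [N_dual, dual_dual, h]
  congr 1
  ring

/-- The composition of `G` with an affine function that is not constant in one direction. -/
theorem isMeromorphicUnitOn_G_comp {c : Params → ℂ} (hc : Differentiable ℂ c)
    (e : (Fin 4 → ℂ) × ℂ × ℂ)
    (he : ∀ (p : Params) (s : ℂ), c (p.1, p.2.1, p.2.2 + s • e) = c p + s) :
    IsMeromorphicUnitOn (fun p : Params => G p.1 p.2.1 (c p)) fullDomain := by
  refine isMeromorphicUnitOn_G.comp (T := fun p : Params => (p.1, p.2.1, c p)) (by fun_prop)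
    (IsOpenMap.of_sections fun p => ?_) rfl
  -- A continuous section through `p`: the periods are prescribed, and moving along `e` corrects the
  -- argument of `G`.
  refine ⟨fun q => (q.1, q.2.1, p.2.2 + (q.2.2 - c (q.1, q.2.1, p.2.2)) • e), ?_, ?_, ?_⟩
  · have := hc.continuous
    exact Continuous.continuousAt (by fun_prop)
  · simp
  · intro q
    have := he (q.1, q.2.1, p.2.2) (q.2.2 - c (q.1, q.2.1, p.2.2))
    simp only at this ⊢
    rw [this]
    simp

theorem isMeromorphicUnitOn_N :
    IsMeromorphicUnitOn (fun p : Params => N p.1 p.2.1 p.2.2.1) fullDomain := by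
  have h : ∀ j : Fin 3, IsMeromorphicUnitOn (fun p : Params => G p.1 p.2.1
      (Complex.I * p.2.2.1 0 + Complex.I * p.2.2.1 j.succ + Complex.I * ((p.1 + p.2.1) / 2)))
      fullDomain := by
    intro j
    refine isMeromorphicUnitOn_G_comp (by fun_prop) (Pi.single j.succ (-Complex.I), 0, 0)
      fun p s => ?_
    have h0 : (Pi.single j.succ (-Complex.I) : Fin 4 → ℂ) 0 = 0 :=
      Pi.single_eq_of_ne (Fin.succ_ne_zero j).symm _
    simp only [Prod.fst_add, Prod.smul_fst, Pi.add_apply, Pi.smul_apply, smul_eq_mul, h0,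
      Pi.single_eq_same]
    linear_combination (-s) * Complex.I_sq
  simp only [N, Fin.prod_univ_three]
  exact ((h 0).mul (h 1)).mul (h 2)

theorem isMeromorphicUnitOn_Delta :
    IsMeromorphicUnitOn (fun p : Params => Delta p.1 p.2.1 p.2.2.1 p.2.2.2.1) fullDomain := by
  have h : ∀ (k : ℂ) (j : Fin 4), IsMeromorphicUnitOn (fun p : Params =>
      G p.1 p.2.1 (p.2.2.2.1 + k * p.2.2.1 j)) fullDomain := by
    intro k j
    refine isMeromorphicUnitOn_G_comp (by fun_prop) (0, 1, 0) fun p s => ?_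
    simp
    ring
  have := ((h Complex.I 2).mul (h Complex.I 3)).div ((h (-Complex.I) 0).mul (h (-Complex.I) 1))
  simpa only [Delta, neg_mul, ← sub_eq_add_neg] using this

/-- Both arguments are less than `π / 2` in modulus, so the product avoids the cut and the principal
square root is holomorphic. -/
theorem mul_mem_slitPlane {w₁ w₂ : ℂ} (h₁ : 0 < w₁.re) (h₂ : 0 < w₂.re) :
    w₁ * w₂ ∈ Complex.slitPlane := by
  rw [Complex.mem_slitPlane_iff]
  by_contra! h
  obtain ⟨a, b⟩ := h
  rw [Complex.mul_re] at a
  rw [Complex.mul_im] at b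
  have e : (w₁.re * w₂.re - w₁.im * w₂.im) * w₂.re =
      w₁.re * (w₂.re ^ 2 + w₂.im ^ 2) := by linear_combination (-w₂.im) * b
  have : 0 < w₁.re * (w₂.re ^ 2 + w₂.im ^ 2) := by positivity
  nlinarith

theorem isMeromorphicUnitOn_sqrt :
    IsMeromorphicUnitOn (fun p : Params => (p.1 * p.2.1) ^ (1 / 2 : ℂ)) fullDomain := by
  refine IsMeromorphicUnitOn.of_differentiableOn isOpen_fullDomain (fun p hp => ?_) fun p hp => ?_
  · have d : DifferentiableAt ℂ (fun p : Params => p.1 * p.2.1) p := by fun_prop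
    exact (d.cpow_const (mul_mem_slitPlane hp.1 hp.2)).differentiableWithinAt
  · rw [Complex.cpow_def_of_ne_zero (Complex.slitPlane_ne_zero (mul_mem_slitPlane hp.1 hp.2))]
    exact Complex.exp_ne_zero _

theorem isMeromorphicOn_S : IsMeromorphicOn S fullDomain := by
  have hd := (isMeromorphicUnitOn_sqrt.mul isMeromorphicUnitOn_Delta).mul
    (isMeromorphicUnitOn_Delta.comp differentiable_swap isOpenMap_swap preimage_swap_fullDomain)
  have := (isMeromorphicUnitOn_N.isMeromorphicOn.mul isPsi_psi.1).mul hd.inv.isMeromorphicOn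
  have e : S = fun p : Params => N p.1 p.2.1 p.2.2.1 * psi p *
      ((p.1 * p.2.1) ^ (1 / 2 : ℂ) * Delta p.1 p.2.1 p.2.2.1 p.2.2.2.1 *
        Delta (swap p).1 (swap p).2.1 (swap p).2.2.1 (swap p).2.2.2.1)⁻¹ := by
    funext ⟨w₁, w₂, γ, x, l⟩
    exact div_eq_mul_inv _ _
  rw [e]
  exact this

theorem S_meromorphicEqOn_swap : MeromorphicEqOn S (fun p => S (swap p)) fullDomain := by
  obtain ⟨W, hW, hWO, hd, he⟩ := psi_meromorphicEqOn_swap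
  exact ⟨W, hW, hWO, hd, fun p hp => S_eq_of_psi_eq (he hp)⟩

end Duality

end HypGamma

end

/-- The first two conjuncts say that the integral representation of `ψ` does have a meromorphic
continuation to the full domain, and only one; the last two that `S` is a meromorphic function on
the full domain and that `S(γ; x, λ) = S(γ̂; λ, x)` as meromorphic functions there. -/
theorem theorem6p5 :
    HypGamma.IsPsi HypGamma.psi ∧
    (∀ f : HypGamma.Params → ℂ, HypGamma.IsPsi f →
      HypGamma.MeromorphicEqOn f HypGamma.psi HypGamma.fullDomain) ∧
    HypGamma.IsMeromorphicOn HypGamma.S HypGamma.fullDomain ∧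
    HypGamma.MeromorphicEqOn HypGamma.S
      (fun p : HypGamma.Params =>
        match p with
        | (w₁, w₂, γ, x, l) => HypGamma.S (w₁, w₂, HypGamma.dual γ, l, x))
      HypGamma.fullDomain :=
  ⟨HypGamma.isPsi_psi, fun _ hf => hf.meromorphicEqOn HypGamma.isPsi_psi,
    HypGamma.isMeromorphicOn_S, HypGamma.S_meromorphicEqOn_swap⟩
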